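/- **Theorem (existence and uniqueness of Young modules of type $C$).** Let $K$ be a field, $\delta\in K$ with $\delta\neq 0$, and $r\ge 0$. *The algebra.* Let $B=\mathcal B(C_r,\delta)$ be the Brauer algebra of type $C$: its basis consists of the perfect matchings of $2r$ top and $2r$ bottom vertices, each row labelled by $-r,\dots,-1,1,\dots,r$, that are invariant under $v\mapsto -v$; two diagrams are multiplied by concatenation, with a factor $\delta$ for each closed loop. Let $J_m$ be the two-sided ideal generated by the diagrams with at least $m$ horizontal edges in the top row. For $0\le l\le r$ let $e_l\in B$ be $\delta^{-l}$ times the diagram with horizontal edges $\{-i,i\}$, $1\le i\le l$, in both rows and with vertical edges joining $v$ to $v$ for $|v|>l$. *The groups.* Let $W_n$ be the hyperoctahedral group of permutations of $\{\pm1,\dots,\pm n\}$ commuting with $v\mapsto -v$, and $\mathcal W_n=KW_n$. The algebra $\mathcal W_{r-l}$ acts from the left on $e_lB$ and on $e_l(B/J_{l+1})$ through the diagrams of permutations of $\pm(l+1),\dots,\pm r$ that fix $\pm1,\dots,\pm l$. All modules are right modules. For a right $\mathcal W_{r-l}$-module $M$ put $$\operatorname{Ind}_l M=M\otimes_{\mathcal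 W_{r-l}}e_lB,\qquad \operatorname{ind}_l M=M\otimes_{\mathcal W_{r-l}}e_l(B/J_{l+1}).$$ *Modules of $\mathcal W_n$.* For a bipartition $\lambda=(\lambda^1,\lambda^2)$ of $n$, a $\lambda$-bitableau $t=(t^1,t^2)$ is a filling of the boxes of the two Young diagrams by elements of $\{\pm1,\dots,\pm n\}$ with distinct absolute values. Its row group consists of the elements of $W_n$ that permute the entries in each row and may in addition change signs of entries of $t^2$; its column group $C_t$ consists of those that permute the entries in each column and may in addition change signs of entries of $t^1$. The permutation module $M(\lambda)$ has as basis the bitabloids $\{t\}$, that is, the classes of bitableaux under their row groups. The Specht module $S(\lambda)\subseteq M(\lambda)$ is spanned by the elements $\{t\}\sum_{\sigma\in C_t}\operatorname{sgn}(\sigma)\,\sigma$, where $\operatorname{sgn}(\sigma)$ is $(-1)^{x}$ times the sign of the permutation $|\sigma|$ of $\{1,\dots,n\}$ induced by $\sigma$, and $x$ is the number of $i\in\{1,\dots,n\}$ with $\sigma(i)<0$. The Young module $Y(\lambda)$ is an indecomposable direct summand of $M(\lambda)$ that contains $S(\lambda)$. *Claim.* Let $0\le l\le r$, let $\lambda$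 be a bipartition of $r-l$, and put $M(l,\lambda)=\operatorname{Ind}_lM(\lambda)$. Then a Young module $Y(\lambda)$ as above exists, and for every choice of it the following hold. 1. The $B$-module $M(l,\lambda)$ has an indecomposable direct summand with a quotient isomorphic to $\operatorname{ind}_lY(\lambda)$, and any two such summands are isomorphic. 2. In every decomposition of $M(l,\lambda)$ as a finite direct sum of indecomposable submodules there is exactly one summand with a quotient isomorphic to $\operatorname{ind}_lY(\lambda)$. This summand, unique up to isomorphism, is called the Young module $Y(l,\lambda)$ of $B$. -/

import Mathlib

namespace TypeC

/-! ### Stacking set partitions -/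

section Stacking

open Relation

variable {V : Type*}

/-- Relation generated on the vertices of three rows (top, middle, bottom) when the two-row
graph `a` occupies the upper two rows and `b` the lower two rows. -/
def stackStep (a b : V ⊕ V → V ⊕ V → Prop) : V ⊕ (V ⊕ V) → V ⊕ (V ⊕ V) → Prop :=
  fun u v => Relation.Map a (Sum.map id Sum.inl) (Sum.map id Sum.inl) u v ∨
    Relation.Map b Sum.inr Sum.inr u v

/-- Connectivity in the three-row graph obtained by placing `a` on top of `b`. -/
def stack (a b : Setoid (V ⊕ V)) : Setoid (V ⊕ (V ⊕ V)) :=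
  EqvGen.setoid (stackStep a b)

/-- Inclusion of the outer two rows into three rows. -/
def outer : V ⊕ V → V ⊕ (V ⊕ V) := Sum.map id Sum.inr

/-- Connectivity between outer vertices in the three-row graph. -/
def compRel (a b : Setoid (V ⊕ V)) : Setoid (V ⊕ V) := (stack a b).comap outer

/-- The components of an equivalence relation that avoid the set `O`. -/
def Avoid {U : Type*} (s : Setoid U) (O : Set U) : Type _ :=
  {c : Quotient s // ∀ u ∈ O, Quotient.mk s u ≠ c}

/-- The number of components of the three-row graph lying entirely in the middle row
(the closed loops). -/
noncomputable def loops (a b : Setoid (V ⊕ V)) : ℕ :=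
  Nat.card (Avoid (stack a b) (Set.range outer))

section Elim

variable {U A T : Type*} {i : A → U} {j : T → U} (r : A → A → Prop) (q : T → T → Prop)

def bigSetoid (i : A → U) (j : T → U) (r : A → A → Prop) (q : T → T → Prop) : Setoid U :=
  EqvGen.setoid fun u v => Relation.Map r i i u v ∨ Relation.Map q j j u v

def smallSetoid (i : A → U) (j : T → U) (r : A → A → Prop) (q : T → T → Prop) : Setoid T :=
  EqvGen.setoid fun x y => (∃ x' y', i x' = j x ∧ i y' = j y ∧ EqvGen r x' y') ∨ q x y

theorem big_of_eqvGen {x y : A} (h : EqvGen r x y) : bigSetoid i j r q (i x) (i y) := by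
  induction h with
  | rel x y h => exact EqvGen.rel _ _ (Or.inl ⟨x, y, h, rfl, rfl⟩)
  | refl x => exact EqvGen.refl _
  | symm x y _ ih => exact EqvGen.symm _ _ ih
  | trans x y z _ _ h1 h2 => exact EqvGen.trans _ _ _ h1 h2

theorem big_of_small {x y : T} (h : smallSetoid i j r q x y) :
    bigSetoid i j r q (j x) (j y) := by
  induction h with
  | rel x y h =>
    rcases h with ⟨x', y', hx, hy, h⟩ | h
    · rw [← hx, ← hy]; exact big_of_eqvGen r q h
    · exact EqvGen.rel _ _ (Or.inr ⟨x, y, h, rfl, rfl⟩)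
  | refl x => exact EqvGen.refl _
  | symm x y _ ih => exact EqvGen.symm _ _ ih
  | trans x y z _ _ h1 h2 => exact EqvGen.trans _ _ _ h1 h2

/-- Induction principle for one endpoint. -/
theorem eqvGen_invariant {X : Type*} {r : X → X → Prop} {P : X → Prop}
    (h : ∀ x y, r x y → (P x ↔ P y)) {x y : X} (hxy : EqvGen r x y) : P x ↔ P y := by
  induction hxy with
  | rel x y hr => exact h x y hr
  | refl x => exact Iff.rfl
  | symm x y _ ih => exact ih.symm
  | trans x y z _ _ h1 h2 => exact h1.trans h2

theorem small_iff_big (hi : Function.Injective i) (hj : Function.Injective j) {x y : T} :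
    smallSetoid i j r q x y ↔ bigSetoid i j r q (j x) (j y) := by
  refine ⟨big_of_small r q, fun h => ?_⟩
  let P : U → Prop := fun u => ∃ z, smallSetoid i j r q x z ∧
    (u = j z ∨ ∃ z' u', i z' = j z ∧ i u' = u ∧ EqvGen r z' u')
  have key : ∀ u, P u → ∀ z, u = j z → smallSetoid i j r q x z := by
    rintro u ⟨w, hw, h | ⟨z', u', h1, h2, h3⟩⟩ z hz
    · have := hj (h.symm.trans hz); subst this; exact hw
    · exact EqvGen.trans _ _ _ hw (EqvGen.rel _ _ (Or.inl ⟨z', u', h1, h2.trans hz, h3⟩))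
  have inv1 : ∀ u v, r u v ∨ r v u → P (i u) → P (i v) := by
    rintro u v huv ⟨w, hw, h⟩
    have huv' : EqvGen r u v := huv.elim (EqvGen.rel _ _) fun h => EqvGen.symm _ _ (EqvGen.rel _ _ h)
    rcases h with h | ⟨z', u', h1, h2, h3⟩
    · exact ⟨w, hw, Or.inr ⟨u, v, h, rfl, huv'⟩⟩
    · obtain rfl := hi h2
      exact ⟨w, hw, Or.inr ⟨z', v, h1, rfl, h3.trans _ _ _ huv'⟩⟩
  have hP : P (j x) ↔ P (j y) := by
    refine eqvGen_invariant ?_ h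
    rintro u v (⟨u, v, h, rfl, rfl⟩ | ⟨u, v, h, rfl, rfl⟩)
    · exact ⟨inv1 u v (Or.inl h), inv1 v u (Or.inr h)⟩
    · constructor
      · intro hu
        exact ⟨v, (key _ hu u rfl).trans _ _ _ (EqvGen.rel _ _ (Or.inr h)), Or.inl rfl⟩
      · intro hu
        exact ⟨u, (key _ hu v rfl).trans _ _ _ (EqvGen.symm _ _ (EqvGen.rel _ _ (Or.inr h))),
          Or.inl rfl⟩
  exact key _ (hP.1 ⟨x, EqvGen.refl _, Or.inl rfl⟩) y rfl

/-- A component of `r` disjoint from the image of `T` stays a component of the whole graph. -/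
theorem closed_component (hi : Function.Injective i) {x : A}
    (hx : ∀ w ∈ i ⁻¹' Set.range j, ¬ EqvGen r w x) {u : U} (h : bigSetoid i j r q (i x) u) :
    ∃ x', i x' = u ∧ EqvGen r x x' := by
  let P : U → Prop := fun u => ∃ x', i x' = u ∧ EqvGen r x x'
  have inv1 : ∀ u v, r u v ∨ r v u → P (i u) → P (i v) := by
    rintro u v huv ⟨w, hw, h⟩
    have huv' : EqvGen r u v := huv.elim (EqvGen.rel _ _) fun h => EqvGen.symm _ _ (EqvGen.rel _ _ h)
    obtain rfl := hi hw
    exact ⟨v, rfl, h.trans _ _ _ huv'⟩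
  have no : ∀ t, ¬ P (j t) := by
    rintro t ⟨x', h1, h2⟩
    exact hx x' ⟨t, h1.symm⟩ (EqvGen.symm _ _ h2)
  have hP : P (i x) ↔ P u := by
    refine eqvGen_invariant ?_ h
    rintro u v (⟨u, v, h, rfl, rfl⟩ | ⟨u, v, h, rfl, rfl⟩)
    · exact ⟨inv1 u v (Or.inl h), inv1 v u (Or.inr h)⟩
    · exact iff_of_false (no u) (no v)
  exact hP.1 ⟨x, rfl, EqvGen.refl _⟩

theorem card_avoid [Finite A] [Finite T] (hi : Function.Injective i) (hj : Function.Injective j)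
    (cover : ∀ u, u ∈ Set.range i ∨ u ∈ Set.range j) (O : Set T) :
    Nat.card (Avoid (bigSetoid i j r q) (j '' O)) =
      Nat.card (Avoid (EqvGen.setoid r) (i ⁻¹' Set.range j)) +
      Nat.card (Avoid (smallSetoid i j r q) O) := by
  have : Finite (Avoid (EqvGen.setoid r) (i ⁻¹' Set.range j)) := Subtype.finite
  have : Finite (Avoid (smallSetoid i j r q) O) := Subtype.finite
  rw [← Nat.card_sum]
  symm
  have cc : ∀ x : A, (∀ w ∈ i ⁻¹' Set.range j,
      Quotient.mk (EqvGen.setoid r) w ≠ Quotient.mk (EqvGen.setoid r) x) →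
      ∀ w ∈ i ⁻¹' Set.range j, ¬ EqvGen r w x :=
    fun x h w hw h' => h w hw (Quotient.sound (s := EqvGen.setoid r) h')
  let f1 : Quotient (EqvGen.setoid r) → Quotient (bigSetoid i j r q) :=
    Quotient.map i fun _ _ h => big_of_eqvGen r q h
  let f2 : Quotient (smallSetoid i j r q) → Quotient (bigSetoid i j r q) :=
    Quotient.map j fun _ _ h => big_of_small r q h
  have h1 : ∀ c : Avoid (EqvGen.setoid r) (i ⁻¹' Set.range j), ∀ t : T,
      Quotient.mk (bigSetoid i j r q) (j t) ≠ f1 c.1 := by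
    rintro ⟨c, hc⟩ t h
    induction c using Quotient.inductionOn with | _ x
    have h := Quotient.exact (s := bigSetoid i j r q) h.symm
    obtain ⟨x', h1, h2⟩ := closed_component r q hi (cc x hc) h
    exact hc x' ⟨t, h1.symm⟩ (Quotient.sound (s := EqvGen.setoid r) (EqvGen.symm _ _ h2))
  have h2 : ∀ c : Avoid (smallSetoid i j r q) O, ∀ u ∈ j '' O,
      Quotient.mk (bigSetoid i j r q) u ≠ f2 c.1 := by
    rintro ⟨c, hc⟩ _ ⟨t, ht, rfl⟩ h
    induction c using Quotient.inductionOn with | _ x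
    have h := Quotient.exact (s := bigSetoid i j r q) h
    exact hc t ht (Quotient.sound (s := smallSetoid i j r q) ((small_iff_big r q hi hj).2 h))
  refine Nat.card_congr (Equiv.ofBijective (Sum.elim
    (fun c => ⟨f1 c.1, by rintro _ ⟨t, _, rfl⟩; exact h1 c t⟩) (fun c => ⟨f2 c.1, h2 c⟩)) ⟨?_, ?_⟩)
  · rintro (⟨c, hc⟩ | ⟨c, hc⟩) (⟨d, hd⟩ | ⟨d, hd⟩) h
    · induction c using Quotient.inductionOn with | _ x
      induction d using Quotient.inductionOn with | _ y
      have h := Quotient.exact (s := bigSetoid i j r q) (Subtype.ext_iff.1 h)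
      obtain ⟨x', h1, h2⟩ := closed_component r q hi (cc x hc) h
      obtain rfl := hi h1
      exact congrArg Sum.inl (Subtype.ext (Quotient.sound (s := EqvGen.setoid r) h2))
    · induction d using Quotient.inductionOn with | _ y
      exact absurd (Subtype.ext_iff.1 h).symm (h1 ⟨c, hc⟩ y)
    · induction c using Quotient.inductionOn with | _ y
      exact absurd (Subtype.ext_iff.1 h) (h1 ⟨d, hd⟩ y)
    · induction c using Quotient.inductionOn with | _ x
      induction d using Quotient.inductionOn with | _ y
      have h := Quotient.exact (s := bigSetoid i j r q) (Subtype.ext_iff.1 h)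
      exact congrArg Sum.inr (Subtype.ext (Quotient.sound (s := smallSetoid i j r q)
        ((small_iff_big r q hi hj).2 h)))
  · rintro ⟨c, hc⟩
    by_cases hT : ∃ t : T, Quotient.mk (bigSetoid i j r q) (j t) = c
    · obtain ⟨t, rfl⟩ := hT
      refine ⟨Sum.inr ⟨Quotient.mk _ t, fun u hu h => hc (j u) ⟨u, hu, rfl⟩ ?_⟩, rfl⟩
      exact Quotient.sound (s := bigSetoid i j r q) (big_of_small r q (Quotient.exact h))
    · induction c using Quotient.inductionOn with | _ u
      rcases cover u with ⟨x, rfl⟩ | ⟨t, rfl⟩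
      · refine ⟨Sum.inl ⟨Quotient.mk _ x, ?_⟩, rfl⟩
        rintro w ⟨t, ht⟩ h
        refine hT ⟨t, ?_⟩
        rw [ht]
        exact Quotient.sound (s := bigSetoid i j r q)
          (big_of_eqvGen r q (Quotient.exact (s := EqvGen.setoid r) h))
      · exact absurd ⟨t, rfl⟩ hT

end Elim

/-- Connectivity in the four-row graph. -/
def stack4 (a b c : Setoid (V ⊕ V)) : Setoid (V ⊕ (V ⊕ (V ⊕ V))) :=
  EqvGen.setoid fun u v =>
    Relation.Map a (Sum.map id Sum.inl) (Sum.map id Sum.inl) u v ∨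
    Relation.Map b (Sum.inr ∘ Sum.map id Sum.inl) (Sum.inr ∘ Sum.map id Sum.inl) u v ∨
    Relation.Map c (Sum.inr ∘ Sum.inr) (Sum.inr ∘ Sum.inr) u v

theorem relMap_or {X Y : Type*} (p q : X → X → Prop) (f : X → Y) (u v : Y) :
    Relation.Map (fun x y => p x y ∨ q x y) f f u v ↔
      Relation.Map p f f u v ∨ Relation.Map q f f u v := by
  simp only [Relation.Map]; grind

theorem relMap_map {X Y Z : Type*} (p : X → X → Prop) (f : X → Y) (g : Y → Z) :
    Relation.Map (Relation.Map p f f) g g = Relation.Map p (g ∘ f) (g ∘ f) :=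
  Relation.map_map ..

theorem stack4_left (a b c : Setoid (V ⊕ V)) :
    stack4 a b c = bigSetoid (Sum.map id (Sum.map id Sum.inl)) (Sum.map id Sum.inr)
      (stackStep a b) (Relation.Map c Sum.inr Sum.inr) := by
  have e1 : (Sum.map id (Sum.map id Sum.inl) ∘ Sum.map id Sum.inl :
      V ⊕ V → V ⊕ (V ⊕ (V ⊕ V))) = Sum.map id Sum.inl := by
    funext x; rcases x with x | x <;> rfl
  have e2 : (Sum.map id (Sum.map id Sum.inl) ∘ Sum.inr :
      V ⊕ V → V ⊕ (V ⊕ (V ⊕ V))) = Sum.inr ∘ Sum.map id Sum.inl := rfl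
  have e3 : (Sum.map id Sum.inr ∘ Sum.inr : V ⊕ V → V ⊕ (V ⊕ (V ⊕ V))) = Sum.inr ∘ Sum.inr := rfl
  unfold stack4 bigSetoid
  congr 1
  funext u v
  unfold stackStep
  rw [relMap_or, relMap_map, relMap_map, relMap_map, or_assoc, e1, e2, e3]

theorem stack4_right (a b c : Setoid (V ⊕ V)) :
    stack4 a b c = bigSetoid Sum.inr (Sum.map id (Sum.map id Sum.inr))
      (stackStep b c) (Relation.Map a (Sum.map id Sum.inl) (Sum.map id Sum.inl)) := by
  have e1 : (Sum.map id (Sum.map id Sum.inr) ∘ Sum.map id Sum.inl :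
      V ⊕ V → V ⊕ (V ⊕ (V ⊕ V))) = Sum.map id Sum.inl := by
    funext x; rcases x with x | x <;> rfl
  unfold stack4 bigSetoid
  congr 1
  funext u v
  unfold stackStep
  rw [relMap_or, relMap_map, relMap_map, relMap_map, e1]
  exact propext or_comm |>.trans (propext or_assoc) |>.trans
    (by rw [or_comm (b := Relation.Map a _ _ _ _)]; grind)

theorem small_left (a b c : Setoid (V ⊕ V)) :
    smallSetoid (Sum.map id (Sum.map id Sum.inl)) (Sum.map id Sum.inr : _ → V ⊕ (V ⊕ (V ⊕ V)))
      (stackStep a b) (Relation.Map c Sum.inr Sum.inr) = stack (compRel a b) c := by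
  unfold smallSetoid stack stackStep
  congr 1
  funext x y
  refine congrArg (· ∨ _) (propext ⟨?_, ?_⟩)
  · rintro ⟨x', y', hx, hy, h⟩
    rcases x with x | x | x <;> rcases x' with x' | x' | x' <;> simp at hx <;>
    rcases y with y | y | y <;> rcases y' with y' | y' | y' <;> simp at hy <;> subst hx hy
    · exact ⟨.inl _, .inl _, h, rfl, rfl⟩
    · exact ⟨.inl _, .inr _, h, rfl, rfl⟩
    · exact ⟨.inr _, .inl _, h, rfl, rfl⟩
    · exact ⟨.inr _, .inr _, h, rfl, rfl⟩
  · rintro ⟨x', y', h, rfl, rfl⟩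
    refine ⟨outer x', outer y', ?_, ?_, h⟩
    · rcases x' with x | x <;> rfl
    · rcases y' with x | x <;> rfl

theorem small_right (a b c : Setoid (V ⊕ V)) :
    smallSetoid Sum.inr (Sum.map id (Sum.map id Sum.inr) : _ → V ⊕ (V ⊕ (V ⊕ V)))
      (stackStep b c) (Relation.Map a (Sum.map id Sum.inl) (Sum.map id Sum.inl)) =
      stack a (compRel b c) := by
  unfold smallSetoid stack stackStep
  congr 1
  funext x y
  refine (propext or_comm).trans (congrArg (_ ∨ ·) (propext ⟨?_, ?_⟩))
  · rintro ⟨x', y', hx, hy, h⟩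
    rcases x with x | x | x <;> rcases x' with x' | x' | x' <;> simp at hx <;>
    rcases y with y | y | y <;> rcases y' with y' | y' | y' <;> simp at hy <;> subst hx hy
    · exact ⟨.inl _, .inl _, h, rfl, rfl⟩
    · exact ⟨.inl _, .inr _, h, rfl, rfl⟩
    · exact ⟨.inr _, .inl _, h, rfl, rfl⟩
    · exact ⟨.inr _, .inr _, h, rfl, rfl⟩
  · rintro ⟨x', y', h, rfl, rfl⟩
    refine ⟨outer x', outer y', ?_, ?_, h⟩
    · rcases x' with x | x <;> rfl
    · rcases y' with x | x <;> rfl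

theorem inj_l : Function.Injective (Sum.map id (Sum.map id Sum.inl) :
    V ⊕ (V ⊕ V) → V ⊕ (V ⊕ (V ⊕ V))) :=
  Function.injective_id.sumMap (Function.injective_id.sumMap Sum.inl_injective)

theorem inj_m : Function.Injective (Sum.map id Sum.inr :
    V ⊕ (V ⊕ V) → V ⊕ (V ⊕ (V ⊕ V))) :=
  Function.injective_id.sumMap Sum.inr_injective

theorem inj_r : Function.Injective (Sum.map id (Sum.map id Sum.inr) :
    V ⊕ (V ⊕ V) → V ⊕ (V ⊕ (V ⊕ V))) :=
  Function.injective_id.sumMap (Function.injective_id.sumMap Sum.inr_injective)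

theorem compRel_assoc (a b c : Setoid (V ⊕ V)) :
    compRel (compRel a b) c = compRel a (compRel b c) := by
  ext u v
  change stack (compRel a b) c (outer u) (outer v) ↔ stack a (compRel b c) (outer u) (outer v)
  rw [← small_left, ← small_right, small_iff_big _ _ inj_l inj_m,
    small_iff_big _ _ Sum.inr_injective inj_r, ← stack4_left, ← stack4_right]
  rcases u with u | u <;> rcases v with v | v <;> rfl

theorem loops_assoc [Finite V] (a b c : Setoid (V ⊕ V)) :
    loops a b + loops (compRel a b) c = loops b c + loops a (compRel b c) := by
  have hl := card_avoid (stackStep a b) (Relation.Map c Sum.inr Sum.inr)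
    (inj_l (V := V)) inj_m (by rintro (u | u | u | u) <;> simp) (Set.range outer)
  have hr := card_avoid (stackStep b c) (Relation.Map a (Sum.map id Sum.inl) (Sum.map id Sum.inl))
    (Sum.inr_injective (α := V)) (inj_r (V := V)) (by rintro (u | u | u | u) <;> simp)
    (Set.range outer)
  have e1 : (Sum.map id (Sum.map id Sum.inl) : V ⊕ (V ⊕ V) → V ⊕ (V ⊕ (V ⊕ V))) ⁻¹'
      Set.range (Sum.map id Sum.inr : V ⊕ (V ⊕ V) → V ⊕ (V ⊕ (V ⊕ V))) = Set.range outer := by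
    ext (u | u | u) <;> simp [outer]
  have e2 : (Sum.inr : V ⊕ (V ⊕ V) → V ⊕ (V ⊕ (V ⊕ V))) ⁻¹'
      Set.range (Sum.map id (Sum.map id Sum.inr) : V ⊕ (V ⊕ V) → V ⊕ (V ⊕ (V ⊕ V))) =
      Set.range outer := by
    ext (u | u | u) <;> simp [outer]
  have e3 : (Sum.map id Sum.inr : V ⊕ (V ⊕ V) → V ⊕ (V ⊕ (V ⊕ V))) '' Set.range outer =
      (Sum.map id (Sum.map id Sum.inr)) '' Set.range outer := by
    rw [← Set.range_comp, ← Set.range_comp]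
    congr 1
    funext u
    rcases u with u | u <;> rfl
  rw [small_left, ← stack4_left, e1] at hl
  rw [small_right, ← stack4_right, e2, ← e3] at hr
  exact hl.symm.trans hr

/-- Connectivity in the diagram of a permutation: the bottom vertex `v` is joined to the top
vertex `σ v`. -/
def permRel (σ : Equiv.Perm V) : Setoid (V ⊕ V) := Setoid.ker (Sum.elim id σ)

theorem permRel_iff (σ : Equiv.Perm V) (u v : V ⊕ V) :
    permRel σ u v ↔ Sum.elim id σ u = Sum.elim id σ v := Iff.rfl

theorem stack_permRel_left (σ : Equiv.Perm V) (a : Setoid (V ⊕ V)) :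
    stack (permRel σ) a = a.comap (Sum.elim (Sum.inl ∘ σ.symm) id) := by
  ext u v
  constructor
  · intro h
    induction h with
    | rel x y h =>
      rcases h with ⟨p, q, h, rfl, rfl⟩ | ⟨p, q, h, rfl, rfl⟩
      · rw [permRel_iff] at h
        rw [Setoid.comap_rel]
        have e : ∀ p : V ⊕ V, (Sum.elim (Sum.inl ∘ σ.symm) id (Sum.map id Sum.inl p) : V ⊕ V) =
            Sum.inl (σ.symm (Sum.elim id σ p)) := by
          rintro (p | p) <;> simp
        rw [e, e, h]
      · exact h
    | refl x => exact a.refl' _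
    | symm x y _ ih => exact a.symm' ih
    | trans x y z _ _ h1 h2 => exact a.trans' h1 h2
  · intro h
    have key : ∀ u, stack (permRel σ) a u (Sum.inr (Sum.elim (Sum.inl ∘ σ.symm) id u)) := by
      rintro (u | u)
      · exact EqvGen.rel _ _ (Or.inl ⟨.inl u, .inr (σ.symm u), by simp [permRel_iff], rfl, rfl⟩)
      · exact EqvGen.refl _
    exact (stack _ _).trans' (key u) ((stack _ _).trans'
      (EqvGen.rel _ _ (Or.inr ⟨_, _, h, rfl, rfl⟩)) ((stack _ _).symm' (key v)))

theorem stack_permRel_right (σ : Equiv.Perm V) (a : Setoid (V ⊕ V)) :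
    stack a (permRel σ) = a.comap (Sum.elim Sum.inl (Sum.elim Sum.inr (Sum.inr ∘ σ))) := by
  ext u v
  constructor
  · intro h
    induction h with
    | rel x y h =>
      rcases h with ⟨p, q, h, rfl, rfl⟩ | ⟨p, q, h, rfl, rfl⟩
      · rcases p with p | p <;> rcases q with q | q <;> exact h
      · rw [permRel_iff] at h
        rw [Setoid.comap_rel]
        have e : ∀ p : V ⊕ V, (Sum.elim Sum.inl (Sum.elim Sum.inr (Sum.inr ∘ σ))
            (Sum.inr p : V ⊕ (V ⊕ V)) : V ⊕ V) = Sum.inr (Sum.elim id σ p) := by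
          rintro (p | p) <;> simp
        rw [e, e, h]
    | refl x => exact a.refl' _
    | symm x y _ ih => exact a.symm' ih
    | trans x y z _ _ h1 h2 => exact a.trans' h1 h2
  · intro h
    have key : ∀ u, stack a (permRel σ) u
        (Sum.map id Sum.inl (Sum.elim Sum.inl (Sum.elim Sum.inr (Sum.inr ∘ σ)) u)) := by
      rintro (u | u | u)
      · exact EqvGen.refl _
      · exact EqvGen.refl _
      · exact EqvGen.rel _ _ (Or.inr ⟨.inr u, .inl (σ u), by simp [permRel_iff], rfl, rfl⟩)
    exact (stack _ _).trans' (key u) ((stack _ _).trans'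
      (EqvGen.rel _ _ (Or.inl ⟨_, _, h, rfl, rfl⟩)) ((stack _ _).symm' (key v)))

theorem compRel_permRel_left (σ : Equiv.Perm V) (a : Setoid (V ⊕ V)) :
    compRel (permRel σ) a = a.comap (Sum.map σ.symm id) := by
  ext u v
  rw [compRel, stack_permRel_left, Setoid.comap_rel, Setoid.comap_rel, Setoid.comap_rel]
  rcases u with u | u <;> rcases v with v | v <;> rfl

theorem compRel_permRel_right (σ : Equiv.Perm V) (a : Setoid (V ⊕ V)) :
    compRel a (permRel σ) = a.comap (Sum.map id σ) := by
  ext u v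
  rw [compRel, stack_permRel_right, Setoid.comap_rel, Setoid.comap_rel, Setoid.comap_rel]
  rcases u with u | u <;> rcases v with v | v <;> rfl

theorem loops_permRel_left (σ : Equiv.Perm V) (a : Setoid (V ⊕ V)) :
    loops (permRel σ) a = 0 := by
  have : IsEmpty (Avoid (stack (permRel σ) a) (Set.range outer)) := by
    refine ⟨fun ⟨c, hc⟩ => ?_⟩
    induction c using Quotient.inductionOn with | _ u
    rcases u with u | u | u
    · exact hc _ ⟨.inl u, rfl⟩ rfl
    · refine hc _ ⟨.inl (σ u), rfl⟩ (Quotient.sound ?_)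
      exact EqvGen.rel _ _ (Or.inl ⟨.inl (σ u), .inr u, by simp [permRel_iff], rfl, rfl⟩)
    · exact hc _ ⟨.inr u, rfl⟩ rfl
  exact Nat.card_of_isEmpty

theorem loops_permRel_right (σ : Equiv.Perm V) (a : Setoid (V ⊕ V)) :
    loops a (permRel σ) = 0 := by
  have : IsEmpty (Avoid (stack a (permRel σ)) (Set.range outer)) := by
    refine ⟨fun ⟨c, hc⟩ => ?_⟩
    induction c using Quotient.inductionOn with | _ u
    rcases u with u | u | u
    · exact hc _ ⟨.inl u, rfl⟩ rfl
    · refine hc _ ⟨.inr (σ.symm u), rfl⟩ (Quotient.sound ?_)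
      exact EqvGen.rel _ _ (Or.inr ⟨.inr (σ.symm u), .inl u, by simp [permRel_iff], rfl, rfl⟩)
    · exact hc _ ⟨.inr u, rfl⟩ rfl
  exact Nat.card_of_isEmpty

/-! ### Perfect matchings are closed under stacking -/

/-- Every vertex is joined to exactly one other vertex. -/
def IsMatching {U : Type*} (s : Setoid U) : Prop := ∀ u, ∃! v, v ≠ u ∧ s u v

theorem dihedral_path {U : Type*} [Finite U] (α β : Equiv.Perm U) (hα : ∀ u, α (α u) = u)
    (hβ : ∀ u, β (β u) = u) (hne : ∀ u, β u = u → α u ≠ u) (x : U) (hx : β x = x) :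
    ∃! y, y ≠ x ∧ (α y = y ∨ β y = y) ∧ EqvGen (fun u v => v = α u ∨ v = β u) x y := by
  set g : Equiv.Perm U := β * α with hg
  have hαg : ∀ u, α u = β (g u) := fun u => by simp [hg, hβ]
  have hβg : ∀ (k : ℤ) u, β ((g ^ k) u) = (g ^ (-k)) (β u) := by
    have hconj : β * g * β⁻¹ = g⁻¹ := by
      ext u
      have h1 : β⁻¹ = β := by
        ext u; rw [Equiv.Perm.inv_eq_iff_eq, hβ]
      have h2 : α⁻¹ = α := by
        ext u; rw [Equiv.Perm.inv_eq_iff_eq, hα]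
      simp [hg, h1, h2, hβ]
    intro k u
    have : β * g ^ k = g ^ (-k) * β := by
      rw [zpow_neg, ← inv_zpow, ← hconj, conj_zpow]; group
    exact congrArg (fun e : Equiv.Perm U => e u) this
  have hb : ∀ k : ℤ, β ((g ^ k) x) = (g ^ (-k)) x := fun k => by rw [hβg, hx]
  have ha : ∀ k : ℤ, α ((g ^ k) x) = (g ^ (-k - 1)) x := fun k => by
    rw [hαg, ← Equiv.Perm.mul_apply g, ← zpow_one_add, hb]; congr 2; ring
  have horb : ∀ y, EqvGen (fun u v => v = α u ∨ v = β u) x y ↔ ∃ k : ℤ, (g ^ k) x = y := by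
    intro y
    constructor
    · intro h
      have := eqvGen_invariant (P := fun y => ∃ k : ℤ, (g ^ k) x = y) ?_ h
      · exact this.1 ⟨0, rfl⟩
      · have st : ∀ u, (∃ k : ℤ, (g ^ k) x = u) →
            (∃ k : ℤ, (g ^ k) x = α u) ∧ (∃ k : ℤ, (g ^ k) x = β u) := by
          rintro _ ⟨k, rfl⟩
          exact ⟨⟨_, (ha k).symm⟩, ⟨_, (hb k).symm⟩⟩
        rintro u v (rfl | rfl)
        · exact ⟨fun h => (st u h).1, fun h => by simpa [hα] using (st _ h).1⟩
        · exact ⟨fun h => (st u h).2, fun h => by simpa [hβ] using (st _ h).2⟩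
    · rintro ⟨k, rfl⟩
      have st : ∀ u, EqvGen (fun u v => v = α u ∨ v = β u) u (g u) := fun u =>
        EqvGen.trans _ _ _ (EqvGen.rel u (α u) (Or.inl rfl)) (EqvGen.rel _ _ (Or.inr rfl))
      induction k with
      | zero => exact EqvGen.refl _
      | succ k ih =>
        refine EqvGen.trans _ _ _ ih ?_
        rw [add_comm, zpow_one_add, Equiv.Perm.mul_apply]
        exact st _
      | pred k ih =>
        refine EqvGen.trans _ _ _ ih (EqvGen.symm _ _ ?_)
        have := st ((g ^ (-(k : ℤ) - 1)) x)
        rwa [← Equiv.Perm.mul_apply, ← zpow_one_add, add_sub_cancel] at this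
  obtain ⟨m, hm0, hm⟩ : ∃ m : ℕ, 0 < m ∧ ∀ k : ℤ, (g ^ k) x = x ↔ (m : ℤ) ∣ k := by
    refine ⟨Function.minimalPeriod g x, ?_, ?_⟩
    · exact Function.minimalPeriod_pos_of_mem_periodicPts
        ((Function.Injective.mem_periodicPts g.injective) x)
    · intro k
      exact MulAction.zpow_smul_eq_iff_minimalPeriod_dvd (a := g) (b := x)
  have heq : ∀ k k' : ℤ, (g ^ k) x = (g ^ k') x ↔ (m : ℤ) ∣ k - k' := by
    intro k k'
    rw [← hm, sub_eq_neg_add, zpow_add, Equiv.Perm.mul_apply, zpow_neg, Equiv.Perm.inv_eq_iff_eq,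
      eq_comm]
  have hm1 : m ≠ 1 := by
    rintro rfl
    have := (hm (-0 - 1)).2 (by simp)
    rw [← ha 0] at this
    exact hne x hx (by simpa using this)
  have hfix : ∀ k : ℤ, (α ((g ^ k) x) = (g ^ k) x ∨ β ((g ^ k) x) = (g ^ k) x) ↔
      ((m : ℤ) ∣ 2 * k + 1 ∨ (m : ℤ) ∣ 2 * k) := by
    intro k
    rw [ha, hb, heq, heq, ← dvd_neg, ← dvd_neg (b := -k - k)]
    ring_nf
  rcases Nat.even_or_odd' m with ⟨h, hh | hh⟩
  · refine ⟨(g ^ (h : ℤ)) x, ⟨?_, (hfix h).2 (Or.inr (by rw [hh]; push_cast; rfl)),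
      (horb _).2 ⟨_, rfl⟩⟩, ?_⟩
    · rw [Ne, hm]
      intro hd
      have := Nat.le_of_dvd (by omega) (Int.natCast_dvd_natCast.1 hd)
      omega
    · rintro y ⟨hy1, hy2, hy3⟩
      obtain ⟨k, rfl⟩ := (horb y).1 hy3
      rw [hfix] at hy2
      rw [Ne, hm] at hy1
      rw [heq]
      rw [hh] at hy1 hy2 ⊢
      push_cast at hy1 hy2 ⊢
      rcases hy2 with ⟨c, hc⟩ | ⟨c, hc⟩
      · have : 2 * k + 1 = 2 * (h * c) := by rw [hc]; ring
        omega
      · have hk : k = h * c := by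
          have : 2 * k = 2 * (h * c) := by rw [hc]; ring
          omega
        rcases Int.even_or_odd' c with ⟨d, rfl | rfl⟩
        · exact absurd ⟨d, by rw [hk]; ring⟩ hy1
        · exact ⟨d, by rw [hk]; ring⟩
  · refine ⟨(g ^ (h : ℤ)) x, ⟨?_, (hfix h).2 (Or.inl (by rw [hh]; push_cast; rfl)),
      (horb _).2 ⟨_, rfl⟩⟩, ?_⟩
    · rw [Ne, hm]
      intro hd
      have := Nat.le_of_dvd (by omega) (Int.natCast_dvd_natCast.1 hd)
      omega
    · rintro y ⟨hy1, hy2, hy3⟩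
      obtain ⟨k, rfl⟩ := (horb y).1 hy3
      rw [hfix] at hy2
      rw [Ne, hm] at hy1
      rw [heq]
      have hcop : IsCoprime (m : ℤ) 2 := ⟨1, -h, by rw [hh]; push_cast; ring⟩
      rcases hy2 with hc | hc
      · refine hcop.dvd_of_dvd_mul_left (y := 2) ?_
        have : (m : ℤ) ∣ (2 * k + 1) - m := dvd_sub hc dvd_rfl
        have e : (2 : ℤ) * (k - h) = 2 * k + 1 - m := by rw [hh]; push_cast; ring
        rw [e]
        exact this
      · exact absurd (hcop.dvd_of_dvd_mul_left hc) hy1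

theorem IsMatching.exists_partner {U : Type*} {s : Setoid U} (h : IsMatching s) :
    ∃ f : U → U, (∀ u, f u ≠ u) ∧ (∀ u, f (f u) = u) ∧ ∀ u v, s u v ↔ v = u ∨ v = f u := by
  choose f hf hu using h
  have hs : ∀ u v, s u v ↔ v = u ∨ v = f u := by
    intro u v
    constructor
    · intro h
      by_cases hv : v = u
      · exact Or.inl hv
      · exact Or.inr (hu u v ⟨hv, h⟩)
    · rintro (rfl | rfl)
      · exact s.refl' _
      · exact (hf u).2
  exact ⟨f, fun u => (hf u).1, fun u => (hu (f u) u ⟨(hf u).1.symm, s.symm' (hf u).2⟩).symm, hs⟩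

theorem IsMatching.compRel [Finite V] {a b : Setoid (V ⊕ V)} (ha : IsMatching a)
    (hb : IsMatching b) : IsMatching (compRel a b) := by
  obtain ⟨f, f1, f2, f3⟩ := ha.exists_partner
  obtain ⟨k, k1, k2, k3⟩ := hb.exists_partner
  let α' : V ⊕ (V ⊕ V) → V ⊕ (V ⊕ V) := Sum.elim (fun x => Sum.map id Sum.inl (f (.inl x)))
    (Sum.elim (fun y => Sum.map id Sum.inl (f (.inr y))) (fun z => .inr (.inr z)))
  let β' : V ⊕ (V ⊕ V) → V ⊕ (V ⊕ V) := Sum.elim Sum.inl (fun y => Sum.inr (k y))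
  have hα'u : ∀ p : V ⊕ V, α' (Sum.map id Sum.inl p) = Sum.map id Sum.inl (f p) := by
    rintro (p | p) <;> rfl
  have hα' : Function.Involutive α' := by
    rintro (x | x | x)
    · exact (hα'u _).trans (by rw [f2]; rfl)
    · exact (hα'u _).trans (by rw [f2]; rfl)
    · rfl
  have hβ' : Function.Involutive β' := by
    rintro (x | x)
    · rfl
    · exact congrArg Sum.inr (k2 x)
  have hinj : Function.Injective (Sum.map id Sum.inl : V ⊕ V → V ⊕ (V ⊕ V)) :=
    Function.injective_id.sumMap Sum.inl_injective
  have fα : ∀ u, α' u = u ↔ ∃ z, u = .inr (.inr z) := by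
    rintro (x | x | x)
    · refine iff_of_false (fun h => f1 (.inl x) (hinj h)) (by simp)
    · refine iff_of_false (fun h => f1 (.inr x) (hinj h)) (by simp)
    · simp [α']
  have fβ : ∀ u, β' u = u ↔ ∃ z, u = .inl z := by
    rintro (x | x)
    · simp [β']
    · simp [β', k1]
  have hst : ∀ u v, stack a b u v ↔ EqvGen (fun u v => v = α' u ∨ v = β' u) u v := by
    intro u v
    constructor
    · intro h
      induction h with
      | rel x y h =>
        rcases h with ⟨p, q, h, rfl, rfl⟩ | ⟨p, q, h, rfl, rfl⟩
        · rcases (f3 _ _).1 h with rfl | rfl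
          · exact EqvGen.refl _
          · exact EqvGen.rel _ _ (Or.inl (hα'u p).symm)
        · rcases (k3 _ _).1 h with rfl | rfl
          · exact EqvGen.refl _
          · exact EqvGen.rel _ _ (Or.inr rfl)
      | refl x => exact EqvGen.refl _
      | symm x y _ ih => exact EqvGen.symm _ _ ih
      | trans x y z _ _ h1 h2 => exact EqvGen.trans _ _ _ h1 h2
    · intro h
      induction h with
      | rel x y h =>
        rcases h with rfl | rfl
        · rcases x with x | x | x
          · exact EqvGen.rel _ _ (Or.inl ⟨.inl x, _, (f3 _ _).2 (Or.inr rfl), rfl, rfl⟩)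
          · exact EqvGen.rel _ _ (Or.inl ⟨.inr x, _, (f3 _ _).2 (Or.inr rfl), rfl, rfl⟩)
          · exact EqvGen.refl _
        · rcases x with x | x
          · exact EqvGen.refl _
          · exact EqvGen.rel _ _ (Or.inr ⟨x, _, (k3 _ _).2 (Or.inr rfl), rfl, rfl⟩)
      | refl x => exact EqvGen.refl _
      | symm x y _ ih => exact EqvGen.symm _ _ ih
      | trans x y z _ _ h1 h2 => exact EqvGen.trans _ _ _ h1 h2
  have hout : ∀ u : V ⊕ (V ⊕ V), (α' u = u ∨ β' u = u) ↔ u ∈ Set.range outer := by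
    intro u
    rw [fα, fβ]
    rcases u with x | x | x <;> simp [outer]
  have oinj : Function.Injective (outer : V ⊕ V → _) :=
    Function.injective_id.sumMap Sum.inr_injective
  intro u
  have main : ∃! y, y ≠ outer u ∧ (α' y = y ∨ β' y = y) ∧
      EqvGen (fun u v => v = α' u ∨ v = β' u) (outer u) y := by
    rcases u with u | u
    · refine dihedral_path hα'.toPerm hβ'.toPerm hα' hβ' ?_ _ ((fβ _).2 ⟨u, rfl⟩)
      intro v h1 h2
      obtain ⟨z, rfl⟩ := (fβ _).1 h1
      obtain ⟨z, hz⟩ := (fα (.inl _)).1 h2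
      cases hz
    · have := dihedral_path hβ'.toPerm hα'.toPerm hβ' hα' ?_ (.inr (.inr u)) ((fα _).2 ⟨u, rfl⟩)
      · simpa only [or_comm, Function.Involutive.coe_toPerm, outer, Sum.map_inr] using this
      · intro v h1 h2
        obtain ⟨z, rfl⟩ := (fα _).1 h1
        obtain ⟨z, hz⟩ := (fβ (.inr (.inr _))).1 h2
        cases hz
  obtain ⟨y, ⟨hy1, hy2, hy3⟩, hy4⟩ := main
  obtain ⟨v, rfl⟩ := (hout _).1 hy2
  refine ⟨v, ⟨fun h => hy1 (by rw [h]), (hst _ _).2 hy3⟩, ?_⟩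
  rintro w ⟨hw1, hw2⟩
  exact oinj (hy4 _ ⟨fun h => hw1 (oinj h), (hout _).2 ⟨w, rfl⟩, (hst _ _).1 hw2⟩)

/-- Relabelling all vertices by a map preserving `a` and `b` preserves their composite. -/
theorem compRel_map {a b : Setoid (V ⊕ V)} (n : V → V)
    (ha : ∀ u v, a u v → a (Sum.map n n u) (Sum.map n n v))
    (hb : ∀ u v, b u v → b (Sum.map n n u) (Sum.map n n v)) {u v : V ⊕ V}
    (h : compRel a b u v) : compRel a b (Sum.map n n u) (Sum.map n n v) := by
  have key : ∀ x y, stack a b x y →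
      stack a b (Sum.map n (Sum.map n n) x) (Sum.map n (Sum.map n n) y) := by
    intro x y h
    induction h with
    | rel x y h =>
      rcases h with ⟨p, q, h, rfl, rfl⟩ | ⟨p, q, h, rfl, rfl⟩
      · refine EqvGen.rel _ _ (Or.inl ⟨_, _, ha _ _ h, ?_, ?_⟩)
        · rcases p with p | p <;> rfl
        · rcases q with p | p <;> rfl
      · exact EqvGen.rel _ _ (Or.inr ⟨_, _, hb _ _ h, rfl, rfl⟩)
    | refl x => exact EqvGen.refl _
    | symm x y _ ih => exact EqvGen.symm _ _ ih
    | trans x y z _ _ h1 h2 => exact EqvGen.trans _ _ _ h1 h2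
  have := key _ _ h
  change stack a b _ _
  convert this using 1
  · rcases u with u | u <;> rfl
  · rcases v with u | u <;> rfl

end Stacking

/-! ### Hyperoctahedral groups and Brauer diagrams of type C -/

/-- The set `{-n, …, -1, 1, …, n}`: the pair `(i, true)` is the element `i + 1` and `(i, false)`
is the element `-(i + 1)`, for `i = 0, …, n - 1`. -/
abbrev Vertex (n : ℕ) : Type := Fin n × Bool

/-- The reflection `v ↦ -v`. -/
def refl {n : ℕ} (v : Vertex n) : Vertex n := (v.1, !v.2)

@[simp] theorem refl_refl {n : ℕ} (v : Vertex n) : refl (refl v) = v := by simp [refl]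

theorem refl_injective {n : ℕ} : Function.Injective (refl (n := n)) :=
  Function.Involutive.injective refl_refl

/-- The hyperoctahedral group: the permutations `σ` of `{±1, …, ±n}` with `σ (-v) = -(σ v)`. -/
def Hyp (n : ℕ) : Subgroup (Equiv.Perm (Vertex n)) where
  carrier := {σ | ∀ v, σ (refl v) = refl (σ v)}
  mul_mem' := fun {σ τ} hσ hτ v => by simp [hτ v, hσ (τ v)]
  one_mem' := fun _ => rfl
  inv_mem' := fun {σ} hσ v => by
    rw [Equiv.Perm.inv_eq_iff_eq, hσ]; simp

theorem hyp_apply_refl {n : ℕ} (σ : Hyp n) (v : Vertex n) : σ.1 (refl v) = refl (σ.1 v) := σ.2 v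

/-- A Brauer diagram of type C: a partition of the `2r` top vertices (`Sum.inl`) and `2r` bottom
vertices (`Sum.inr`) into pairs (the edges), invariant under the reflection. -/
@[ext]
structure Diagram (r : ℕ) where
  rel : Setoid (Vertex r ⊕ Vertex r)
  matching : IsMatching rel
  symm : ∀ u v, rel u v → rel (Sum.map refl refl u) (Sum.map refl refl v)

namespace Diagram

variable {r : ℕ}

/-- Concatenation of diagrams (`a` above `b`), closed loops being discarded. -/
def comp (a b : Diagram r) : Diagram r where
  rel := compRel a.rel b.rel
  matching := a.matching.compRel b.matching
  symm := fun _ _ h => compRel_map refl a.symm b.symm h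

theorem permRel_matching {V : Type*} (σ : Equiv.Perm V) : IsMatching (permRel σ) := by
  rintro (u | u)
  · refine ⟨.inr (σ.symm u), ⟨by simp, by simp [permRel_iff]⟩, ?_⟩
    rintro (v | v) ⟨h1, h2⟩ <;> simp [permRel_iff] at h1 h2
    · exact absurd h2.symm h1
    · simp [h2]
  · refine ⟨.inl (σ u), ⟨by simp, by simp [permRel_iff]⟩, ?_⟩
    rintro (v | v) ⟨h1, h2⟩ <;> simp [permRel_iff] at h1 h2
    · simp [h2]
    · exact absurd h2.symm h1

/-- The diagram of an element of the hyperoctahedral group, without horizontal edges: the bottom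
vertex `v` is joined to the top vertex `σ v`. -/
def ofPerm (σ : Hyp r) : Diagram r where
  rel := permRel σ.1
  matching := permRel_matching σ.1
  symm := by
    rintro (u | u) (v | v) h <;> rw [permRel_iff] at h ⊢ <;> simp_all [hyp_apply_refl]

theorem comp_assoc (a b c : Diagram r) : (a.comp b).comp c = a.comp (b.comp c) :=
  Diagram.ext (compRel_assoc a.rel b.rel c.rel)

theorem one_comp (a : Diagram r) : (ofPerm 1).comp a = a := by
  refine Diagram.ext ((compRel_permRel_left 1 a.rel).trans ?_)
  ext u v
  rcases u with u | u <;> rcases v with v | v <;> rfl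

theorem comp_one (a : Diagram r) : a.comp (ofPerm 1) = a := by
  refine Diagram.ext ((compRel_permRel_right 1 a.rel).trans ?_)
  ext u v
  rcases u with u | u <;> rcases v with v | v <;> rfl

theorem ofPerm_mul (σ τ : Hyp r) : ofPerm (σ * τ) = (ofPerm σ).comp (ofPerm τ) := by
  refine Diagram.ext (Eq.trans ?_ (compRel_permRel_right τ.1 (permRel σ.1)).symm)
  ext u v
  rcases u with u | u <;> rcases v with v | v <;> rfl

/-- The number of horizontal edges in the top row (equal to that in the bottom row): half the
number of top vertices that are joined to another top vertex. -/
noncomputable def horizontal (d : Diagram r) : ℕ :=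
  {x : Vertex r | ∃ y, y ≠ x ∧ d.rel (.inl x) (.inl y)}.ncard / 2

/-- Auxiliary labelling of the vertices of `capCup l`: two vertices get the same label exactly when
they are joined. -/
def capLabel (l : ℕ) : Vertex r ⊕ Vertex r → (Bool × Fin r) ⊕ Vertex r :=
  Sum.elim (fun v => if v.1.1 < l then .inl (true, v.1) else .inr v)
    (fun v => if v.1.1 < l then .inl (false, v.1) else .inr v)

/-- The diagram with horizontal edges `{-i, i}` in both rows for `1 ≤ i ≤ l`, all other edges being
vertical and joining `v` with `v`. -/
def capCup (r l : ℕ) : Diagram r where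
  rel := Setoid.ker (capLabel l)
  matching := by
    have key : ∀ u v : Vertex r ⊕ Vertex r, Setoid.ker (capLabel l) u v ↔
      capLabel l u = capLabel l v := fun _ _ => Iff.rfl
    simp only [IsMatching, key]
    rintro (⟨i, s⟩ | ⟨i, s⟩) <;> by_cases h : i.1 < l
    · refine ⟨.inl (i, !s), by simp [capLabel, h], ?_⟩
      rintro (⟨k, t⟩ | ⟨k, t⟩) <;> by_cases h' : k.1 < l <;> cases s <;> cases t <;>
        simp [capLabel, h, h'] <;> grind
    · refine ⟨.inr (i, s), by simp [capLabel, h], ?_⟩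
      rintro (⟨k, t⟩ | ⟨k, t⟩) <;> by_cases h' : k.1 < l <;> cases s <;> cases t <;>
        simp [capLabel, h, h'] <;> grind
    · refine ⟨.inr (i, !s), by simp [capLabel, h], ?_⟩
      rintro (⟨k, t⟩ | ⟨k, t⟩) <;> by_cases h' : k.1 < l <;> cases s <;> cases t <;>
        simp [capLabel, h, h'] <;> grind
    · refine ⟨.inl (i, s), by simp [capLabel, h], ?_⟩
      rintro (⟨k, t⟩ | ⟨k, t⟩) <;> by_cases h' : k.1 < l <;> cases s <;> cases t <;>
        simp [capLabel, h, h'] <;> grind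
  symm := by
    have key : ∀ u v : Vertex r ⊕ Vertex r, Setoid.ker (capLabel l) u v ↔
      capLabel l u = capLabel l v := fun _ _ => Iff.rfl
    simp only [key]
    rintro (⟨i, s⟩ | ⟨i, s⟩) (⟨k, t⟩ | ⟨k, t⟩) <;> by_cases h : i.1 < l <;>
      by_cases h' : k.1 < l <;> simp [capLabel, h, h', refl]

end Diagram

/-! ### The Brauer algebra of type C -/

section Algebra

variable (r : ℕ) (K : Type*) [Field K] (δ : K)

/-- The Brauer algebra of type C with parameter `δ`: the vector space with basis the Brauer diagrams
of type C. -/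
def BrauerC (_δ : K) : Type _ := Diagram r →₀ K

namespace BrauerC

noncomputable instance : AddCommGroup (BrauerC r K δ) :=
  inferInstanceAs (AddCommGroup (Diagram r →₀ K))

noncomputable instance : Module K (BrauerC r K δ) :=
  inferInstanceAs (Module K (Diagram r →₀ K))

variable {r K}

/-- The basis of diagrams. -/
noncomputable def basis : Module.Basis (Diagram r) K (BrauerC r K δ) :=
  .ofRepr (LinearEquiv.refl K (Diagram r →₀ K))

/-- The basis element given by a diagram. -/
noncomputable def diag (d : Diagram r) : BrauerC r K δ := basis δ d

/-- The bilinear multiplication: concatenate, and multiply by `δ` for every closed loop. -/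
noncomputable def mulHom : BrauerC r K δ →ₗ[K] BrauerC r K δ →ₗ[K] BrauerC r K δ :=
  (basis δ).constr K fun a => (basis δ).constr K fun b =>
    δ ^ loops a.rel b.rel • diag δ (a.comp b)

theorem mulHom_diag (a b : Diagram r) :
    mulHom δ (diag δ a) (diag δ b) = δ ^ loops a.rel b.rel • diag δ (a.comp b) := by
  simp [mulHom, diag, Module.Basis.constr_basis]

theorem mulHom_assoc (x y z : BrauerC r K δ) :
    mulHom δ (mulHom δ x y) z = mulHom δ x (mulHom δ y z) := by
  have h : (mulHom δ).compr₂ (mulHom δ) =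
      (LinearMap.mul K (Module.End K (BrauerC r K δ))).compl₁₂ (mulHom δ) (mulHom δ) := by
    refine (basis δ).ext fun a => (basis δ).ext fun b => (basis δ).ext fun c => ?_
    change mulHom δ (mulHom δ (diag δ a) (diag δ b)) (diag δ c) =
      mulHom δ (diag δ a) (mulHom δ (diag δ b) (diag δ c))
    rw [mulHom_diag, mulHom_diag, map_smul, map_smul, LinearMap.smul_apply, mulHom_diag,
      mulHom_diag, smul_smul, smul_smul, ← pow_add, ← pow_add, Diagram.comp_assoc]
    congr 2
    exact loops_assoc a.rel b.rel c.rel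
  exact LinearMap.congr_fun (LinearMap.congr_fun₂ h x y) z

theorem one_mulHom (x : BrauerC r K δ) : mulHom δ (diag δ (.ofPerm 1)) x = x := by
  have h : mulHom δ (diag δ (.ofPerm (1 : Hyp r))) = LinearMap.id := by
    refine (basis δ).ext fun a => ?_
    change mulHom δ (diag δ (.ofPerm 1)) (diag δ a) = diag δ a
    rw [mulHom_diag, Diagram.one_comp]
    erw [loops_permRel_left, pow_zero, one_smul]
  exact LinearMap.congr_fun h x

theorem mulHom_one (x : BrauerC r K δ) : mulHom δ x (diag δ (.ofPerm 1)) = x := by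
  have h : (mulHom δ).flip (diag δ (.ofPerm (1 : Hyp r))) = LinearMap.id := by
    refine (basis δ).ext fun a => ?_
    change mulHom δ (diag δ a) (diag δ (.ofPerm 1)) = diag δ a
    rw [mulHom_diag, Diagram.comp_one]
    erw [loops_permRel_right, pow_zero, one_smul]
  exact LinearMap.congr_fun h x

noncomputable instance : Ring (BrauerC r K δ) :=
  { (inferInstance : AddCommGroup (BrauerC r K δ)) with
    mul := fun x y => mulHom δ x y
    one := diag δ (.ofPerm 1)
    mul_assoc := mulHom_assoc δ
    one_mul := one_mulHom δ
    mul_one := mulHom_one δ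
    left_distrib := fun x y z => map_add (mulHom δ x) y z
    right_distrib := fun x y z => LinearMap.map_add₂ (mulHom δ) x y z
    zero_mul := fun x => LinearMap.map_zero₂ (mulHom δ) x
    mul_zero := fun x => map_zero (mulHom δ x) }

noncomputable instance : Algebra K (BrauerC r K δ) :=
  Algebra.ofModule (fun c x y => LinearMap.map_smul₂ (mulHom δ) c x y)
    (fun c x y => map_smul (mulHom δ x) c y)

theorem one_def : (1 : BrauerC r K δ) = diag δ (.ofPerm 1) := rfl

theorem diag_mul_diag (a b : Diagram r) :
    diag δ a * diag δ b = δ ^ loops a.rel b.rel • diag δ (a.comp b) := mulHom_diag δ a b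

/-- The group algebra of the hyperoctahedral group inside the Brauer algebra. -/
noncomputable def ofGroup : Hyp r →* BrauerC r K δ where
  toFun σ := diag δ (.ofPerm σ)
  map_one' := rfl
  map_mul' σ τ := by
    rw [diag_mul_diag, Diagram.ofPerm_mul]
    erw [loops_permRel_left, pow_zero, one_smul]

/-- The idempotent `e_l = δ^{-l} · capCup l` (for `δ ≠ 0`). -/
noncomputable def e (r l : ℕ) : BrauerC r K δ := (δ ^ l)⁻¹ • diag δ (.capCup r l)

end BrauerC

/-- The inclusion `{±1, …, ±(r-l)} → {±1, …, ±r}`, `±i ↦ ±(l+i)`. -/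
def outerVertex (l : ℕ) : Vertex (r - l) ↪ Vertex r where
  toFun v := (⟨l + v.1.1, by omega⟩, v.2)
  inj' := by
    rintro ⟨⟨i, hi⟩, s⟩ ⟨⟨k, hk⟩, t⟩ h
    simp only [Prod.mk.injEq, Fin.mk.injEq] at h ⊢
    exact ⟨by omega, h.2⟩

theorem mem_range_outerVertex (l : ℕ) (v : Vertex r) :
    v ∈ Set.range (outerVertex r l) ↔ l ≤ v.1.1 := by
  constructor
  · rintro ⟨w, rfl⟩; exact Nat.le_add_right _ _
  · intro h
    refine ⟨(⟨v.1.1 - l, by omega⟩, v.2), Prod.ext (Fin.ext ?_) rfl⟩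
    change l + (v.1.1 - l) = v.1.1
    omega

theorem outerVertex_refl (l : ℕ) (v : Vertex (r - l)) :
    outerVertex r l (refl v) = refl (outerVertex r l v) := rfl

/-- The embedding of the hyperoctahedral group of rank `r - l` in that of rank `r`, permuting
`±(l+1), …, ±r` and fixing `±1, …, ±l`. -/
noncomputable def hypEmbedding (l : ℕ) : Hyp (r - l) →* Hyp r :=
  ((Equiv.Perm.viaEmbeddingHom (outerVertex r l)).comp (Hyp (r - l)).subtype).codRestrict (Hyp r) <| by
    intro σ v
    change σ.1.viaEmbedding (outerVertex r l) (refl v) =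
      refl (σ.1.viaEmbedding (outerVertex r l) v)
    by_cases hv : v ∈ Set.range (outerVertex r l)
    · obtain ⟨w, rfl⟩ := hv
      rw [← outerVertex_refl, Equiv.Perm.viaEmbedding_apply, Equiv.Perm.viaEmbedding_apply,
        hyp_apply_refl, outerVertex_refl]
    · have hv' : refl v ∉ Set.range (outerVertex r l) := by
        rw [mem_range_outerVertex] at hv ⊢; exact hv
      rw [Equiv.Perm.viaEmbedding_apply_of_notMem _ _ _ hv,
        Equiv.Perm.viaEmbedding_apply_of_notMem _ _ _ hv']

/-- The group algebra of the hyperoctahedral group of rank `n`. -/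
abbrev HypAlg (n : ℕ) : Type _ := MonoidAlgebra K (Hyp n)

/-- The algebra map from the group algebra of rank `r - l` to the Brauer algebra. -/
noncomputable def hat (l : ℕ) : HypAlg K (r - l) →ₐ[K] BrauerC r K δ :=
  MonoidAlgebra.lift K _ _ ((BrauerC.ofGroup δ).comp (hypEmbedding r l))

theorem capLabel_hyp (l : ℕ) (σ : Hyp (r - l)) (u v : Vertex r ⊕ Vertex r) :
    Diagram.capLabel l (Sum.map (hypEmbedding r l σ).1 (hypEmbedding r l σ).1 u) =
      Diagram.capLabel l (Sum.map (hypEmbedding r l σ).1 (hypEmbedding r l σ).1 v) ↔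
      Diagram.capLabel l u = Diagram.capLabel l v := by
  set τ := (hypEmbedding r l σ).1 with hτ
  have h1 : ∀ v : Vertex r, v.1.1 < l → τ v = v := fun v hv =>
    Equiv.Perm.viaEmbedding_apply_of_notMem _ _ _ (by rw [mem_range_outerVertex]; omega)
  have h2 : ∀ v : Vertex r, ¬ v.1.1 < l → ¬ (τ v).1.1 < l := by
    intro v hv
    obtain ⟨w, rfl⟩ := (mem_range_outerVertex r l v).2 (by omega)
    have : τ (outerVertex r l w) = outerVertex r l (σ.1 w) := Equiv.Perm.viaEmbedding_apply _ _ _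
    rw [this]
    have := (mem_range_outerVertex r l (outerVertex r l (σ.1 w))).1 ⟨_, rfl⟩
    omega
  rcases u with u | u <;> rcases v with v | v <;> by_cases hu : u.1.1 < l <;>
    by_cases hv : v.1.1 < l <;>
    simp only [Diagram.capLabel, Sum.map_inl, Sum.map_inr, Sum.elim_inl, Sum.elim_inr, hu, hv, h1,
      h2, if_true, if_false, reduceCtorEq, Sum.inr.injEq, EmbeddingLike.apply_eq_iff_eq,
      not_false_eq_true]

theorem ofGroup_mul_e (l : ℕ) (σ : Hyp (r - l)) :
    BrauerC.ofGroup δ (hypEmbedding r l σ) * BrauerC.e δ r l =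
      BrauerC.e δ r l * BrauerC.ofGroup δ (hypEmbedding r l σ) := by
  unfold BrauerC.e
  rw [mul_smul_comm, smul_mul_assoc]
  congr 1
  change BrauerC.diag δ (.ofPerm _) * _ = _ * BrauerC.diag δ (.ofPerm _)
  rw [BrauerC.diag_mul_diag, BrauerC.diag_mul_diag]
  have hl := loops_permRel_left (hypEmbedding r l σ).1 (Diagram.capCup r l).rel
  have hr := loops_permRel_right (hypEmbedding r l σ).1 (Diagram.capCup r l).rel
  erw [hl, hr]
  congr 2
  refine Diagram.ext ((compRel_permRel_left _ _).trans
    (Eq.trans ?_ (compRel_permRel_right _ _).symm))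
  ext u v
  change Diagram.capLabel l _ = Diagram.capLabel l _ ↔ Diagram.capLabel l _ = Diagram.capLabel l _
  rw [← capLabel_hyp r l σ]
  rcases u with u | u <;> rcases v with v | v <;> simp

theorem hat_mul_e (l : ℕ) (a : HypAlg K (r - l)) :
    hat r K δ l a * BrauerC.e δ r l = BrauerC.e δ r l * hat r K δ l a := by
  induction a using MonoidAlgebra.induction_on with
  | of σ => simpa [hat] using ofGroup_mul_e r K δ l σ
  | add a b ha hb => rw [map_add, add_mul, mul_add, ha, hb]
  | smul c a ha => rw [map_smul, smul_mul_assoc, mul_smul_comm, ha]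

end Algebra

/-! ### Tableaux, permutation modules, Specht modules and Young modules of hyperoctahedral groups -/

/-- A bipartition of `n`: a pair of partitions (given by their Young diagrams) of total size `n`. -/
structure BiPartition (n : ℕ) where
  fst : YoungDiagram
  snd : YoungDiagram
  card_add_card : fst.card + snd.card = n

section Tableaux

variable {n : ℕ}

/-- The boxes of a bipartition; those of the first component are `Sum.inl`, those of the second
component are `Sum.inr`. -/
abbrev BiPartition.Box (lam : BiPartition n) : Type := lam.fst.cells ⊕ lam.snd.cells

/-- The position (row, column) of a box inside its component. -/
def BiPartition.pos {lam : BiPartition n} : lam.Box → ℕ × ℕ := Sum.elim (fun b => b.1) (fun b => b.1)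

/-- A bitableau: a filling of the `n` boxes by elements of `{±1, …, ±n}` with distinct
absolute values. -/
@[ext]
structure BiTableau (lam : BiPartition n) where
  entry : lam.Box → Vertex n
  abs_injective : Function.Injective fun b => (entry b).1

theorem hypAbs_eq_iff (σ : Hyp n) (v w : Vertex n) : (σ.1 v).1 = (σ.1 w).1 ↔ v.1 = w.1 := by
  have key : ∀ v w : Vertex n, v.1 = w.1 ↔ v = w ∨ v = refl w := by
    rintro ⟨i, s⟩ ⟨k, t⟩
    cases s <;> cases t <;> simp [refl]
  rw [key, key, ← hyp_apply_refl, EmbeddingLike.apply_eq_iff_eq, EmbeddingLike.apply_eq_iff_eq]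

/-- The underlying permutation of absolute values. -/
noncomputable def hypAbs (σ : Hyp n) : Equiv.Perm (Fin n) :=
  Equiv.ofBijective (fun i => (σ.1 (i, true)).1)
    (Finite.injective_iff_bijective.1 fun _ _ h => (hypAbs_eq_iff σ _ _).1 h)

/-- The sign `(-1)^x · sgn |σ|`, where `x` is the number of sign changes. -/
noncomputable def hypSgn (σ : Hyp n) : ℤˣ :=
  (∏ i : Fin n, if (σ.1 (i, true)).2 then 1 else -1) * Equiv.Perm.sign (hypAbs σ)

variable {lam : BiPartition n}

namespace BiTableau

/-- The right action of the hyperoctahedral group, through `v · σ = σ⁻¹ v` on entries. -/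
def act (t : BiTableau lam) (σ : Hyp n) : BiTableau lam where
  entry b := (σ⁻¹).1 (t.entry b)
  abs_injective := fun _ _ h => t.abs_injective ((hypAbs_eq_iff σ⁻¹ _ _).1 h)

theorem act_one (t : BiTableau lam) : t.act 1 = t := rfl

theorem act_mul (t : BiTableau lam) (σ τ : Hyp n) : t.act (σ * τ) = (t.act σ).act τ := by
  ext1; funext b; simp [act]

/-- Row permutations: they permute the entries in each row, and may change the signs of the
entries of the second component. -/
def IsRowPerm (t : BiTableau lam) (σ : Hyp n) : Prop :=
  ∀ b : lam.Box, ∃ b' : lam.Box, b'.isLeft = b.isLeft ∧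
    (BiPartition.pos b').1 = (BiPartition.pos b).1 ∧
    (σ.1 (t.entry b) = t.entry b' ∨ b.isRight ∧ σ.1 (t.entry b) = refl (t.entry b'))

/-- Column permutations: they permute the entries in each column, and may change the signs of the
entries of the first component. -/
def IsColPerm (t : BiTableau lam) (σ : Hyp n) : Prop :=
  ∀ b : lam.Box, ∃ b' : lam.Box, b'.isLeft = b.isLeft ∧
    (BiPartition.pos b').2 = (BiPartition.pos b).2 ∧
    (σ.1 (t.entry b) = t.entry b' ∨ b.isLeft ∧ σ.1 (t.entry b) = refl (t.entry b'))

/-- The group of row permutations. -/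
def rowGroup (t : BiTableau lam) : Subgroup (Hyp n) :=
  let S : Submonoid (Hyp n) :=
    { carrier := {σ | t.IsRowPerm σ}
      one_mem' := fun b => ⟨b, rfl, rfl, Or.inl rfl⟩
      mul_mem' := by
        intro σ τ hσ hτ b
        obtain ⟨b', h1, h2, h3⟩ := hτ b
        obtain ⟨b'', k1, k2, k3⟩ := hσ b'
        have hR : b'.isRight = b.isRight := by
          rw [← Sum.bnot_isLeft, ← Sum.bnot_isLeft, h1]
        refine ⟨b'', k1.trans h1, k2.trans h2, ?_⟩
        change σ.1 (τ.1 _) = _ ∨ _ ∧ σ.1 (τ.1 _) = _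
        rcases h3 with h3 | ⟨h3', h3⟩ <;> rcases k3 with k3 | ⟨k3', k3⟩ <;> rw [h3]
        · exact Or.inl k3
        · exact Or.inr ⟨hR ▸ k3', k3⟩
        · exact Or.inr ⟨h3', by rw [hyp_apply_refl, k3]⟩
        · exact Or.inl (by rw [hyp_apply_refl, k3, refl_refl]) }
  { S with
    inv_mem' := by
      intro σ hσ
      have : σ⁻¹ = σ ^ (orderOf σ - 1) := by
        rw [inv_eq_iff_mul_eq_one, ← pow_succ', Nat.sub_add_cancel (orderOf_pos σ),
          pow_orderOf_eq_one]
      rw [this]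
      exact S.pow_mem hσ _ }

theorem mem_rowGroup {t : BiTableau lam} {σ : Hyp n} : σ ∈ t.rowGroup ↔ t.IsRowPerm σ := Iff.rfl

theorem isRowPerm_act {t : BiTableau lam} {ρ : Hyp n} (σ : Hyp n) (h : t.IsRowPerm ρ) :
    (t.act σ).IsRowPerm (σ⁻¹ * ρ * σ) := by
  intro b
  obtain ⟨b', h1, h2, h3⟩ := h b
  refine ⟨b', h1, h2, ?_⟩
  have e : (σ⁻¹ * ρ * σ).1 ((t.act σ).entry b) = (σ⁻¹).1 (ρ.1 (t.entry b)) := by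
    simp [act]
  rw [e]
  rcases h3 with h3 | ⟨h3', h3⟩ <;> rw [h3]
  · exact Or.inl rfl
  · exact Or.inr ⟨h3', hyp_apply_refl _ _⟩

/-- Row equivalence of bitableaux. -/
def rowSetoid (lam : BiPartition n) : Setoid (BiTableau lam) where
  r t₁ t₂ := ∃ σ ∈ t₁.rowGroup, t₂ = t₁.act σ
  iseqv :=
    { refl := fun t => ⟨1, t.rowGroup.one_mem, rfl⟩
      symm := by
        rintro t _ ⟨σ, hσ, rfl⟩
        refine ⟨σ⁻¹, ?_, ?_⟩
        · have := isRowPerm_act σ hσ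
          rw [inv_mul_cancel, one_mul] at this
          exact (t.act σ).rowGroup.inv_mem this
        · rw [← act_mul, mul_inv_cancel, act_one]
      trans := by
        rintro t _ _ ⟨σ, hσ, rfl⟩ ⟨τ, hτ, rfl⟩
        refine ⟨σ * τ, t.rowGroup.mul_mem hσ ?_, (act_mul t σ τ).symm⟩
        have h2 := isRowPerm_act σ⁻¹ hτ
        rw [← act_mul, mul_inv_cancel, act_one] at h2
        have h3 := t.rowGroup.mul_mem (t.rowGroup.mul_mem (t.rowGroup.inv_mem hσ) h2) hσ
        simpa [mul_assoc] using h3 }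

end BiTableau

/-- Bitabloids: row equivalence classes of bitableaux. -/
def BiTabloid (lam : BiPartition n) : Type := Quotient (BiTableau.rowSetoid lam)

/-- The bitabloid of a bitableau. -/
def BiTableau.tabloid (t : BiTableau lam) : BiTabloid lam := Quotient.mk _ t

/-- The right action on bitabloids. -/
def BiTabloid.act (T : BiTabloid lam) (σ : Hyp n) : BiTabloid lam :=
  Quotient.map (fun t => t.act σ) (by
    rintro t _ ⟨ρ, hρ, rfl⟩
    refine ⟨σ⁻¹ * ρ * σ, BiTableau.isRowPerm_act σ hρ, ?_⟩
    rw [← BiTableau.act_mul, ← BiTableau.act_mul, mul_assoc, mul_inv_cancel_left]) T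

theorem BiTabloid.act_one (T : BiTabloid lam) : T.act 1 = T := by
  induction T using Quotient.inductionOn with | _ t
  rfl

theorem BiTabloid.act_mul (T : BiTabloid lam) (σ τ : Hyp n) :
    T.act (σ * τ) = (T.act σ).act τ := by
  induction T using Quotient.inductionOn with | _ t
  exact congrArg (Quotient.mk _) (BiTableau.act_mul t σ τ)

variable (K : Type*) [Field K]

/-- The permutation module of the hyperoctahedral group algebra: the vector space with basis
the bitabloids. -/
def PermModule (lam : BiPartition n) : Type _ := BiTabloid lam →₀ K

namespace PermModule

noncomputable instance (lam : BiPartition n) : AddCommGroup (PermModule K lam) :=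
  inferInstanceAs (AddCommGroup (BiTabloid lam →₀ K))

noncomputable instance (lam : BiPartition n) : Module K (PermModule K lam) :=
  inferInstanceAs (Module K (BiTabloid lam →₀ K))

/-- The basis vector of a bitabloid. -/
noncomputable def ofTabloid (T : BiTabloid lam) : PermModule K lam := Finsupp.single T (1 : K)

/-- The action of a group element: the linear extension of the right action on bitabloids. -/
noncomputable def actHom (lam : BiPartition n) : Hyp n →* (Module.End K (PermModule K lam))ᵐᵒᵖ where
  toFun σ := MulOpposite.op (Finsupp.lmapDomain K K fun T : BiTabloid lam => T.act σ)
  map_one' := by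
    have : (fun T : BiTabloid lam => T.act 1) = id := funext BiTabloid.act_one
    rw [this, Finsupp.lmapDomain_id]
    rfl
  map_mul' σ τ := by
    have : (fun T : BiTabloid lam => T.act (σ * τ)) = (fun T => T.act τ) ∘ (fun T => T.act σ) :=
      funext fun T => T.act_mul σ τ
    rw [this, Finsupp.lmapDomain_comp]
    rfl

/-- The right module structure over the group algebra. -/
noncomputable instance (lam : BiPartition n) : Module (HypAlg K n)ᵐᵒᵖ (PermModule K lam) :=
  Module.compHom _ (((RingEquiv.opOp (Module.End K (PermModule K lam))).symm.toRingHom).comp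
    (RingHom.op ((MonoidAlgebra.lift K _ _ (actHom K lam)) : HypAlg K n →+* _)))

theorem of_smul (σ : Hyp n) (T : BiTabloid lam) :
    MulOpposite.op (MonoidAlgebra.of K (Hyp n) σ) • ofTabloid K T = ofTabloid K (T.act σ) := by
  change (MonoidAlgebra.lift K _ _ (actHom K lam) (MonoidAlgebra.of K (Hyp n) σ)).unop
    (ofTabloid K T) = _
  rw [MonoidAlgebra.lift_of]
  exact Finsupp.mapDomain_single

end PermModule

open Classical in
/-- The alternating column sum. -/
noncomputable def columnSum (t : BiTableau lam) : HypAlg K n :=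
  ∑ σ : Hyp n, if t.IsColPerm σ then ((hypSgn σ : ℤ) : K) • MonoidAlgebra.of K (Hyp n) σ else 0

/-- The polytabloid of a bitableau. -/
noncomputable def polytabloid (t : BiTableau lam) : PermModule K lam :=
  MulOpposite.op (columnSum K t) • PermModule.ofTabloid K t.tabloid

/-- The Specht module: the submodule spanned by the polytabloids. -/
noncomputable def specht (lam : BiPartition n) : Submodule (HypAlg K n)ᵐᵒᵖ (PermModule K lam) :=
  Submodule.span _ (Set.range fun t : BiTableau lam => polytabloid K t)

end Tableaux

section Modules

/-- A module is indecomposable if it is nonzero and not the direct sum of two nonzero submodules. -/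
def Indecomposable (R M : Type*) [Ring R] [AddCommGroup M] [Module R M] : Prop :=
  Nontrivial M ∧ ∀ p q : Submodule R M, IsCompl p q → p = ⊥ ∨ q = ⊥

/-- A submodule is a direct summand if it has a complement. -/
def IsDirectSummand {R M : Type*} [Ring R] [AddCommGroup M] [Module R M] (N : Submodule R M) :
    Prop := ∃ N' : Submodule R M, IsCompl N N'

/-- `M` has a quotient module isomorphic to `Q`. -/
def HasQuotientIso (R M Q : Type*) [Ring R] [AddCommGroup M] [Module R M] [AddCommGroup Q]
    [Module R Q] : Prop := ∃ U : Submodule R M, Nonempty ((M ⧸ U) ≃ₗ[R] Q)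

/-- `Y` is a Young module of the hyperoctahedral group algebra for `lam`: an indecomposable direct
summand of the permutation module that contains the Specht module. -/
def IsYoungModule (K : Type*) [Field K] {n : ℕ} (lam : BiPartition n)
    (Y : Submodule (HypAlg K n)ᵐᵒᵖ (PermModule K lam)) : Prop :=
  IsDirectSummand Y ∧ Indecomposable (HypAlg K n)ᵐᵒᵖ Y ∧ specht K lam ≤ Y

open scoped TensorProduct in
/-- The tensor product `M ⊗_A N` of a right `A`-module `M` and an `A`-`B`-bimodule `N`, as a right
`B`-module: the quotient of the tensor product of abelian groups (written with `N` as the left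
factor) by the relations `m a ⊗ n = m ⊗ a n`. -/
abbrev BalTensor (A B M N : Type*) [Ring A] [Ring B] [AddCommGroup M] [Module Aᵐᵒᵖ M]
    [AddCommGroup N] [Module A N] [Module Bᵐᵒᵖ N] : Type _ :=
  (N ⊗[ℤ] M) ⧸ Submodule.span Bᵐᵒᵖ {x : N ⊗[ℤ] M | ∃ (a : A) (m : M) (n : N),
    x = n ⊗ₜ[ℤ] (MulOpposite.op a • m) - (a • n) ⊗ₜ[ℤ] m}

end Modules

/-! ### Induction functors and permutation modules of the Brauer algebra -/

section Induction

variable (r : ℕ) (K : Type*) [Field K] (δ : K)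

/-- The two-sided ideal `J_m` generated by the diagrams with at least `m` horizontal edges. -/
noncomputable def layerIdeal (m : ℕ) : TwoSidedIdeal (BrauerC r K δ) :=
  TwoSidedIdeal.span {y | ∃ d : Diagram r, m ≤ d.horizontal ∧ y = BrauerC.diag δ d}

/-- The ideal `J_m` as a right submodule. -/
def layerSubmodule (m : ℕ) : Submodule (BrauerC r K δ)ᵐᵒᵖ (BrauerC r K δ) where
  carrier := {x | x ∈ layerIdeal r K δ m}
  add_mem' := fun hx hy => (layerIdeal r K δ m).add_mem hx hy
  zero_mem' := (layerIdeal r K δ m).zero_mem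
  smul_mem' := fun c x hx => (layerIdeal r K δ m).mul_mem_right x c.unop hx

/-- The quotient `B / J_m`, a `B`-`B`-bimodule. -/
abbrev LayerQuotient (m : ℕ) : Type _ := BrauerC r K δ ⧸ layerSubmodule r K δ m

/-- Left multiplication on `B / J_m`. -/
noncomputable def leftMulQuotient (m : ℕ) (b : BrauerC r K δ) :
    LayerQuotient r K δ m →ₗ[(BrauerC r K δ)ᵐᵒᵖ] LayerQuotient r K δ m :=
  (layerSubmodule r K δ m).mapQ (layerSubmodule r K δ m)
    (Module.toModuleEnd (BrauerC r K δ)ᵐᵒᵖ (BrauerC r K δ) b)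
    (fun x hx => (layerIdeal r K δ m).mul_mem_left b x hx)

noncomputable instance (m : ℕ) : SMul (BrauerC r K δ) (LayerQuotient r K δ m) :=
  ⟨fun b x => leftMulQuotient r K δ m b x⟩

theorem smul_mk_layer (m : ℕ) (b x : BrauerC r K δ) :
    b • (Submodule.Quotient.mk x : LayerQuotient r K δ m) = Submodule.Quotient.mk (b * x) := rfl

noncomputable instance (m : ℕ) : Module (BrauerC r K δ) (LayerQuotient r K δ m) where
  one_smul x := by
    induction x using Submodule.Quotient.induction_on with | _ x
    rw [smul_mk_layer, one_mul]
  mul_smul b c x := by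
    induction x using Submodule.Quotient.induction_on with | _ x
    rw [smul_mk_layer, smul_mk_layer, smul_mk_layer, mul_assoc]
  smul_zero b := map_zero (leftMulQuotient r K δ m b)
  smul_add b x y := map_add (leftMulQuotient r K δ m b) x y
  add_smul b c x := by
    induction x using Submodule.Quotient.induction_on with | _ x
    rw [smul_mk_layer, smul_mk_layer, smul_mk_layer, add_mul, Submodule.Quotient.mk_add]
  zero_smul x := by
    induction x using Submodule.Quotient.induction_on with | _ x
    rw [smul_mk_layer, zero_mul, Submodule.Quotient.mk_zero]

instance (m : ℕ) :
    SMulCommClass (BrauerC r K δ) (BrauerC r K δ)ᵐᵒᵖ (LayerQuotient r K δ m) where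
  smul_comm b c x := map_smul (leftMulQuotient r K δ m b) c x

section Corner

variable (l : ℕ) (X : Type*) [AddCommGroup X] [Module (BrauerC r K δ) X]
  [Module (BrauerC r K δ)ᵐᵒᵖ X] [SMulCommClass (BrauerC r K δ) (BrauerC r K δ)ᵐᵒᵖ X]

/-- The right `B`-module `e_l X` for a `B`-`B`-bimodule `X`. -/
noncomputable def corner : Submodule (BrauerC r K δ)ᵐᵒᵖ X :=
  LinearMap.range (Module.toModuleEnd (BrauerC r K δ)ᵐᵒᵖ X (BrauerC.e δ r l))

theorem hat_smul_mem_corner (a : HypAlg K (r - l)) {x : X} (hx : x ∈ corner r K δ l X) :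
    hat r K δ l a • x ∈ corner r K δ l X := by
  obtain ⟨y, rfl⟩ := hx
  refine ⟨hat r K δ l a • y, ?_⟩
  change BrauerC.e δ r l • hat r K δ l a • y = hat r K δ l a • BrauerC.e δ r l • y
  rw [smul_smul, smul_smul, hat_mul_e]

/-- The left action of the group algebra of rank `r - l` on `e_l X`. -/
noncomputable instance : Module (HypAlg K (r - l)) (corner r K δ l X) where
  smul a x := ⟨hat r K δ l a • x.1, hat_smul_mem_corner r K δ l X a x.2⟩
  one_smul x := Subtype.ext (show hat r K δ l 1 • x.1 = x.1 by rw [map_one, one_smul])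
  mul_smul a b x := Subtype.ext (show hat r K δ l (a * b) • x.1 = _ • _ • x.1 by
    rw [map_mul, mul_smul])
  smul_zero a := Subtype.ext (smul_zero _)
  smul_add a x y := Subtype.ext (smul_add _ _ _)
  add_smul a b x := Subtype.ext (show hat r K δ l (a + b) • x.1 = _ • x.1 + _ • x.1 by
    rw [map_add, add_smul])
  zero_smul x := Subtype.ext (show hat r K δ l 0 • x.1 = 0 by rw [map_zero, zero_smul])

end Corner

variable (l : ℕ) (M : Type*) [AddCommGroup M] [Module (HypAlg K (r - l))ᵐᵒᵖ M]

/-- `Ind_l M = M ⊗ e_l B`. -/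
abbrev BigInd : Type _ :=
  BalTensor (HypAlg K (r - l)) (BrauerC r K δ) M (corner r K δ l (BrauerC r K δ))

/-- `ind_l M = M ⊗ e_l (B / J_{l+1})`. -/
abbrev SmallInd : Type _ :=
  BalTensor (HypAlg K (r - l)) (BrauerC r K δ) M (corner r K δ l (LayerQuotient r K δ (l + 1)))

/-- The permutation module `M(l, lam) = Ind_l M(lam)` of the Brauer algebra. -/
abbrev BrauerPermModule (lam : BiPartition (r - l)) : Type _ :=
  BigInd r K δ l (PermModule K lam)

end Induction

/-- `N` is an indecomposable direct summand of `M(l, lam)` with a quotient isomorphic to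
`ind_l Y`. -/
def IsBrauerYoungModule (r : ℕ) (K : Type*) [Field K] (δ : K) (l : ℕ) (lam : BiPartition (r - l))
    (Y : Submodule (HypAlg K (r - l))ᵐᵒᵖ (PermModule K lam))
    (N : Submodule (BrauerC r K δ)ᵐᵒᵖ (BrauerPermModule r K δ l lam)) : Prop :=
  IsDirectSummand N ∧ Indecomposable (BrauerC r K δ)ᵐᵒᵖ N ∧
    HasQuotientIso (BrauerC r K δ)ᵐᵒᵖ N (SmallInd r K δ l Y)

end TypeC

/-! The two groups of assertions rest on one ring element and one local endomorphism ring. Write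
`κ_t` for the alternating column sum of a bitableau `t`, `T = M(l,λ) J_{l+1}`, `Q = ind_l Y(λ)`, and
let `s = e_l κ_t` act from the right.

For the hyperoctahedral group, James's argument gives `M(λ) κ_t = K {t}κ_t`: for bitableaux `s`, `t`
of the same shape, either an odd involution lies in the column group of `t` and in the row group of
`s`, and then `{s}κ_t = 0`, or `{s} = {t}σ` with `σ` in the column group, and then `{s}κ_t = ±
{t}κ_t` (`exists_odd_or_exists_isColPerm`, `exists_columnSum_smul_eq`). Since row and column group
meet trivially, `{t}κ_t ≠ 0`. Hence a summand of `M(λ)` on which `κ_t` is nonzero contains `S(λ)`,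
and an indecomposable one exists.

For the Brauer algebra, `e_l B e_l` equals `e_l W_{r-l}` modulo `J_{l+1}`
(`exists_e_mul_e_sub_mem`). So `e_l` maps `Ind_l M` to `M ⊗ e_l` modulo `T`, and `s` has rank at
most one on `M(l,λ)/T`. The submodule `T` is stable under endomorphisms and is killed by every
homomorphism to `Q`, because `J_{l+1}` annihilates `Q`; but `s` does not annihilate `Q`, because `y
↦ y ⊗ e_l` embeds `Y(λ)` in `Q`. Consequently at most one of two complementary summands of `M(l,λ)`
maps onto `Q`.

Conversely one of them does. Compose the projection `M(l,λ) → Q` with the projections to the two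
summands and cut down by `e_l`. This gives two homomorphisms `M(λ) → Y(λ)` whose restrictions to
`Y(λ)` add up to the identity. By Fitting's lemma one restriction is bijective, and the
corresponding summand then maps onto the generators `y ⊗ e_l` of `Q` (`exists_surjective_smallInd`).
These facts are collected in `RankOneTest`, from which existence, uniqueness up to isomorphism and
uniqueness within a decomposition follow formally, the isomorphism again by Fitting's lemma. -/

namespace TypeC

/-! ### Indecomposable summands of modules of finite length -/

section FiniteLength

variable {R X Q : Type*} [Ring R] [AddCommGroup X] [Module R X] [AddCommGroup Q] [Module R Q]

/-- In the endomorphism ring of an indecomposable module of finite length, one of two elements with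
sum `1` is invertible. -/
theorem Indecomposable.bijective_or_bijective [IsArtinian R X] [IsNoetherian R X]
    (hX : Indecomposable R X) {f g : Module.End R X} (hfg : f + g = 1) :
    Function.Bijective f ∨ Function.Bijective g := by
  obtain ⟨n, hn⟩ := Filter.eventually_atTop.1 f.eventually_isCompl_ker_pow_range_pow
  -- Fitting decomposition. The exponent `n + 1` is positive, which is needed to pass from an
  -- invertible power to an invertible `f`.
  have hc := hn (n + 1) (Nat.le_succ n)
  rcases hX.2 _ _ hc with h | h
  · left
    have hr : LinearMap.range (f ^ (n + 1)) = ⊤ := by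
      have := hc.sup_eq_top; rwa [h, bot_sup_eq] at this
    have hu : IsUnit (f ^ (n + 1)) :=
      (Module.End.isUnit_iff _).2 ⟨LinearMap.ker_eq_bot.1 h, LinearMap.range_eq_top.1 hr⟩
    exact (Module.End.isUnit_iff _).1 ((isUnit_pow_iff (Nat.succ_ne_zero n)).1 hu)
  · right
    have hnil : IsNilpotent f := ⟨n + 1, LinearMap.range_eq_bot.1 h⟩
    rw [← eq_sub_iff_add_eq'] at hfg
    exact (Module.End.isUnit_iff _).1 (hfg ▸ hnil.isUnit_one_sub)

/-- Take a minimal direct summand with `P`. If it splits, one of the two parts inherits `P` and is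
itself a summand of `X`, so by minimality it is everything. Typically `P` says that a fixed ring
element acts nontrivially. -/
theorem exists_indecomposable_summand [IsArtinian R X] (P : Submodule R X → Prop) (htop : P ⊤)
    (hbot : ¬ P ⊥) (hsup : ∀ p q, P (p ⊔ q) → P p ∨ P q) :
    ∃ N, IsDirectSummand N ∧ Indecomposable R N ∧ P N := by
  obtain ⟨N, ⟨⟨C, hC⟩, hN⟩, hmin⟩ := (wellFounded_lt (α := Submodule R X)).has_min
    {N | IsDirectSummand N ∧ P N} ⟨⊤, ⟨⊥, isCompl_top_bot⟩, htop⟩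
  refine ⟨N, ⟨C, hC⟩, ⟨?_, ?_⟩, hN⟩
  · rw [Submodule.nontrivial_iff_ne_bot]
    rintro rfl
    exact hbot hN
  · have key : ∀ p q : Submodule R N, IsCompl p q → P (p.map N.subtype) → q = ⊥ := by
      intro p q hpq hp
      have hdisj : Disjoint (p.map N.subtype) (q.map N.subtype) :=
        Submodule.disjoint_map N.injective_subtype hpq.disjoint
      have hsum : p.map N.subtype ⊔ q.map N.subtype = N := by
        rw [← Submodule.map_sup, hpq.sup_eq_top, Submodule.map_top, Submodule.range_subtype]
      have hle : p.map N.subtype ≤ N := Submodule.map_subtype_le N p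
      have hs : IsDirectSummand (p.map N.subtype) := by
        refine ⟨q.map N.subtype ⊔ C, ?_, ?_⟩
        · exact hdisj.disjoint_sup_right_of_disjoint_sup_left (by rw [hsum]; exact hC.disjoint)
        · rw [codisjoint_iff, ← sup_assoc, hsum, hC.sup_eq_top]
      have heq : p.map N.subtype = N :=
        hle.lt_or_eq.resolve_left fun h => hmin _ ⟨hs, hp⟩ h
      rw [heq] at hdisj
      have : q.map N.subtype = ⊥ := by
        rw [← le_bot_iff]
        exact hdisj (Submodule.map_subtype_le N q) le_rfl
      exact Submodule.map_injective_of_injective N.injective_subtype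
        (this.trans (Submodule.map_bot _).symm)
    intro p q hpq
    have hsum : p.map N.subtype ⊔ q.map N.subtype = N := by
      rw [← Submodule.map_sup, hpq.sup_eq_top, Submodule.map_top, Submodule.range_subtype]
    rcases hsup _ _ (by rw [hsum]; exact hN) with h | h
    · exact Or.inr (key p q hpq h)
    · exact Or.inl (key q p hpq.symm h)

/-! ### Summands detected by a ring element of rank at most one -/

theorem hasQuotientIso_iff {N : Type*} [AddCommGroup N] [Module R N] :
    HasQuotientIso R N Q ↔ ∃ f : N →ₗ[R] Q, Function.Surjective f := by
  constructor
  · rintro ⟨U, ⟨φ⟩⟩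
    exact ⟨φ.toLinearMap ∘ₗ U.mkQ, φ.surjective.comp U.mkQ_surjective⟩
  · rintro ⟨f, hf⟩
    exact ⟨LinearMap.ker f, ⟨f.quotKerEquivOfSurjective hf⟩⟩

/-- A ring element `s` acts on `X` with rank at most one modulo a submodule `T` that is killed by
all homomorphisms to `Q`, but `s` does not act as zero on `Q`. Moreover one of the summands of every
decomposition of `X` in two summands maps onto `Q`. -/
structure RankOneTest (s : R) (T : Submodule R X) (Q : Type*) [AddCommGroup Q] [Module R Q] :
    Prop where
  invariant : ∀ f : X →ₗ[R] X, ∀ x ∈ T, f x ∈ T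
  killed : ∀ f : X →ₗ[R] Q, ∀ x ∈ T, f x = 0
  rank_le : ∀ x y : X, s • x ∉ T → ∃ c : R, s • y - c • s • x ∈ T
  exists_smul_ne : ∃ z : Q, s • z ≠ 0
  exists_surjective : ∀ N C : Submodule R X, IsCompl N C →
    (∃ f : N →ₗ[R] Q, Function.Surjective f) ∨ ∃ f : C →ₗ[R] Q, Function.Surjective f

namespace RankOneTest

variable {s : R} {T : Submodule R X}

/-- Lift to `N` an element of `Q` not annihilated by `s`. The map `N → Q`, extended by zero on the
complement, kills `T` but not `s • x`. -/
theorem exists_of_hasQuotientIso (h : RankOneTest s T Q) {N C : Submodule R X} (hN : IsCompl N C)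
    (hQ : HasQuotientIso R N Q) : ∃ x ∈ N, s • x ∉ T := by
  obtain ⟨f, hf⟩ := hasQuotientIso_iff.1 hQ
  obtain ⟨z, hz⟩ := h.exists_smul_ne
  obtain ⟨x, rfl⟩ := hf z
  refine ⟨x, x.2, fun hx => hz ?_⟩
  have := h.killed (f ∘ₗ N.projectionOnto C hN) _ hx
  rwa [map_smul, LinearMap.comp_apply, Submodule.projectionOnto_apply_left] at this

/-- If `s` were nonzero modulo `T` on both summands, its rank there would be at least two: the
projection to `C` preserves `T`, kills `s • x` and fixes `s • y`, so the relation between them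
modulo `T` forces `s • y ∈ T`. -/
theorem false_of_isCompl (h : RankOneTest s T Q) {N C : Submodule R X} (hN : IsCompl N C)
    (h1 : ∃ x ∈ N, s • x ∉ T) (h2 : ∃ x ∈ C, s • x ∉ T) : False := by
  obtain ⟨x, hx, hx'⟩ := h1
  obtain ⟨y, hy, hy'⟩ := h2
  obtain ⟨c, hc⟩ := h.rank_le x y hx'
  have := h.invariant (C.projection N hN.symm) _ hc
  rw [map_sub, map_smul, map_smul, map_smul, Submodule.projection_apply_of_mem_left _ hy,
    Submodule.projection_apply_of_mem_right _ hx, smul_zero, smul_zero, sub_zero] at this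
  exact hy' this

/-- One of `N`, `C` maps onto `Q`; if it were `C`, then `s` would be nonzero modulo `T` on both.
With `exists_of_hasQuotientIso`, having the quotient `Q` becomes, for summands, the condition that
`s` is nonzero modulo `T`, which is additive and easy to follow through decompositions. -/
theorem hasQuotientIso_of_exists (h : RankOneTest s T Q) {N C : Submodule R X} (hN : IsCompl N C)
    (h1 : ∃ x ∈ N, s • x ∉ T) : HasQuotientIso R N Q := by
  rcases h.exists_surjective N C hN with hf | hf
  · exact hasQuotientIso_iff.2 hf
  · exact (h.false_of_isCompl hN h1
      (h.exists_of_hasQuotientIso hN.symm (hasQuotientIso_iff.2 hf))).elim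

theorem exists_smul_notMem (h : RankOneTest s T Q) : ∃ x, s • x ∉ T := by
  rcases h.exists_surjective ⊤ ⊥ isCompl_top_bot with hf | hf
  · obtain ⟨x, -, hx⟩ := h.exists_of_hasQuotientIso isCompl_top_bot (hasQuotientIso_iff.2 hf)
    exact ⟨x, hx⟩
  · obtain ⟨x, -, hx⟩ := h.exists_of_hasQuotientIso isCompl_bot_top (hasQuotientIso_iff.2 hf)
    exact ⟨x, hx⟩

theorem exists_summand [IsArtinian R X] (h : RankOneTest s T Q) :
    ∃ N : Submodule R X, IsDirectSummand N ∧ Indecomposable R N ∧ HasQuotientIso R N Q := by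
  obtain ⟨N, ⟨C, hC⟩, h2, h3⟩ := exists_indecomposable_summand (R := R) (X := X)
    (fun N => ∃ x ∈ N, s • x ∉ T) (by simpa using h.exists_smul_notMem)
    (by simp) (by
      rintro p q ⟨x, hx, hx'⟩
      obtain ⟨y, hy, z, hz, rfl⟩ := Submodule.mem_sup.1 hx
      by_contra! hcon
      exact hx' (by rw [smul_add]; exact T.add_mem (hcon.1 y hy) (hcon.2 z hz)))
  exact ⟨N, ⟨C, hC⟩, h2, h.hasQuotientIso_of_exists hC h3⟩

/-- The endomorphisms of `N` that factor through `N'` and `C'` add up to `1`, so one of them is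
bijective. If it were the one through `C'`, then `C'` would map onto `N` and hence onto `Q`, as `N'`
does, which is excluded. -/
theorem bijective_comp [IsArtinian R X] [IsNoetherian R X] (h : RankOneTest s T Q)
    {N C N' C' : Submodule R X} (hN : IsCompl N C) (hN' : IsCompl N' C')
    (hi : Indecomposable R N) (hq : HasQuotientIso R N Q) (hq' : HasQuotientIso R N' Q) :
    Function.Bijective ((N.projectionOnto C hN ∘ₗ N'.subtype) ∘ₗ
      (N'.projectionOnto C' hN' ∘ₗ N.subtype)) := by
  have hsum : ((N.projectionOnto C hN ∘ₗ N'.subtype) ∘ₗ (N'.projectionOnto C' hN' ∘ₗ N.subtype)) +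
      ((N.projectionOnto C hN ∘ₗ C'.subtype) ∘ₗ
        (C'.projectionOnto N' hN'.symm ∘ₗ N.subtype)) = (1 : Module.End R N) := by
    ext1 x
    have e : N'.projection C' hN' x.1 + C'.projection N' hN'.symm x.1 = x.1 :=
      Submodule.projection_add_projection_eq_self hN' x.1
    have := congrArg (N.projectionOnto C hN) e
    rw [map_add, Submodule.projectionOnto_apply_left] at this
    exact this
  rcases hi.bijective_or_bijective hsum with hb | hb
  · exact hb
  · exfalso
    refine h.false_of_isCompl hN' (h.exists_of_hasQuotientIso hN' hq') ?_
    refine h.exists_of_hasQuotientIso hN'.symm ?_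
    obtain ⟨f, hf⟩ := hasQuotientIso_iff.1 hq
    refine hasQuotientIso_iff.2 ⟨f ∘ₗ N.projectionOnto C hN ∘ₗ C'.subtype, hf.comp ?_⟩
    exact Function.Surjective.of_comp (f := N.projectionOnto C hN ∘ₗ C'.subtype)
      (g := C'.projectionOnto N' hN'.symm ∘ₗ N.subtype) hb.2

/-- The projection `N' → N` is an isomorphism: `bijective_comp` applied in the two orders makes it
injective and surjective. -/
theorem nonempty_equiv [IsArtinian R X] [IsNoetherian R X] (h : RankOneTest s T Q)
    {N N' : Submodule R X} (hN : IsDirectSummand N) (hN' : IsDirectSummand N')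
    (hi : Indecomposable R N) (hi' : Indecomposable R N') (hq : HasQuotientIso R N Q)
    (hq' : HasQuotientIso R N' Q) : Nonempty (N' ≃ₗ[R] N) := by
  obtain ⟨C, hC⟩ := hN
  obtain ⟨C', hC'⟩ := hN'
  refine ⟨LinearEquiv.ofBijective (N.projectionOnto C hC ∘ₗ N'.subtype) ⟨?_, ?_⟩⟩
  · exact Function.Injective.of_comp (f := N'.projectionOnto C' hC' ∘ₗ N.subtype)
      (g := N.projectionOnto C hC ∘ₗ N'.subtype) (h.bijective_comp hC' hC hi' hq' hq).1
  · exact Function.Surjective.of_comp (f := N.projectionOnto C hC ∘ₗ N'.subtype)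
      (g := N'.projectionOnto C' hC' ∘ₗ N.subtype) (h.bijective_comp hC hC' hi hq hq').2

theorem existsUnique_of_isInternal (h : RankOneTest s T Q) {k : ℕ} {N : Fin k → Submodule R X}
    (hN : DirectSum.IsInternal N) : ∃! i, HasQuotientIso R (N i) Q := by
  have hind := hN.submodule_iSupIndep
  have htop := hN.submodule_iSup_eq_top
  -- Grouping all other summands reduces everything to decompositions in two summands.
  have hc : ∀ i, IsCompl (N i) (⨆ j ≠ i, N j) := by
    intro i
    refine ⟨hind i, ?_⟩
    rw [codisjoint_iff, ← htop]
    refine le_antisymm (sup_le (le_iSup N i) (iSup₂_le fun j _ => le_iSup N j)) (iSup_le fun j => ?_)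
    by_cases hj : j = i
    · subst hj; exact le_sup_left
    · exact le_sup_of_le_right (le_iSup₂_of_le j hj le_rfl)
  obtain ⟨i, hi⟩ : ∃ i, ∃ x ∈ N i, s • x ∉ T := by
    by_contra! hcon
    obtain ⟨x, hx⟩ := h.exists_smul_notMem
    have hmem : x ∈ ⨆ i, N i := by rw [htop]; trivial
    refine hx (Submodule.iSup_induction N (motive := fun x => s • x ∈ T) hmem hcon ?_ ?_)
    · rw [smul_zero]; exact T.zero_mem
    · intro y z hy hz
      rw [smul_add]; exact T.add_mem hy hz
  refine ⟨i, h.hasQuotientIso_of_exists (hc i) hi, fun j hj => ?_⟩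
  by_contra hne
  obtain ⟨y, hy, hy'⟩ := h.exists_of_hasQuotientIso (hc j) hj
  exact h.false_of_isCompl (hc i) hi ⟨y, Submodule.mem_iSup_of_mem j
    (Submodule.mem_iSup_of_mem hne hy), hy'⟩

end RankOneTest

end FiniteLength

/-! ### Signs of signed permutations -/

section Signs

variable {n : ℕ}

theorem fst_eq_iff (v w : Vertex n) : v.1 = w.1 ↔ v = w ∨ v = refl w := by
  obtain ⟨i, s⟩ := v
  obtain ⟨k, t⟩ := w
  cases s <;> cases t <;> simp [refl]

theorem fst_refl (v : Vertex n) : (refl v).1 = v.1 := rfl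

/-- The sign of `σ (τ i)` is the sign of `σ |τ i|` times that of `τ i`; in the product over `i` the
first factors are reindexed along the permutation `|τ|`. -/
theorem hypSgn_mul (σ τ : Hyp n) : hypSgn (σ * τ) = hypSgn σ * hypSgn τ := by
  have habs : hypAbs (σ * τ) = hypAbs σ * hypAbs τ := by
    ext1 i
    exact (hypAbs_eq_iff σ _ _).2 rfl
  have hsign : ∀ v : Vertex n, (if (σ.1 v).2 then (1 : ℤˣ) else -1) =
      (if (σ.1 (v.1, true)).2 then 1 else -1) * (if v.2 then 1 else -1) := by
    rintro ⟨i, _ | _⟩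
    · have : σ.1 (i, false) = refl (σ.1 (i, true)) := hyp_apply_refl σ (i, true)
      rw [this]
      cases h : (σ.1 (i, true)).2 <;> simp [refl, h]
    · simp
  have hprod : (∏ i : Fin n, if ((σ * τ).1 (i, true)).2 then (1 : ℤˣ) else -1) =
      (∏ i : Fin n, if (σ.1 (i, true)).2 then 1 else -1) *
        ∏ i : Fin n, if (τ.1 (i, true)).2 then 1 else -1 := by
    rw [← Equiv.prod_comp (hypAbs τ) (fun i => if (σ.1 (i, true)).2 then (1 : ℤˣ) else -1),
      ← Finset.prod_mul_distrib]
    exact Finset.prod_congr rfl fun i _ => hsign (τ.1 (i, true))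
  rw [hypSgn, habs, map_mul, hprod, hypSgn, hypSgn]
  exact mul_mul_mul_comm _ _ _ _

theorem hypSgn_one : hypSgn (1 : Hyp n) = 1 := by
  have := hypSgn_mul (1 : Hyp n) 1
  rw [one_mul] at this
  exact (mul_eq_left.1 this.symm)

/-- The change of a single sign. -/
theorem exists_signChange (i : Fin n) : ∃ τ : Hyp n, τ * τ = 1 ∧ hypSgn τ = -1 ∧
    (∀ v : Vertex n, v.1 = i → τ.1 v = refl v) ∧ ∀ v : Vertex n, v.1 ≠ i → τ.1 v = v := by
  let f : Vertex n → Vertex n := fun v => if v.1 = i then refl v else v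
  have hf : Function.Involutive f := by
    intro v
    by_cases h : v.1 = i <;> simp [f, h, fst_refl]
  have h1 : ∀ v : Vertex n, v.1 = i → f v = refl v := fun v hv => if_pos hv
  have h2 : ∀ v : Vertex n, v.1 ≠ i → f v = v := fun v hv => if_neg hv
  have hmem : hf.toPerm ∈ Hyp n := by
    intro v
    change f (refl v) = refl (f v)
    by_cases h : v.1 = i
    · rw [h1 v h, h1 (refl v) h]
    · rw [h2 v h, h2 (refl v) h]
  refine ⟨⟨hf.toPerm, hmem⟩, Subtype.ext (Equiv.ext hf), ?_, h1, h2⟩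
  · have habs : hypAbs (⟨hf.toPerm, hmem⟩ : Hyp n) = 1 := by
      ext1 k
      change (f (k, true)).1 = k
      by_cases h : k = i
      · rw [h1 (k, true) h]; rfl
      · rw [h2 (k, true) h]
    rw [hypSgn, habs, map_one, mul_one]
    change (∏ k : Fin n, if (f (k, true)).2 then (1 : ℤˣ) else -1) = -1
    rw [Finset.prod_eq_single i]
    · rw [h1 (i, true) rfl]; rfl
    · intro k _ hk
      rw [h2 (k, true) hk]; rfl
    · simp

/-- The transposition of two vertices (and of their reflections). -/
theorem exists_signedSwap (v w : Vertex n) (h : v.1 ≠ w.1) : ∃ τ : Hyp n, τ * τ = 1 ∧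
    hypSgn τ = -1 ∧ τ.1 v = w ∧ τ.1 w = v ∧
    ∀ u : Vertex n, u.1 ≠ v.1 → u.1 ≠ w.1 → τ.1 u = u := by
  -- The sign is flipped exactly when `v` and `w` have different signs, so that `v ↔ w` and `-v ↔
  -- -w`.
  let f : Vertex n → Vertex n := fun u => if u.1 = v.1 then (w.1, u.2 ^^ (v.2 ^^ w.2)) else
    if u.1 = w.1 then (v.1, u.2 ^^ (v.2 ^^ w.2)) else u
  have h1 : ∀ u : Vertex n, u.1 = v.1 → f u = (w.1, u.2 ^^ (v.2 ^^ w.2)) := fun u hu => if_pos hu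
  have h2 : ∀ u : Vertex n, u.1 = w.1 → f u = (v.1, u.2 ^^ (v.2 ^^ w.2)) := fun u hu =>
    (if_neg (by rw [hu]; exact h.symm)).trans (if_pos hu)
  have h3 : ∀ u : Vertex n, u.1 ≠ v.1 → u.1 ≠ w.1 → f u = u := fun u hu hu' =>
    (if_neg hu).trans (if_neg hu')
  have hf : Function.Involutive f := by
    intro u
    by_cases hu : u.1 = v.1
    · rw [h1 u hu, h2 (w.1, u.2 ^^ (v.2 ^^ w.2)) rfl]
      exact Prod.ext hu.symm (by simp)
    · by_cases hu' : u.1 = w.1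
      · rw [h2 u hu', h1 (v.1, u.2 ^^ (v.2 ^^ w.2)) rfl]
        exact Prod.ext hu'.symm (by simp)
      · rw [h3 u hu hu', h3 u hu hu']
  have hmem : hf.toPerm ∈ Hyp n := by
    intro u
    change f (refl u) = refl (f u)
    by_cases hu : u.1 = v.1
    · rw [h1 u hu, h1 (refl u) hu]; simp [refl]
    · by_cases hu' : u.1 = w.1
      · rw [h2 u hu', h2 (refl u) hu']; simp [refl]
      · rw [h3 u hu hu', h3 (refl u) hu hu']
  refine ⟨⟨hf.toPerm, hmem⟩, Subtype.ext (Equiv.ext hf), ?_, ?_, ?_, h3⟩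
  · have habs : hypAbs (⟨hf.toPerm, hmem⟩ : Hyp n) = Equiv.swap v.1 w.1 := by
      ext1 k
      change (f (k, true)).1 = _
      by_cases hu : k = v.1
      · rw [h1 (k, true) hu, hu, Equiv.swap_apply_left]
      · by_cases hu' : k = w.1
        · rw [h2 (k, true) hu', hu', Equiv.swap_apply_right]
        · rw [h3 (k, true) hu hu', Equiv.swap_apply_of_ne_of_ne hu hu']
    rw [hypSgn, habs, Equiv.Perm.sign_swap h]
    change (∏ k : Fin n, if (f (k, true)).2 then (1 : ℤˣ) else -1) * -1 = -1
    -- The two exchanged indices change sign together or not at all, so their factors cancel and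
    -- only the sign of the transposition remains.
    rw [Finset.prod_eq_mul v.1 w.1 h, h1 (v.1, true) rfl, h2 (w.1, true) rfl]
    · split_ifs <;> simp
    · rintro k - ⟨hk, hk'⟩
      rw [h3 (k, true) hk hk']; rfl
    · simp
    · simp
  · change f v = w
    rw [h1 v rfl]
    exact Prod.ext rfl (by simp)
  · change f w = v
    rw [h2 w rfl]
    exact Prod.ext rfl (by cases v.2 <;> cases w.2 <;> rfl)

end Signs

/-! ### Sorting the columns of a Young diagram -/

/-- If a weight on the cells of a Young diagram takes distinct values in each column and has the
same sum as the row index, then the cells can be permuted within the columns in such a way that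
the row index becomes equal to the weight. -/
theorem exists_columnSort (μ : YoungDiagram) (w : μ.cells → ℕ)
    (hinj : ∀ b b' : μ.cells, b.1.2 = b'.1.2 → w b = w b' → b = b')
    (hsum : ∑ b, w b = ∑ b : μ.cells, b.1.1) :
    ∃ φ : Equiv.Perm μ.cells, ∀ b, (φ b).1.2 = b.1.2 ∧ (φ b).1.1 = w b := by
  -- The new row of `b` is its rank by weight within its column, counted from `0`. The cells of
  -- smaller weight have distinct weights below `w b`, so the rank is at most `w b`.
  let S : μ.cells → Finset μ.cells := fun b =>
    Finset.univ.filter fun b' => b'.1.2 = b.1.2 ∧ w b' < w b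
  have hS : ∀ b b', b' ∈ S b ↔ b'.1.2 = b.1.2 ∧ w b' < w b := fun b b' => by simp [S]
  have hle : ∀ b, (S b).card ≤ w b := by
    intro b
    calc (S b).card = ((S b).image w).card := by
          refine (Finset.card_image_of_injOn fun x hx y hy hxy => ?_).symm
          exact hinj x y (((hS b x).1 hx).1.trans ((hS b y).1 hy).1.symm) hxy
      _ ≤ (Finset.range (w b)).card := by
          refine Finset.card_le_card fun k hk => ?_
          obtain ⟨x, hx, rfl⟩ := Finset.mem_image.1 hk
          exact Finset.mem_range.2 ((hS b x).1 hx).2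
      _ = w b := Finset.card_range _
  -- The cells of `S b` together with `b` are distinct cells of one column, so the rank is less than
  -- the column length.
  have hmem : ∀ b, ((S b).card, b.1.2) ∈ μ.cells := by
    intro b
    rw [YoungDiagram.mem_cells, YoungDiagram.mem_iff_lt_colLen]
    calc (S b).card < (insert b (S b)).card := by
          rw [Finset.card_insert_of_notMem fun h => lt_irrefl _ ((hS b b).1 h).2]
          exact Nat.lt_succ_self _
      _ = ((insert b (S b)).image fun x => x.1.1).card := by
          have hcol : ∀ x ∈ insert b (S b), x.1.2 = b.1.2 := fun x hx =>
            (Finset.mem_insert.1 hx).elim (fun h => by rw [h]) fun h => ((hS b x).1 h).1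
          refine (Finset.card_image_of_injOn fun x hx y hy hxy => ?_).symm
          exact Subtype.ext (Prod.ext hxy ((hcol x hx).trans (hcol y hy).symm))
      _ ≤ (Finset.range (μ.colLen b.1.2)).card := by
          refine Finset.card_le_card fun k hk => ?_
          obtain ⟨x, hx, rfl⟩ := Finset.mem_image.1 hk
          have hcol : x.1.2 = b.1.2 :=
            (Finset.mem_insert.1 hx).elim (fun h => by rw [h]) fun h => ((hS b x).1 h).1
          rw [Finset.mem_range, ← hcol, ← YoungDiagram.mem_iff_lt_colLen]
          exact (YoungDiagram.mem_cells _).1 x.2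
      _ = μ.colLen b.1.2 := Finset.card_range _
  have hlt : ∀ b b', b.1.2 = b'.1.2 → w b < w b' → (S b).card < (S b').card := by
    intro b b' hc hw
    refine Finset.card_lt_card ⟨fun x hx => ?_, fun hsub => ?_⟩
    · rw [hS] at hx ⊢
      exact ⟨hx.1.trans hc, hx.2.trans hw⟩
    · exact lt_irrefl _ ((hS b b).1 (hsub ((hS b' b).2 ⟨hc, hw⟩))).2
  let f : μ.cells → μ.cells := fun b => ⟨_, hmem b⟩
  have hf : Function.Injective f := by
    intro b b' h
    have h1 : (S b).card = (S b').card := congrArg (fun x : μ.cells => x.1.1) h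
    have h2 : b.1.2 = b'.1.2 := (Prod.ext_iff.1 (Subtype.ext_iff.1 h)).2
    rcases lt_trichotomy (w b) (w b') with h3 | h3 | h3
    · exact absurd h1 (hlt b b' h2 h3).ne
    · exact hinj b b' h2 h3
    · exact absurd h1 (hlt b' b h2.symm h3).ne'
  let φ : Equiv.Perm μ.cells := Equiv.ofBijective f (Finite.injective_iff_bijective.1 hf)
  -- Ranks are the row indices after a permutation of the cells, so their sum is the sum of the
  -- weights; termwise inequality then becomes equality.
  have hsum' : ∑ b, (S b).card = ∑ b, w b := by
    rw [hsum]
    exact Equiv.sum_comp φ fun b : μ.cells => b.1.1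
  refine ⟨φ, fun b => ⟨rfl, ?_⟩⟩
  exact (Finset.sum_eq_sum_iff_of_le fun b _ => hle b).1 hsum' b (Finset.mem_univ b)

/-! ### Row and column groups of bitableaux -/

namespace BiTableau

variable {n : ℕ} {lam : BiPartition n}

/-- The boxes of a bitableau correspond to the absolute values of its entries. -/
noncomputable def absEquiv (t : BiTableau lam) : lam.Box ≃ Fin n :=
  Equiv.ofBijective (fun b => (t.entry b).1) <|
    (Fintype.bijective_iff_injective_and_card _).2 ⟨t.abs_injective, by
      simpa [YoungDiagram.card] using lam.card_add_card⟩

theorem absEquiv_apply (t : BiTableau lam) (b : lam.Box) : t.absEquiv b = (t.entry b).1 := rfl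

theorem exists_entry (t : BiTableau lam) (v : Vertex n) :
    ∃ b, v = t.entry b ∨ v = refl (t.entry b) := by
  refine ⟨t.absEquiv.symm v.1, (fst_eq_iff _ _).1 ?_⟩
  rw [← absEquiv_apply, Equiv.apply_symm_apply]

/-- The signed permutation taking each entry of `t` to the entry of `s` in the same box does this,
up to the inverse built into `act`. Together with `eq_of_act_eq` the action is simply transitive. -/
theorem exists_act_eq (t s : BiTableau lam) : ∃ σ : Hyp n, s = t.act σ := by
  let f : BiTableau lam → BiTableau lam → Vertex n → Vertex n := fun t s v =>
    ((s.entry (t.absEquiv.symm v.1)).1,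
      v.2 ^^ ((t.entry (t.absEquiv.symm v.1)).2 ^^ (s.entry (t.absEquiv.symm v.1)).2))
  have hf : ∀ t s : BiTableau lam, ∀ v, f s t (f t s v) = v := by
    intro t s v
    have h1 : s.absEquiv.symm (f t s v).1 = t.absEquiv.symm v.1 := by
      rw [Equiv.symm_apply_eq, absEquiv_apply]
    refine Prod.ext ?_ ?_
    · change (t.entry (s.absEquiv.symm (f t s v).1)).1 = v.1
      rw [h1, ← absEquiv_apply, Equiv.apply_symm_apply]
    · change ((f t s v).2 ^^ ((s.entry (s.absEquiv.symm (f t s v).1)).2 ^^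
        (t.entry (s.absEquiv.symm (f t s v).1)).2)) = v.2
      rw [h1]
      change ((v.2 ^^ ((t.entry (t.absEquiv.symm v.1)).2 ^^ (s.entry (t.absEquiv.symm v.1)).2)) ^^
        ((s.entry (t.absEquiv.symm v.1)).2 ^^ (t.entry (t.absEquiv.symm v.1)).2)) = v.2
      generalize (t.entry (t.absEquiv.symm v.1)).2 = x
      generalize (s.entry (t.absEquiv.symm v.1)).2 = y
      cases x <;> cases y <;> simp
  let σ : Hyp n := ⟨⟨f t s, f s t, hf t s, hf s t⟩, fun v => Prod.ext rfl
    (by change ((!v.2) ^^ (_ ^^ _)) = !(v.2 ^^ (_ ^^ _)); simp [refl])⟩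
  refine ⟨σ⁻¹, ?_⟩
  ext1
  funext b
  change s.entry b = (σ⁻¹⁻¹).1 (t.entry b)
  rw [inv_inv]
  have hb : t.absEquiv.symm (t.entry b).1 = b := by rw [Equiv.symm_apply_eq]; rfl
  change s.entry b = f t s (t.entry b)
  refine Prod.ext ?_ ?_
  · change _ = (s.entry (t.absEquiv.symm (t.entry b).1)).1
    rw [hb]
  · change _ = ((t.entry b).2 ^^ ((t.entry (t.absEquiv.symm (t.entry b).1)).2 ^^
      (s.entry (t.absEquiv.symm (t.entry b).1)).2))
    rw [hb]
    simp

theorem eq_of_act_eq (t : BiTableau lam) {σ ρ : Hyp n} (h : t.act σ = t.act ρ) : σ = ρ := by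
  rw [← inv_inj]
  refine Subtype.ext (Equiv.ext fun v => ?_)
  have hb : ∀ b, (σ⁻¹).1 (t.entry b) = (ρ⁻¹).1 (t.entry b) := fun b =>
    congrFun (congrArg BiTableau.entry h) b
  obtain ⟨b, rfl | rfl⟩ := t.exists_entry v
  · exact hb b
  · rw [hyp_apply_refl, hyp_apply_refl, hb]

theorem IsColPerm.one (t : BiTableau lam) : t.IsColPerm 1 := fun b => ⟨b, rfl, rfl, Or.inl rfl⟩

theorem IsColPerm.mul {t : BiTableau lam} {σ τ : Hyp n} (hσ : t.IsColPerm σ)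
    (hτ : t.IsColPerm τ) : t.IsColPerm (σ * τ) := by
  intro b
  obtain ⟨b', h1, h2, h3⟩ := hτ b
  obtain ⟨b'', k1, k2, k3⟩ := hσ b'
  refine ⟨b'', k1.trans h1, k2.trans h2, ?_⟩
  change σ.1 (τ.1 _) = _ ∨ _ ∧ σ.1 (τ.1 _) = _
  rcases h3 with h3 | ⟨h3', h3⟩ <;> rcases k3 with k3 | ⟨k3', k3⟩ <;> rw [h3]
  · exact Or.inl k3
  · exact Or.inr ⟨h1 ▸ k3', k3⟩
  · exact Or.inr ⟨h3', by rw [hyp_apply_refl, k3]⟩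
  · exact Or.inl (by rw [hyp_apply_refl, k3, refl_refl])

theorem IsColPerm.inv {t : BiTableau lam} {σ : Hyp n} (hσ : t.IsColPerm σ) :
    t.IsColPerm σ⁻¹ := by
  have hpow : ∀ k : ℕ, t.IsColPerm (σ ^ k) := by
    intro k
    induction k with
    | zero => exact IsColPerm.one t
    | succ k ih => rw [pow_succ]; exact ih.mul hσ
  have : σ⁻¹ = σ ^ (orderOf σ - 1) := by
    rw [inv_eq_iff_mul_eq_one, ← pow_succ', Nat.sub_add_cancel (orderOf_pos σ), pow_orderOf_eq_one]
  rw [this]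
  exact hpow _

theorem IsColPerm.mul_iff {t : BiTableau lam} {σ τ : Hyp n} (hσ : t.IsColPerm σ) :
    t.IsColPerm (σ * τ) ↔ t.IsColPerm τ :=
  ⟨fun h => by simpa using hσ.inv.mul h, hσ.mul⟩

/-- A box is determined by its component and position. -/
theorem box_ext {b b' : lam.Box} (h1 : b.isLeft = b'.isLeft)
    (h2 : BiPartition.pos b = BiPartition.pos b') : b = b' := by
  rcases b with b | b <;> rcases b' with b' | b'
  · exact congrArg Sum.inl (Subtype.ext h2)
  · simp at h1
  · simp at h1
  · exact congrArg Sum.inr (Subtype.ext h2)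

/-- Each box keeps its row and its column, so only signs could change; rows allow this in the second
component only and columns in the first only. -/
theorem eq_one_of_isRowPerm_of_isColPerm {t : BiTableau lam} {σ : Hyp n} (hr : t.IsRowPerm σ)
    (hc : t.IsColPerm σ) : σ = 1 := by
  refine t.eq_of_act_eq (ρ := 1) ?_
  have key : ∀ b, σ.1 (t.entry b) = t.entry b := by
    intro b
    obtain ⟨b', h1, h2, h3⟩ := hr b
    obtain ⟨b'', k1, k2, k3⟩ := hc b
    have hb : b' = b'' := by
      refine t.abs_injective ?_
      have e1 : (σ.1 (t.entry b)).1 = (t.entry b').1 := by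
        rcases h3 with h3 | ⟨-, h3⟩ <;> rw [h3]
        rfl
      have e2 : (σ.1 (t.entry b)).1 = (t.entry b'').1 := by
        rcases k3 with k3 | ⟨-, k3⟩ <;> rw [k3]
        rfl
      exact e1.symm.trans e2
    subst hb
    have hb : b' = b := box_ext h1 (Prod.ext h2 k2)
    subst hb
    rcases h3 with h3 | ⟨h3', -⟩
    · exact h3
    · rcases k3 with k3 | ⟨k3', -⟩
      · exact k3
      · rcases b' with b' | b' <;> simp at h3' k3'
  ext1
  funext b
  change (σ⁻¹).1 (t.entry b) = t.entry b
  rw [InvMemClass.coe_inv, Equiv.Perm.inv_eq_iff_eq, key]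

/-- Either some odd involution is a column permutation of `t` and a row permutation of `s`, or the
bitabloid of `s` is obtained from that of `t` by a column permutation of `t`. -/
theorem exists_odd_or_exists_isColPerm (s t : BiTableau lam) :
    (∃ τ : Hyp n, t.IsColPerm τ ∧ s.IsRowPerm τ ∧ τ * τ = 1 ∧ hypSgn τ = -1) ∨
      ∃ σ : Hyp n, t.IsColPerm σ ∧ (t.act σ).tabloid = s.tabloid := by
  by_contra! hcon
  obtain ⟨hodd, hcol⟩ := hcon
  -- `β` sends a box of `t` to the box of `s` that holds the same absolute value.
  let β : lam.Box ≃ lam.Box := t.absEquiv.trans s.absEquiv.symm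
  have hβ : ∀ b, (s.entry (β b)).1 = (t.entry b).1 := fun b =>
    s.absEquiv.apply_symm_apply (t.absEquiv b)
  -- An entry in the first component of `t` and the second of `s` could have its sign changed by
  -- both groups, which would be an odd common involution. By counting, `β` then preserves both
  -- components.
  have hleft : ∀ b, b.isLeft → (β b).isLeft := by
    intro b hb
    by_contra hb'
    have hR : (β b).isRight := by simpa using hb'
    obtain ⟨τ, h1, h2, h3, h4⟩ := exists_signChange (t.entry b).1
    refine hodd τ (fun c => ⟨c, rfl, rfl, ?_⟩) (fun c => ⟨c, rfl, rfl, ?_⟩) h1 h2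
    · by_cases hc : (t.entry c).1 = (t.entry b).1
      · exact Or.inr ⟨t.abs_injective hc ▸ hb, h3 _ hc⟩
      · exact Or.inl (h4 _ hc)
    · by_cases hc : (s.entry c).1 = (t.entry b).1
      · exact Or.inr ⟨s.abs_injective (hc.trans (hβ b).symm) ▸ hR, h3 _ hc⟩
      · exact Or.inl (h4 _ hc)
  have h1 : ∀ b : lam.fst.cells, ∃ c, β (.inl b) = .inl c := fun b =>
    Sum.isLeft_iff.1 (hleft (.inl b) rfl)
  choose β₁ hβ₁ using h1
  have hβ₁' : Function.Bijective β₁ := by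
    refine Finite.injective_iff_bijective.1 fun x y h => ?_
    exact Sum.inl_injective (β.injective ((hβ₁ x).trans (by rw [h, hβ₁])))
  have h2 : ∀ b : lam.snd.cells, ∃ c, β (.inr b) = .inr c := by
    intro b
    rcases hb : β (.inr b) with c | c
    · obtain ⟨x, rfl⟩ := hβ₁'.2 c
      rw [← hβ₁] at hb
      exact absurd (β.injective hb) (by simp)
    · exact ⟨c, rfl⟩
  choose β₂ hβ₂ using h2
  have hβ₂' : Function.Bijective β₂ := by
    refine Finite.injective_iff_bijective.1 fun x y h => ?_
    exact Sum.inr_injective (β.injective ((hβ₂ x).trans (by rw [h, hβ₂])))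
  have hβl : ∀ b, (β b).isLeft = b.isLeft := by
    rintro (b | b)
    · rw [hβ₁]; rfl
    · rw [hβ₂]; rfl
  -- Two entries in one column of `t` and one row of `s` would be exchanged by an odd involution in
  -- both groups.
  have hrow : ∀ b b', b.isLeft = b'.isLeft → (BiPartition.pos b).2 = (BiPartition.pos b').2 →
      (BiPartition.pos (β b)).1 = (BiPartition.pos (β b')).1 → b = b' := by
    intro b b' hl hc hr
    by_contra hne
    have hne' : (t.entry b).1 ≠ (t.entry b').1 := fun h => hne (t.abs_injective h)
    -- The signs of the exchanged vertices must suit the group that cannot change signs: those of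
    -- `s` in the first component, those of `t` in the second.
    have hgen : ∀ v w : Vertex n, v.1 = (t.entry b).1 → w.1 = (t.entry b').1 →
        (∀ τ : Hyp n, τ.1 v = w → τ.1 w = v →
          (τ.1 (t.entry b) = t.entry b' ∨ b.isLeft ∧ τ.1 (t.entry b) = refl (t.entry b')) ∧
          (τ.1 (t.entry b') = t.entry b ∨ b'.isLeft ∧ τ.1 (t.entry b') = refl (t.entry b)) ∧
          (τ.1 (s.entry (β b)) = s.entry (β b') ∨
            (β b).isRight ∧ τ.1 (s.entry (β b)) = refl (s.entry (β b'))) ∧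
          (τ.1 (s.entry (β b')) = s.entry (β b) ∨
            (β b').isRight ∧ τ.1 (s.entry (β b')) = refl (s.entry (β b)))) → False := by
      intro v w hv hw H
      obtain ⟨τ, h1, h2, h3, h4, h5⟩ := exists_signedSwap v w (by rw [hv, hw]; exact hne')
      obtain ⟨H1, H2, H3, H4⟩ := H τ h3 h4
      refine hodd τ (fun c => ?_) (fun c => ?_) h1 h2
      · by_cases hcb : c = b
        · subst hcb; exact ⟨b', hl.symm, hc.symm, H1⟩
        by_cases hcb' : c = b'
        · subst hcb'; exact ⟨b, hl, hc, H2⟩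
        refine ⟨c, rfl, rfl, Or.inl (h5 _ ?_ ?_)⟩
        · rw [hv]; exact fun h => hcb (t.abs_injective h)
        · rw [hw]; exact fun h => hcb' (t.abs_injective h)
      · by_cases hcb : c = β b
        · subst hcb; exact ⟨β b', by rw [hβl, hβl, hl], hr.symm, H3⟩
        by_cases hcb' : c = β b'
        · subst hcb'; exact ⟨β b, by rw [hβl, hβl, hl], hr, H4⟩
        refine ⟨c, rfl, rfl, Or.inl (h5 _ ?_ ?_)⟩
        · rw [hv, ← hβ]; exact fun h => hcb (s.abs_injective h)
        · rw [hw, ← hβ]; exact fun h => hcb' (s.abs_injective h)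
    have hsg : ∀ (τ : Hyp n) (x y p q : Vertex n), p.1 = x.1 → q.1 = y.1 → τ.1 p = q →
        τ.1 x = y ∨ τ.1 x = refl y := by
      intro τ x y p q hp hq h
      rw [← fst_eq_iff, ← hq, ← h, hypAbs_eq_iff, hp]
    by_cases hbl : b.isLeft
    · have hbl' : b'.isLeft := hl ▸ hbl
      refine hgen _ _ (hβ b) (hβ b') fun τ h3 h4 => ⟨?_, ?_, Or.inl h3, Or.inl h4⟩
      · simpa only [hbl, true_and] using hsg τ _ _ _ _ (hβ b) (hβ b') h3
      · simpa only [hbl', true_and] using hsg τ _ _ _ _ (hβ b') (hβ b) h4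
    · have hbr : (β b).isRight := by
        have := hβl b
        rw [← Sum.not_isLeft]; simp [this, hbl]
      have hbr' : (β b').isRight := by
        have := hβl b'
        rw [← Sum.not_isLeft]; simp [this, ← hl, hbl]
      refine hgen _ _ rfl rfl fun τ h3 h4 => ⟨Or.inl h3, Or.inl h4, ?_, ?_⟩
      · simpa only [hbr, true_and] using hsg τ _ _ _ _ (hβ b).symm (hβ b').symm h3
      · simpa only [hbr', true_and] using hsg τ _ _ _ _ (hβ b').symm (hβ b).symm h4
  -- The weight of a box of `t` is the row of its entry in `s`; after sorting the columns every
  -- entry lies in the row that it has in `s`.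
  obtain ⟨φ₁, hφ₁⟩ := exists_columnSort lam.fst (fun b => (β₁ b).1.1)
    (fun b b' hc hr => Sum.inl_injective (hrow (.inl b) (.inl b') rfl hc
      (by rw [hβ₁, hβ₁]; exact hr)))
    (Equiv.sum_comp (Equiv.ofBijective β₁ hβ₁') fun b => b.1.1)
  obtain ⟨φ₂, hφ₂⟩ := exists_columnSort lam.snd (fun b => (β₂ b).1.1)
    (fun b b' hc hr => Sum.inr_injective (hrow (.inr b) (.inr b') rfl hc
      (by rw [hβ₂, hβ₂]; exact hr)))
    (Equiv.sum_comp (Equiv.ofBijective β₂ hβ₂') fun b => b.1.1)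
  let φ : lam.Box ≃ lam.Box := Equiv.sumCongr φ₁ φ₂
  have hφ : ∀ b, (φ b).isLeft = b.isLeft ∧ (BiPartition.pos (φ b)).2 = (BiPartition.pos b).2 ∧
      (BiPartition.pos (φ b)).1 = (BiPartition.pos (β b)).1 := by
    rintro (b | b)
    · exact ⟨rfl, (hφ₁ b).1, by rw [hβ₁]; exact (hφ₁ b).2⟩
    · exact ⟨rfl, (hφ₂ b).1, by rw [hβ₂]; exact (hφ₂ b).2⟩
  let t' : BiTableau lam :=
    ⟨fun b => t.entry (φ b), fun b b' h => φ.injective (t.abs_injective h)⟩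
  -- `w` takes its signs from `s` in the first component and from `t` in the second. Hence `t` and
  -- `w` differ by signs allowed to columns, and `w` and `s ∘ β` by signs allowed to rows.
  let w : BiTableau lam :=
    { entry := fun b => if b.isLeft then s.entry (β b) else t.entry b
      abs_injective := by
        have : (fun b => (if b.isLeft then s.entry (β b) else t.entry b : Vertex n).1) =
            fun b => (t.entry b).1 := by
          funext b
          split_ifs
          · exact hβ b
          · rfl
        rw [this]
        exact t.abs_injective }
  have hwt : ∀ b, t.entry b = w.entry b ∨ b.isLeft ∧ t.entry b = refl (w.entry b) := by
    intro b
    by_cases hb : b.isLeft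
    · have : w.entry b = s.entry (β b) := if_pos hb
      rw [this]
      simpa only [hb, true_and] using (fst_eq_iff _ _).1 (hβ b).symm
    · exact Or.inl (if_neg hb).symm
  have hws : ∀ b, w.entry b = s.entry (β b) ∨ b.isRight ∧ w.entry b = refl (s.entry (β b)) := by
    intro b
    by_cases hb : b.isLeft
    · exact Or.inl (if_pos hb)
    · have e : w.entry b = t.entry b := if_neg hb
      have hb' : b.isRight := by rw [← Sum.not_isLeft]; simpa using hb
      rw [e]
      simpa only [hb', true_and] using (fst_eq_iff _ _).1 (hβ b).symm
  obtain ⟨σ, hσ⟩ := t'.exists_act_eq w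
  have hσ' : ∀ b, σ.1 (w.entry b) = t.entry (φ b) := by
    intro b
    rw [hσ]
    change σ.1 ((σ⁻¹).1 (t.entry (φ b))) = _
    simp
  obtain ⟨ρ, hρ⟩ := (t.act σ).exists_act_eq s
  have hρ' : ∀ b, ρ.1 (s.entry b) = (t.act σ).entry b := by
    intro b
    rw [hρ]
    change ρ.1 ((ρ⁻¹).1 _) = _
    simp
  refine hcol σ (fun b => ?_) (Quotient.sound ⟨ρ, fun c => ?_, hρ⟩)
  · refine ⟨φ b, (hφ b).1, (hφ b).2.1, ?_⟩
    rcases hwt b with h | ⟨hb, h⟩ <;> rw [h]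
    · exact Or.inl (hσ' b)
    · exact Or.inr ⟨hb, by rw [hyp_apply_refl, hσ']⟩
  · obtain ⟨b, rfl⟩ := φ.surjective c
    have e : (t.act σ).entry (φ b) = w.entry b := by
      change (σ⁻¹).1 (t.entry (φ b)) = _
      rw [InvMemClass.coe_inv, Equiv.Perm.inv_eq_iff_eq, hσ']
    refine ⟨β b, by rw [hβl, (hφ b).1], (hφ b).2.2.symm, ?_⟩
    rw [e]
    rcases hws b with h | ⟨hb, h⟩ <;> rw [h]
    · exact Or.inl (hρ' _)
    · refine Or.inr ⟨?_, by rw [hyp_apply_refl, hρ']⟩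
      rw [← Sum.not_isLeft, (hφ b).1, Sum.not_isLeft, hb]

end BiTableau

/-! ### Young modules of hyperoctahedral groups -/

section PermModules

variable {n : ℕ} {lam : BiPartition n} (K : Type*) [Field K]

instance : Finite (BiTableau lam) :=
  Finite.of_injective BiTableau.entry fun _ _ h => BiTableau.ext h

instance : Finite (BiTabloid lam) := inferInstanceAs (Finite (Quotient _))

instance : Nonempty (BiTableau lam) := by
  have hc : Fintype.card lam.Box = Fintype.card (Fin n) := by
    simpa [YoungDiagram.card] using lam.card_add_card
  obtain ⟨f⟩ := Fintype.card_eq.1 hc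
  exact ⟨⟨fun b => (f b, true), f.injective⟩⟩

instance : Module.Finite K (PermModule K lam) :=
  inferInstanceAs (Module.Finite K (BiTabloid lam →₀ K))

namespace PermModule

variable {K}

theorem op_smul_def (a : HypAlg K n) (m : PermModule K lam) :
    MulOpposite.op a • m = (MonoidAlgebra.lift K _ _ (actHom K lam) a).unop m := rfl

theorem op_smul_smul (c : K) (a : HypAlg K n) (m : PermModule K lam) :
    MulOpposite.op (c • a) • m = c • MulOpposite.op a • m := by
  rw [op_smul_def, map_smul, MulOpposite.unop_smul]
  rfl

theorem op_algebraMap_smul (c : K) (m : PermModule K lam) :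
    MulOpposite.op (algebraMap K (HypAlg K n) c) • m = c • m := by
  rw [Algebra.algebraMap_eq_smul_one, op_smul_smul, MulOpposite.op_one, one_smul]

instance : IsScalarTower K (HypAlg K n)ᵐᵒᵖ (PermModule K lam) where
  smul_assoc c a m := op_smul_smul c a.unop m

instance : IsNoetherian (HypAlg K n)ᵐᵒᵖ (PermModule K lam) := isNoetherian_of_tower K inferInstance

instance : IsArtinian (HypAlg K n)ᵐᵒᵖ (PermModule K lam) := isArtinian_of_tower K inferInstance

theorem induction {P : PermModule K lam → Prop} (m : PermModule K lam) (h0 : P 0)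
    (hadd : ∀ x y, P x → P y → P (x + y))
    (hsingle : ∀ (c : K) (t : BiTableau lam), P (c • ofTabloid K t.tabloid)) : P m := by
  refine Finsupp.induction_linear (motive := P) m h0 hadd fun T c => ?_
  induction T using Quotient.inductionOn with | _ t
  have : (Finsupp.single (t.tabloid) c : BiTabloid lam →₀ K) =
      c • Finsupp.single t.tabloid (1 : K) := by
    rw [Finsupp.smul_single, smul_eq_mul, mul_one]
  exact this ▸ hsingle c t

end PermModule

open Classical in
theorem columnSum_smul_ofTabloid (t : BiTableau lam) (T : BiTabloid lam) :
    MulOpposite.op (columnSum K t) • PermModule.ofTabloid K T =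
      ∑ σ : Hyp n, if t.IsColPerm σ then
        ((hypSgn σ : ℤ) : K) • PermModule.ofTabloid K (T.act σ) else 0 := by
  have hop : MulOpposite.op (columnSum K t) = ∑ σ : Hyp n, MulOpposite.op (if t.IsColPerm σ then
      ((hypSgn σ : ℤ) : K) • MonoidAlgebra.of K (Hyp n) σ else 0) :=
    map_sum MulOpposite.opAddEquiv _ _
  rw [hop, Finset.sum_smul]
  refine Finset.sum_congr rfl fun σ _ => ?_
  split_ifs
  · rw [PermModule.op_smul_smul, PermModule.of_smul]
  · rw [MulOpposite.op_zero, zero_smul]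

variable {K} in
open Classical in
theorem of_mul_columnSum {t : BiTableau lam} {σ : Hyp n} (hσ : t.IsColPerm σ) :
    MonoidAlgebra.of K (Hyp n) σ * columnSum K t = ((hypSgn σ : ℤ) : K) • columnSum K t := by
  rw [columnSum, Finset.mul_sum, Finset.smul_sum, ← Equiv.sum_comp (Equiv.mulLeft σ)
    fun τ => ((hypSgn σ : ℤ) : K) • (if t.IsColPerm τ then
      ((hypSgn τ : ℤ) : K) • MonoidAlgebra.of K (Hyp n) τ else 0)]
  refine Finset.sum_congr rfl fun τ _ => ?_
  simp only [Equiv.coe_mulLeft, hσ.mul_iff]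
  split_ifs
  · rw [smul_smul, hypSgn_mul, mul_smul_comm, map_mul]
    congr 1
    push_cast
    rw [← mul_assoc, ← Int.cast_mul, ← Units.val_mul, Int.units_mul_self]
    simp
  · rw [mul_zero, smul_zero]

-- The column group of `t.act σ` is the conjugate of that of `t`, and `hypSgn` is invariant under
-- conjugation. This makes polytabloids translates of each other.
open Classical in
theorem columnSum_act (t : BiTableau lam) (σ : Hyp n) :
    columnSum K (t.act σ) =
      MonoidAlgebra.of K (Hyp n) σ⁻¹ * columnSum K t * MonoidAlgebra.of K (Hyp n) σ := by
  have hiff : ∀ ρ : Hyp n, (t.act σ).IsColPerm (σ⁻¹ * ρ * σ) ↔ t.IsColPerm ρ := by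
    intro ρ
    refine forall_congr' fun b => exists_congr fun b' => and_congr_right fun _ =>
      and_congr_right fun _ => ?_
    have e : (σ⁻¹ * ρ * σ).1 ((t.act σ).entry b) = (σ⁻¹).1 (ρ.1 (t.entry b)) := by
      simp [BiTableau.act]
    have e' : (t.act σ).entry b' = (σ⁻¹).1 (t.entry b') := rfl
    rw [e, e', ← hyp_apply_refl, EmbeddingLike.apply_eq_iff_eq, EmbeddingLike.apply_eq_iff_eq]
  have hs : ∀ ρ : Hyp n, hypSgn (σ⁻¹ * ρ * σ) = hypSgn ρ := by
    intro ρ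
    rw [hypSgn_mul, hypSgn_mul, mul_right_comm, ← hypSgn_mul, inv_mul_cancel, hypSgn_one, one_mul]
  rw [columnSum, columnSum, Finset.mul_sum, Finset.sum_mul,
    ← Equiv.sum_comp ((Equiv.mulLeft σ⁻¹).trans (Equiv.mulRight σ))]
  refine Finset.sum_congr rfl fun ρ _ => ?_
  simp only [Equiv.trans_apply, Equiv.coe_mulLeft, Equiv.coe_mulRight, hiff, hs]
  split_ifs
  · rw [mul_smul_comm, smul_mul_assoc, map_mul, map_mul]
  · rw [mul_zero, zero_mul]

theorem polytabloid_act (t : BiTableau lam) (σ : Hyp n) :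
    polytabloid K (t.act σ) = MulOpposite.op (MonoidAlgebra.of K (Hyp n) σ) • polytabloid K t := by
  have h : PermModule.ofTabloid K (t.act σ).tabloid =
      MulOpposite.op (MonoidAlgebra.of K (Hyp n) σ) • PermModule.ofTabloid K t.tabloid :=
    (PermModule.of_smul K σ t.tabloid).symm
  rw [polytabloid, polytabloid, columnSum_act, h, smul_smul, smul_smul, ← MulOpposite.op_mul,
    ← MulOpposite.op_mul]
  congr 2
  rw [← mul_assoc, ← mul_assoc, ← map_mul, mul_inv_cancel, map_one, one_mul]

theorem tabloid_act (t : BiTableau lam) (σ : Hyp n) : t.tabloid.act σ = (t.act σ).tabloid := rfl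

/-- The alternating column sum maps the permutation module to the line of the polytabloid. -/
theorem exists_columnSum_smul_eq (t : BiTableau lam) (m : PermModule K lam) :
    ∃ c : K, MulOpposite.op (columnSum K t) • m = c • polytabloid K t := by
  classical
  induction m using PermModule.induction with
  | h0 => exact ⟨0, by rw [smul_zero, zero_smul]⟩
  | hadd x y hx hy =>
    obtain ⟨c, hc⟩ := hx
    obtain ⟨d, hd⟩ := hy
    exact ⟨c + d, by rw [smul_add, hc, hd, add_smul]⟩
  | hsingle a s =>
    suffices h : ∃ c : K, MulOpposite.op (columnSum K t) • PermModule.ofTabloid K s.tabloid =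
        c • polytabloid K t by
      obtain ⟨c, hc⟩ := h
      refine ⟨a * c, ?_⟩
      rw [← PermModule.op_algebraMap_smul, smul_smul, ← MulOpposite.op_mul,
        Algebra.commutes, MulOpposite.op_mul, ← smul_smul, hc, PermModule.op_algebraMap_smul,
        smul_smul]
    rcases s.exists_odd_or_exists_isColPerm t with ⟨τ, h1, h2, h3, h4⟩ | ⟨σ, h1, h2⟩
    · refine ⟨0, ?_⟩
      rw [zero_smul, columnSum_smul_ofTabloid]
      have hfix : s.tabloid.act τ = s.tabloid :=
        (Quotient.sound (s := BiTableau.rowSetoid lam) (a := s) (b := s.act τ) ⟨τ, h2, rfl⟩).symm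
      -- The sign is compared in `ℤˣ`, not in `K`, so the cancelling pairs `σ`, `τ * σ` are distinct
      -- also in characteristic two.
      have hone : τ ≠ 1 := by
        rintro rfl
        rw [hypSgn_one] at h4
        exact absurd h4 (by decide)
      refine Finset.sum_involution (fun σ _ => τ * σ) ?_ ?_ (fun _ _ => Finset.mem_univ _) ?_
      · intro σ _
        simp only [h1.mul_iff, hypSgn_mul, h4, BiTabloid.act_mul, hfix]
        split_ifs
        · rw [← add_smul]; simp
        · rw [add_zero]
      · intro σ _ _ h
        exact hone (mul_eq_right.1 h)
      · intro σ _
        rw [← mul_assoc, h3, one_mul]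
    -- Here `{s} = {t}σ` with `σ` in the column group, which the column sum absorbs up to its sign.
    · refine ⟨((hypSgn σ : ℤ) : K), ?_⟩
      rw [← h2, ← tabloid_act, ← PermModule.of_smul, smul_smul, ← MulOpposite.op_mul,
        of_mul_columnSum h1, PermModule.op_smul_smul, polytabloid]

/-- The coefficient at `{t}` is `1`: a column permutation fixing `{t}` is also a row permutation,
hence trivial. -/
theorem polytabloid_ne_zero (t : BiTableau lam) : polytabloid K t ≠ 0 := by
  classical
  intro h
  let ev : PermModule K lam →+ K := Finsupp.applyAddHom t.tabloid
  have hev : ev (polytabloid K t) = 1 := by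
    rw [polytabloid, columnSum_smul_ofTabloid, map_sum, Finset.sum_eq_single 1]
    · rw [if_pos (BiTableau.IsColPerm.one t), hypSgn_one, BiTabloid.act_one, Units.val_one,
        Int.cast_one, one_smul]
      exact Finsupp.single_eq_same
    · intro σ _ hσ
      split_ifs with hc
      · have hne : t.tabloid.act σ ≠ t.tabloid := by
          intro he
          obtain ⟨ρ, hρ, hρ'⟩ := Quotient.exact (s := BiTableau.rowSetoid lam) he.symm
          obtain rfl := t.eq_of_act_eq hρ'
          exact hσ (BiTableau.eq_one_of_isRowPerm_of_isColPerm hρ hc)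
        change (((hypSgn σ : ℤ) : K) • Finsupp.single (t.tabloid.act σ) (1 : K)) t.tabloid = 0
        rw [Finsupp.smul_apply, Finsupp.single_eq_of_ne hne.symm, smul_zero]
      · exact map_zero ev
    · simp
  rw [h, map_zero] at hev
  exact zero_ne_one hev

/-- A nonzero value of the column sum on `Y` is a nonzero multiple of the polytabloid of `t`, and
all polytabloids are translates of this one. -/
theorem specht_le_of_exists {Y : Submodule (HypAlg K n)ᵐᵒᵖ (PermModule K lam)} (t : BiTableau lam)
    (h : ∃ y ∈ Y, MulOpposite.op (columnSum K t) • y ≠ 0) : specht K lam ≤ Y := by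
  obtain ⟨y, hy, hne⟩ := h
  obtain ⟨c, hc⟩ := exists_columnSum_smul_eq K t y
  have hc0 : c ≠ 0 := by
    rintro rfl
    exact hne (by rw [hc, zero_smul])
  have ht : polytabloid K t ∈ Y := by
    have := Y.smul_mem (MulOpposite.op (algebraMap K (HypAlg K n) c⁻¹))
      (Y.smul_mem (MulOpposite.op (columnSum K t)) hy)
    rwa [hc, PermModule.op_algebraMap_smul, smul_smul, inv_mul_cancel₀ hc0, one_smul] at this
  refine Submodule.span_le.2 ?_
  rintro _ ⟨s, rfl⟩
  obtain ⟨σ, rfl⟩ := t.exists_act_eq s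
  change polytabloid K (t.act σ) ∈ Y
  rw [polytabloid_act]
  exact Y.smul_mem _ ht

theorem exists_isYoungModule (lam : BiPartition n) : ∃ Y, IsYoungModule K lam Y := by
  obtain ⟨t⟩ := (inferInstance : Nonempty (BiTableau lam))
  obtain ⟨Y, h1, h2, h3⟩ := exists_indecomposable_summand (R := (HypAlg K n)ᵐᵒᵖ)
    (X := PermModule K lam) (fun Y => ∃ y ∈ Y, MulOpposite.op (columnSum K t) • y ≠ 0)
    ⟨_, trivial, polytabloid_ne_zero K t⟩ (by simp) (by
      rintro p q ⟨x, hx, hx'⟩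
      obtain ⟨y, hy, z, hz, rfl⟩ := Submodule.mem_sup.1 hx
      by_contra! hcon
      exact hx' (by rw [smul_add, hcon.1 y hy, hcon.2 z hz, add_zero]))
  exact ⟨Y, h1, h2, specht_le_of_exists K t h3⟩

-- The projection to `Y` fixes the polytabloid, which lies in `S(λ) ⊆ Y`; so the projection of `{t}`
-- is a suitable element.
variable {K} in
theorem IsYoungModule.exists_columnSum_smul_ne {Y : Submodule (HypAlg K n)ᵐᵒᵖ (PermModule K lam)}
    (hY : IsYoungModule K lam Y) (t : BiTableau lam) :
    ∃ y : Y, MulOpposite.op (columnSum K t) • y ≠ 0 := by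
  obtain ⟨⟨C, hC⟩, -, hS⟩ := hY
  refine ⟨Y.projectionOnto C hC (PermModule.ofTabloid K t.tabloid), fun h => ?_⟩
  rw [← map_smul] at h
  change Y.projectionOnto C hC (polytabloid K t) = 0 at h
  rw [Submodule.projectionOnto_apply_of_mem_left hC (hS (Submodule.subset_span ⟨t, rfl⟩))] at h
  exact polytabloid_ne_zero K t (congrArg Subtype.val h)

end PermModules

/-! ### Horizontal edges of diagrams -/

namespace Diagram

variable {r : ℕ}

theorem rel_unique (d : Diagram r) {u v w : Vertex r ⊕ Vertex r} (hv : d.rel u v) (hw : d.rel u w)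
    (hv' : v ≠ u) (hw' : w ≠ u) : v = w :=
  (d.matching u).unique ⟨hv', hv⟩ ⟨hw', hw⟩

theorem ext_of_common {d d' : Diagram r} (h : ∀ u, ∃ v, v ≠ u ∧ d.rel u v ∧ d'.rel u v) :
    d = d' := by
  refine Diagram.ext (Setoid.ext fun u v => ?_)
  obtain ⟨w, hw, h1, h2⟩ := h u
  by_cases huv : v = u
  · subst huv; exact iff_of_true (d.rel.refl' _) (d'.rel.refl' _)
  · constructor
    · intro h; rw [d.rel_unique h h1 huv hw]; exact h2
    · intro h; rw [d'.rel_unique h h2 huv hw]; exact h1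

theorem comp_rel_inl {a : Diagram r} (b : Diagram r) {x y : Vertex r}
    (h : a.rel (.inl x) (.inl y)) : (a.comp b).rel (.inl x) (.inl y) :=
  Relation.EqvGen.rel _ _ (Or.inl ⟨_, _, h, rfl, rfl⟩)

theorem comp_rel_inr (a : Diagram r) {b : Diagram r} {x y : Vertex r}
    (h : b.rel (.inr x) (.inr y)) : (a.comp b).rel (.inr x) (.inr y) :=
  Relation.EqvGen.rel _ _ (Or.inr ⟨_, _, h, rfl, rfl⟩)

theorem comp_rel_through {a b : Diagram r} {x y z : Vertex r}
    (h : a.rel (.inl x) (.inr y)) (h' : b.rel (.inl y) (.inr z)) :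
    (a.comp b).rel (.inl x) (.inr z) :=
  Relation.EqvGen.trans _ _ _ (Relation.EqvGen.rel _ _ (Or.inl ⟨_, _, h, rfl, rfl⟩))
    (Relation.EqvGen.rel _ _ (Or.inr ⟨_, _, h', rfl, rfl⟩))

theorem horizontal_le_comp_left (a b : Diagram r) : a.horizontal ≤ (a.comp b).horizontal := by
  refine Nat.div_le_div_right (Set.ncard_le_ncard ?_ (Set.toFinite _))
  rintro x ⟨y, hy, h⟩
  exact ⟨y, hy, comp_rel_inl b h⟩

theorem compl_topHorizontal (d : Diagram r) :
    {x : Vertex r | ∃ y, y ≠ x ∧ d.rel (.inl x) (.inl y)}ᶜ = {x | ∃ z, d.rel (.inl x) (.inr z)} := by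
  ext x
  constructor
  · intro hx
    obtain ⟨v, ⟨hv, h⟩, -⟩ := d.matching (.inl x)
    rcases v with y | z
    · exact absurd ⟨y, fun h' => hv (by rw [h']), h⟩ hx
    · exact ⟨z, h⟩
  · rintro ⟨z, hz⟩ ⟨y, hy, h⟩
    have := d.rel_unique hz h (by simp) (fun h' => hy (Sum.inl_injective h'))
    simp at this

/-- Count the vertical edges instead. The bottom horizontal edges of `b` survive, so a vertical edge
of the composite ends at the foot of a vertical edge of `b`, and different edges end at different
feet. -/
theorem horizontal_le_comp_right (a b : Diagram r) : b.horizontal ≤ (a.comp b).horizontal := by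
  refine Nat.div_le_div_right ?_
  have hc : ∀ d : Diagram r, {x : Vertex r | ∃ y, y ≠ x ∧ d.rel (.inl x) (.inl y)}.ncard +
      {x : Vertex r | ∃ z, d.rel (.inl x) (.inr z)}.ncard = Nat.card (Vertex r) := fun d => by
    rw [← compl_topHorizontal]; exact Set.ncard_add_ncard_compl _
  have hkey : ∀ x, x ∈ {x : Vertex r | ∃ z, (a.comp b).rel (.inl x) (.inr z)} →
      ∃ w z, (a.comp b).rel (.inl x) (.inr z) ∧ b.rel (.inl w) (.inr z) := by
    rintro x ⟨z, hz⟩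
    obtain ⟨v, ⟨hv, h⟩, -⟩ := b.matching (.inr z)
    rcases v with w | z'
    · exact ⟨w, z, hz, b.rel.symm' h⟩
    · have := (a.comp b).rel_unique ((a.comp b).rel.symm' hz) (comp_rel_inr a h) (by simp) hv
      simp at this
  choose! f g hf hg using hkey
  have hle : {x : Vertex r | ∃ z, (a.comp b).rel (.inl x) (.inr z)}.ncard ≤
      {x : Vertex r | ∃ z, b.rel (.inl x) (.inr z)}.ncard := by
    refine Set.ncard_le_ncard_of_injOn f (fun x hx => ⟨g x, hg x hx⟩) ?_ (Set.toFinite _)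
    intro x hx y hy hxy
    have h1 := hg x hx
    rw [hxy] at h1
    have h2 := b.rel_unique h1 (hg y hy) (by simp) (by simp)
    have h3 := (a.comp b).rel.symm' (hf x hx)
    rw [h2] at h3
    exact Sum.inl_injective ((a.comp b).rel_unique h3 ((a.comp b).rel.symm' (hf y hy))
      (by simp) (by simp))
  have h1 := hc b
  have h2 := hc (a.comp b)
  omega

/-! ### The diagrams `capCup` -/

variable {l : ℕ}

theorem capCup_rel_iff (u v : Vertex r ⊕ Vertex r) :
    (capCup r l).rel u v ↔ capLabel l u = capLabel l v := Iff.rfl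

theorem capCup_rel_inl {x : Vertex r} (hx : x.1.1 < l) :
    (capCup r l).rel (.inl x) (.inl (refl x)) := by
  rw [capCup_rel_iff]; simp [capLabel, hx, refl]

theorem capCup_rel_inr {x : Vertex r} (hx : x.1.1 < l) :
    (capCup r l).rel (.inr x) (.inr (refl x)) := by
  rw [capCup_rel_iff]; simp [capLabel, hx, refl]

theorem capCup_rel_through {x : Vertex r} (hx : ¬ x.1.1 < l) :
    (capCup r l).rel (.inl x) (.inr x) := by
  rw [capCup_rel_iff]; simp [capLabel, hx]

theorem refl_ne (x : Vertex r) : refl x ≠ x := fun h => by simpa [refl] using congrArg Prod.snd h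

theorem ncard_inner (hl : l ≤ r) : {x : Vertex r | x.1.1 < l}.ncard = 2 * l := by
  have : {x : Vertex r | x.1.1 < l} =
      (((Finset.univ.filter fun i : Fin r => i.1 < l) ×ˢ (Finset.univ : Finset Bool) :
        Finset (Vertex r)) : Set (Vertex r)) := by
    ext x; simp
  rw [this, Set.ncard_coe_finset, Finset.card_product, Fin.card_filter_val_lt]
  simp [hl, mul_comm]

theorem horizontal_capCup_le (hl : l ≤ r) : (capCup r l).horizontal ≤ l := by
  have hsub : {x : Vertex r | ∃ y, y ≠ x ∧ (capCup r l).rel (.inl x) (.inl y)} ⊆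
      {x : Vertex r | x.1.1 < l} := by
    rintro x ⟨y, hy, h⟩
    by_contra hx
    have hx : ¬ x.1.1 < l := hx
    have := (capCup r l).rel_unique h (capCup_rel_through hx)
      (fun h' => hy (Sum.inl_injective h')) (by simp)
    simp at this
  have := Set.ncard_le_ncard hsub (Set.toFinite _)
  rw [ncard_inner hl] at this
  unfold horizontal
  omega

/-- Multiplication by the inverse permutation cannot lose horizontal edges either. -/
theorem horizontal_ofPerm_comp_le (σ : Hyp r) (d : Diagram r) :
    ((ofPerm σ).comp d).horizontal ≤ d.horizontal := by
  have := horizontal_le_comp_right (ofPerm σ⁻¹) ((ofPerm σ).comp d)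
  rwa [← comp_assoc, ← ofPerm_mul, inv_mul_cancel, one_comp] at this

theorem capCup_comp_capCup : (capCup r l).comp (capCup r l) = capCup r l := by
  refine ext_of_common fun u => ?_
  rcases u with x | x <;> by_cases hx : x.1.1 < l
  · exact ⟨.inl (refl x), by simpa using refl_ne x, comp_rel_inl _ (capCup_rel_inl hx),
      capCup_rel_inl hx⟩
  · exact ⟨.inr x, by simp, comp_rel_through (capCup_rel_through hx) (capCup_rel_through hx),
      capCup_rel_through hx⟩
  · exact ⟨.inr (refl x), by simpa using refl_ne x, comp_rel_inr _ (capCup_rel_inr hx),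
      capCup_rel_inr hx⟩
  · exact ⟨.inl x, by simp, Setoid.symm' _
      (comp_rel_through (capCup_rel_through hx) (capCup_rel_through hx)),
      Setoid.symm' _ (capCup_rel_through hx)⟩

theorem loops_capCup (hl : l ≤ r) : loops (capCup r l).rel (capCup r l).rel = l := by
  -- An invariant of components: the middle pair `{-i, i}` with `i ≤ l` has label `i`, every other
  -- vertex has `none`. It shows that these `l` loops are distinct and avoid the outer rows.
  let lab : Vertex r ⊕ (Vertex r ⊕ Vertex r) → Option (Fin r) :=
    Sum.elim (fun _ => none) (Sum.elim (fun x => if x.1.1 < l then some x.1 else none)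
      fun _ => none)
  have hlab : ∀ u v, stack (capCup r l).rel (capCup r l).rel u v → lab u = lab v := by
    intro u v h
    induction h with
    | rel x y h =>
      rcases h with ⟨p, q, h, rfl, rfl⟩ | ⟨p, q, h, rfl, rfl⟩ <;>
      rw [capCup_rel_iff] at h <;> rcases p with p | p <;> rcases q with q | q <;>
      by_cases hp : p.1.1 < l <;> by_cases hq : q.1.1 < l <;> simp_all [lab, capLabel]
    | refl x => rfl
    | symm x y _ ih => exact ih.symm
    | trans x y z _ _ h1 h2 => exact h1.trans h2
  have hsome : ∀ i : Fin l, lab (.inr (.inl (Fin.castLE hl i, true))) = some (Fin.castLE hl i) :=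
    fun i => if_pos i.2
  let f : Fin l → Avoid (stack (capCup r l).rel (capCup r l).rel) (Set.range outer) := fun i =>
    ⟨Quotient.mk _ (.inr (.inl (Fin.castLE hl i, true))), by
      rintro _ ⟨p, rfl⟩ h
      have := hlab _ _ (Quotient.exact h)
      rw [hsome] at this
      rcases p with p | p <;> cases this⟩
  have hf : Function.Bijective f := by
    constructor
    · intro i j h
      have := hlab _ _ (Quotient.exact (Subtype.ext_iff.1 h))
      rw [hsome, hsome] at this
      exact Fin.castLE_injective hl (Option.some_injective _ this)
    · rintro ⟨c, hc⟩
      induction c using Quotient.inductionOn with | _ u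
      rcases u with x | x | x
      · exact absurd rfl (hc _ ⟨.inl x, rfl⟩)
      · by_cases hx : x.1.1 < l
        · refine ⟨⟨x.1.1, hx⟩, Subtype.ext (Quotient.sound ?_)⟩
          refine Relation.EqvGen.rel _ _ (Or.inl ⟨.inr (x.1, true), .inr x, ?_, rfl, rfl⟩)
          rw [capCup_rel_iff]
          simp [capLabel, hx]
        · refine absurd (Quotient.sound ?_) (hc _ ⟨.inl x, rfl⟩)
          exact Relation.EqvGen.rel _ _
            (Or.inl ⟨.inl x, .inr x, capCup_rel_through hx, rfl, rfl⟩)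
      · exact absurd rfl (hc _ ⟨.inr x, rfl⟩)
  exact (Nat.card_congr (Equiv.ofBijective f hf)).symm.trans (Nat.card_fin l)

theorem hypEmbedding_apply_outer (σ : Hyp (r - l)) (w : Vertex (r - l)) :
    (hypEmbedding r l σ).1 (outerVertex r l w) = outerVertex r l (σ.1 w) :=
  Equiv.Perm.viaEmbedding_apply _ _ _

theorem hypEmbedding_apply_inner (σ : Hyp (r - l)) {v : Vertex r} (hv : v.1.1 < l) :
    (hypEmbedding r l σ).1 v = v :=
  Equiv.Perm.viaEmbedding_apply_of_notMem _ _ _ (by rw [mem_range_outerVertex]; omega)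

theorem not_outerVertex_lt (w : Vertex (r - l)) : ¬ (outerVertex r l w).1.1 < l := by
  have := (mem_range_outerVertex r l (outerVertex r l w)).1 ⟨_, rfl⟩
  omega

theorem exists_outerVertex {v : Vertex r} (hv : ¬ v.1.1 < l) : ∃ w, outerVertex r l w = v :=
  (mem_range_outerVertex r l v).2 (by omega)

theorem ofPerm_comp_rel_inl {σ : Hyp r} {d : Diagram r} {x y : Vertex r}
    (h : d.rel (.inl x) (.inl y)) : ((ofPerm σ).comp d).rel (.inl (σ.1 x)) (.inl (σ.1 y)) := by
  change compRel (permRel σ.1) d.rel _ _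
  rw [compRel_permRel_left, Setoid.comap_rel]
  simpa using h

theorem ofPerm_comp_rel_through {σ : Hyp r} {d : Diagram r} {x y : Vertex r}
    (h : d.rel (.inl x) (.inr y)) : ((ofPerm σ).comp d).rel (.inl (σ.1 x)) (.inr y) := by
  change compRel (permRel σ.1) d.rel _ _
  rw [compRel_permRel_left, Setoid.comap_rel]
  simpa using h

/-! ### The diagrams with exactly the horizontal edges of `capCup` -/

/-- The diagram `capCup l` with its outer vertical edges permuted by `σ`. -/
noncomputable def permCap (σ : Hyp (r - l)) : Diagram r :=
  (ofPerm (hypEmbedding r l σ)).comp (capCup r l)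

theorem permCap_rel_through (σ : Hyp (r - l)) (w : Vertex (r - l)) :
    (permCap σ).rel (.inl (outerVertex r l (σ.1 w))) (.inr (outerVertex r l w)) := by
  rw [← hypEmbedding_apply_outer]
  exact ofPerm_comp_rel_through (capCup_rel_through (not_outerVertex_lt w))

theorem permCap_injective : Function.Injective (permCap (r := r) (l := l)) := by
  intro σ τ h
  refine Subtype.ext (Equiv.ext fun w => ?_)
  have h1 := permCap_rel_through σ w
  have h2 := permCap_rel_through τ w
  rw [h] at h1
  exact (outerVertex r l).injective (Sum.inl_injective ((permCap τ).rel_unique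
    ((permCap τ).rel.symm' h1) ((permCap τ).rel.symm' h2) (by simp) (by simp)))

theorem ofPerm_comp_permCap (σ τ : Hyp (r - l)) :
    (ofPerm (hypEmbedding r l σ)).comp (permCap τ) = permCap (σ * τ) := by
  rw [permCap, permCap, ← comp_assoc, ← ofPerm_mul, map_mul]

theorem horizontal_permCap_le (hl : l ≤ r) (σ : Hyp (r - l)) : (permCap σ).horizontal ≤ l :=
  (horizontal_ofPerm_comp_le _ _).trans (horizontal_capCup_le hl)

/-- A diagram with all the horizontal edges of `capCup l` has another horizontal edge or is
`capCup l` up to a permutation of the outer vertices. -/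
theorem lt_horizontal_or_eq_permCap (hl : l ≤ r) (d : Diagram r)
    (htop : ∀ x : Vertex r, x.1.1 < l → d.rel (.inl x) (.inl (refl x)))
    (hbot : ∀ x : Vertex r, x.1.1 < l → d.rel (.inr x) (.inr (refl x))) :
    l + 1 ≤ d.horizontal ∨ ∃ σ : Hyp (r - l), d = permCap σ := by
  by_cases h : ∃ x : Vertex r, ¬ x.1.1 < l ∧ ∃ y, y ≠ x ∧ d.rel (.inl x) (.inl y)
  · left
    obtain ⟨x, hx, y, hyx, hxy⟩ := h
    have hy : ¬ y.1.1 < l := by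
      intro hy
      have := d.rel_unique (d.rel.symm' hxy) (htop y hy) (fun h => hyx (Sum.inl_injective h).symm)
        (fun h => refl_ne y (Sum.inl_injective h))
      rw [Sum.inl_injective this] at hx
      exact hx hy
    -- The `2l` inner vertices together with `x` and `y` lie on horizontal edges, which makes at
    -- least `l + 1` edges.
    have hsub : insert x (insert y {x : Vertex r | x.1.1 < l}) ⊆
        {x : Vertex r | ∃ y, y ≠ x ∧ d.rel (.inl x) (.inl y)} := by
      rintro z (rfl | rfl | hz)
      · exact ⟨y, hyx, hxy⟩
      · exact ⟨x, hyx.symm, d.rel.symm' hxy⟩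
      · exact ⟨refl z, refl_ne z, htop z hz⟩
    have := Set.ncard_le_ncard hsub (Set.toFinite _)
    rw [Set.ncard_insert_of_notMem (by simp [hyx.symm, hx]) (Set.toFinite _),
      Set.ncard_insert_of_notMem (by simpa using hy) (Set.toFinite _), ncard_inner hl] at this
    unfold horizontal
    omega
  · right
    push Not at h
    have hg : ∀ w : Vertex (r - l), ∃ w', d.rel (.inl (outerVertex r l w))
        (.inr (outerVertex r l w')) := by
      intro w
      obtain ⟨v, ⟨hv, hd⟩, -⟩ := d.matching (.inl (outerVertex r l w))
      rcases v with y | z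
      · exact absurd hd (h _ (not_lt.1 (not_outerVertex_lt w)) y fun h' => hv (by rw [h']))
      · have hz : ¬ z.1.1 < l := by
          intro hz
          have := d.rel_unique (d.rel.symm' hd) (hbot z hz) (by simp)
            (fun h => refl_ne z (Sum.inr_injective h))
          simp at this
        obtain ⟨w', rfl⟩ := exists_outerVertex hz
        exact ⟨w', hd⟩
    choose g hg using hg
    have hginj : Function.Injective g := by
      intro w w' h
      have h1 := d.rel.symm' (hg w)
      rw [h] at h1
      exact (outerVertex r l).injective (Sum.inl_injective
        (d.rel_unique h1 (d.rel.symm' (hg w')) (by simp) (by simp)))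
    have hgbij := Finite.injective_iff_bijective.1 hginj
    have hgrefl : ∀ w, g (refl w) = refl (g w) := by
      intro w
      have h1 := d.symm _ _ (hg w)
      rw [Sum.map_inl, Sum.map_inr, ← outerVertex_refl, ← outerVertex_refl] at h1
      exact (outerVertex r l).injective (Sum.inr_injective
        (d.rel_unique (hg (refl w)) h1 (by simp) (by simp)))
    -- `g` runs from top to bottom, whereas `permCap σ` joins the bottom vertex `v` to the top
    -- vertex `σ v`; hence the inverse below.
    let γ : Hyp (r - l) := ⟨Equiv.ofBijective g hgbij, hgrefl⟩
    have hγ : ∀ w, (permCap γ⁻¹).rel (.inl (outerVertex r l w)) (.inr (outerVertex r l (g w))) := by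
      intro w
      have := permCap_rel_through γ⁻¹ (g w)
      have e : (γ⁻¹).1 (g w) = w := by
        rw [InvMemClass.coe_inv, Equiv.Perm.inv_eq_iff_eq]; rfl
      rwa [e] at this
    refine ⟨γ⁻¹, ext_of_common fun u => ?_⟩
    rcases u with x | x <;> by_cases hx : x.1.1 < l
    · refine ⟨.inl (refl x), by simpa using refl_ne x, htop x hx, ?_⟩
      have := ofPerm_comp_rel_inl (σ := hypEmbedding r l γ⁻¹) (capCup_rel_inl hx)
      rwa [hypEmbedding_apply_inner _ hx, hypEmbedding_apply_inner _ (v := refl x) hx] at this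
    · obtain ⟨w, rfl⟩ := exists_outerVertex hx
      exact ⟨_, by simp, hg w, hγ w⟩
    · exact ⟨.inr (refl x), by simpa using refl_ne x, hbot x hx,
        comp_rel_inr _ (capCup_rel_inr hx)⟩
    · obtain ⟨w, rfl⟩ := exists_outerVertex hx
      obtain ⟨w, rfl⟩ := hgbij.2 w
      exact ⟨_, by simp, d.rel.symm' (hg w), Setoid.symm' _ (hγ w)⟩

end Diagram

/-! ### The corner algebra modulo the next layer -/

section CornerAlgebra

variable {r : ℕ} {K : Type*} [Field K] {δ : K} {l : ℕ}

instance : Finite (Diagram r) := by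
  have : Finite (Setoid (Vertex r ⊕ Vertex r)) :=
    Finite.of_injective (fun s : Setoid (Vertex r ⊕ Vertex r) => s.r)
      fun _ _ h => Setoid.ext fun a b => iff_of_eq (congrFun₂ h a b)
  exact Finite.of_injective Diagram.rel fun _ _ h => Diagram.ext h

instance : Module.Finite K (BrauerC r K δ) := Module.Finite.of_basis (BrauerC.basis δ)

theorem BrauerC.induction {P : BrauerC r K δ → Prop} (x : BrauerC r K δ) (h0 : P 0)
    (hadd : ∀ x y, P x → P y → P (x + y))
    (hdiag : ∀ (c : K) (d : Diagram r), P (c • BrauerC.diag δ d)) : P x := by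
  have hx : x ∈ Submodule.span K (Set.range (BrauerC.basis (r := r) δ)) := by
    rw [(BrauerC.basis δ).span_eq]; trivial
  have : ∀ c : K, P (c • x) := by
    induction hx using Submodule.span_induction with
    | mem x hx => obtain ⟨d, rfl⟩ := hx; exact fun c => hdiag c d
    | zero => intro c; rw [smul_zero]; exact h0
    | add x y _ _ hx hy => intro c; rw [smul_add]; exact hadd _ _ (hx c) (hy c)
    | smul a x _ hx => intro c; rw [smul_smul]; exact hx _
  simpa using this 1

theorem ofPerm_mul_diag (σ : Hyp r) (d : Diagram r) :
    BrauerC.ofGroup δ σ * BrauerC.diag δ d = BrauerC.diag δ ((Diagram.ofPerm σ).comp d) := by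
  change BrauerC.diag δ (.ofPerm σ) * _ = _
  rw [BrauerC.diag_mul_diag]
  erw [loops_permRel_left, pow_zero, one_smul]

theorem hat_of (σ : Hyp (r - l)) :
    hat r K δ l (MonoidAlgebra.of K _ σ) = BrauerC.ofGroup δ (hypEmbedding r l σ) := by
  simp [hat]

theorem diag_permCap (σ : Hyp (r - l)) : BrauerC.diag δ (Diagram.permCap σ) =
    hat r K δ l (MonoidAlgebra.of K _ σ) * BrauerC.diag δ (.capCup r l) := by
  rw [hat_of, ofPerm_mul_diag]; rfl

theorem diag_capCup (hδ : δ ≠ 0) :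
    BrauerC.diag δ (.capCup r l) = δ ^ l • BrauerC.e δ r l := by
  rw [BrauerC.e, smul_smul, mul_inv_cancel₀ (pow_ne_zero l hδ), one_smul]

/-- Squaring `capCup` closes `l` loops, and the factor `δ ^ l` cancels one of the two
normalisations. -/
theorem e_mul_e (hδ : δ ≠ 0) (hl : l ≤ r) :
    BrauerC.e δ r l * BrauerC.e δ r l = BrauerC.e δ r l := by
  rw [BrauerC.e, smul_mul_smul_comm, BrauerC.diag_mul_diag, Diagram.loops_capCup hl,
    Diagram.capCup_comp_capCup, smul_smul, mul_assoc, inv_mul_cancel₀ (pow_ne_zero l hδ), mul_one]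

/-! ### The layer ideals as spans of diagrams -/

/-- The subspace spanned by the diagrams with at least `m` horizontal edges. -/
noncomputable def layerSpan (r : ℕ) {K : Type*} [Field K] (δ : K) (m : ℕ) : Submodule K (BrauerC r K δ) :=
  Submodule.span K {y | ∃ d : Diagram r, m ≤ d.horizontal ∧ y = BrauerC.diag δ d}

theorem mul_mem_layerSpan {m : ℕ} (x : BrauerC r K δ) {y : BrauerC r K δ}
    (hy : y ∈ layerSpan r δ m) : x * y ∈ layerSpan r δ m := by
  induction x using BrauerC.induction with
  | h0 => rw [zero_mul]; exact zero_mem _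
  | hadd x z hx hz => rw [add_mul]; exact add_mem hx hz
  | hdiag c a =>
    induction hy using Submodule.span_induction with
    | mem y hy =>
      obtain ⟨d, hd, rfl⟩ := hy
      rw [smul_mul_assoc, BrauerC.diag_mul_diag]
      exact Submodule.smul_mem _ _ (Submodule.smul_mem _ _ (Submodule.subset_span
        ⟨_, hd.trans (Diagram.horizontal_le_comp_right a d), rfl⟩))
    | zero => rw [mul_zero]; exact zero_mem _
    | add y z _ _ hy hz => rw [mul_add]; exact add_mem hy hz
    | smul k y _ hy => rw [mul_smul_comm]; exact Submodule.smul_mem _ _ hy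

theorem mem_layerSpan_mul {m : ℕ} (x : BrauerC r K δ) {y : BrauerC r K δ}
    (hy : y ∈ layerSpan r δ m) : y * x ∈ layerSpan r δ m := by
  induction x using BrauerC.induction with
  | h0 => rw [mul_zero]; exact zero_mem _
  | hadd x z hx hz => rw [mul_add]; exact add_mem hx hz
  | hdiag c a =>
    induction hy using Submodule.span_induction with
    | mem y hy =>
      obtain ⟨d, hd, rfl⟩ := hy
      rw [mul_smul_comm, BrauerC.diag_mul_diag]
      exact Submodule.smul_mem _ _ (Submodule.smul_mem _ _ (Submodule.subset_span
        ⟨_, hd.trans (Diagram.horizontal_le_comp_left d a), rfl⟩))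
    | zero => rw [zero_mul]; exact zero_mem _
    | add y z _ _ hy hz => rw [add_mul]; exact add_mem hy hz
    | smul k y _ hy => rw [smul_mul_assoc]; exact Submodule.smul_mem _ _ hy

/-- Concatenation never loses horizontal edges, so the linear span of the generators is already a
two-sided ideal. Linear maps can therefore be tested on diagrams. -/
theorem mem_layerSpan_of_mem_layerIdeal {m : ℕ} {x : BrauerC r K δ}
    (hx : x ∈ layerIdeal r K δ m) : x ∈ layerSpan r δ m := by
  have := TwoSidedIdeal.mem_span_iff.1 hx (TwoSidedIdeal.mk' (layerSpan r δ m : Set _)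
    (zero_mem _) (fun hx hy => add_mem hx hy) (fun hx => neg_mem hx)
    (fun hy => mul_mem_layerSpan _ hy) (fun hy => mem_layerSpan_mul _ hy)) (by
      intro y hy
      exact (TwoSidedIdeal.mem_mk' _ _ _ _ _ _ y).2 (Submodule.subset_span hy))
  exact (TwoSidedIdeal.mem_mk' _ _ _ _ _ _ x).1 this

theorem smul_mem_layerIdeal {m : ℕ} (c : K) {x : BrauerC r K δ} (hx : x ∈ layerIdeal r K δ m) :
    c • x ∈ layerIdeal r K δ m := by
  rw [← one_mul x, ← smul_mul_assoc]
  exact (layerIdeal r K δ m).mul_mem_left _ _ hx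

/-- A diagram enclosed between two copies of `capCup l` has the horizontal edges of `capCup l` in
both rows. Either it has more and lies in `J_{l+1}`, or it is a permutation of the outer vertices
times `capCup l`. -/
theorem exists_e_mul_e_sub_mem (hδ : δ ≠ 0) (hl : l ≤ r) (b : BrauerC r K δ) :
    ∃ a : HypAlg K (r - l), BrauerC.e δ r l * b * BrauerC.e δ r l -
      BrauerC.e δ r l * hat r K δ l a ∈ layerIdeal r K δ (l + 1) := by
  induction b using BrauerC.induction with
  | h0 => exact ⟨0, by simp⟩
  | hadd x y hx hy =>
    obtain ⟨a, ha⟩ := hx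
    obtain ⟨b, hb⟩ := hy
    refine ⟨a + b, ?_⟩
    have := (layerIdeal r K δ (l + 1)).add_mem ha hb
    rwa [← add_sub_add_comm, ← mul_add, ← map_add, ← add_mul, ← mul_add] at this
  | hdiag c d =>
    obtain ⟨k, hk⟩ : ∃ k : K, BrauerC.e δ r l * (c • BrauerC.diag δ d) * BrauerC.e δ r l =
        k • BrauerC.diag δ (((Diagram.capCup r l).comp d).comp (.capCup r l)) := by
      rw [BrauerC.e, smul_mul_smul_comm, BrauerC.diag_mul_diag, smul_smul, smul_mul_smul_comm,
        BrauerC.diag_mul_diag, smul_smul]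
      exact ⟨_, rfl⟩
    rw [hk]
    rcases Diagram.lt_horizontal_or_eq_permCap hl (((Diagram.capCup r l).comp d).comp (.capCup r l))
      (fun x hx => Diagram.comp_rel_inl _ (Diagram.comp_rel_inl _ (Diagram.capCup_rel_inl hx)))
      (fun x hx => Diagram.comp_rel_inr _ (Diagram.capCup_rel_inr hx)) with h | ⟨σ, hσ⟩
    · refine ⟨0, ?_⟩
      rw [map_zero, mul_zero, sub_zero]
      exact smul_mem_layerIdeal k (TwoSidedIdeal.subset_span ⟨_, h, rfl⟩)
    · refine ⟨(k * δ ^ l) • MonoidAlgebra.of K _ σ, ?_⟩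
      have : k • BrauerC.diag δ (((Diagram.capCup r l).comp d).comp (.capCup r l)) =
          BrauerC.e δ r l * hat r K δ l ((k * δ ^ l) • MonoidAlgebra.of K _ σ) := by
        rw [hσ, diag_permCap, diag_capCup hδ, map_smul, mul_smul_comm, mul_smul_comm, smul_smul,
          hat_mul_e]
      rw [this, sub_self]
      exact TwoSidedIdeal.zero_mem _

/-! ### Recovering the group algebra from the corner modulo the next layer -/

open Classical in
/-- The coefficients of a Brauer algebra element at the diagrams obtained from `capCup l` by a
permutation of the outer vertices, as an element of the group algebra. -/
noncomputable def capCoeff (r : ℕ) {K : Type*} [Field K] (δ : K) (l : ℕ) :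
    BrauerC r K δ →ₗ[K] HypAlg K (r - l) :=
  (BrauerC.basis δ).constr K fun d =>
    if h : ∃ σ : Hyp (r - l), d = Diagram.permCap σ then
      δ ^ l • MonoidAlgebra.of K _ h.choose else 0

theorem capCoeff_permCap (σ : Hyp (r - l)) :
    capCoeff r δ l (BrauerC.diag δ (Diagram.permCap σ)) = δ ^ l • MonoidAlgebra.of K _ σ := by
  have h : ∃ τ : Hyp (r - l), Diagram.permCap σ = Diagram.permCap (r := r) τ := ⟨σ, rfl⟩
  rw [capCoeff, BrauerC.diag, Module.Basis.constr_basis, dif_pos h,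
    Diagram.permCap_injective h.choose_spec.symm]

theorem capCoeff_of_forall_ne {d : Diagram r} (h : ∀ σ : Hyp (r - l), d ≠ Diagram.permCap σ) :
    capCoeff r δ l (BrauerC.diag δ d) = 0 := by
  rw [capCoeff, BrauerC.diag, Module.Basis.constr_basis, dif_neg (by simpa using h)]

/-- The diagrams seen by `capCoeff` have at most `l` horizontal edges, so none of them occurs in the
span of the layer. -/
theorem capCoeff_of_mem_layerIdeal (hl : l ≤ r) {x : BrauerC r K δ}
    (hx : x ∈ layerIdeal r K δ (l + 1)) : capCoeff r δ l x = 0 := by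
  replace hx := mem_layerSpan_of_mem_layerIdeal hx
  induction hx using Submodule.span_induction with
  | mem x hx =>
    obtain ⟨d, hd, rfl⟩ := hx
    refine capCoeff_of_forall_ne ?_
    rintro σ rfl
    have := Diagram.horizontal_permCap_le hl σ
    omega
  | zero => exact map_zero _
  | add x y _ _ hx hy => rw [map_add, hx, hy, add_zero]
  | smul c x _ hx => rw [map_smul, hx, smul_zero]

/-- Left multiplication by an outer permutation permutes the diagrams `permCap τ` and, being
invertible, also the remaining diagrams. -/
theorem capCoeff_hat_mul (a : HypAlg K (r - l)) (x : BrauerC r K δ) :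
    capCoeff r δ l (hat r K δ l a * x) = a * capCoeff r δ l x := by
  induction a using MonoidAlgebra.induction_on with
  | add a b ha hb => rw [map_add, add_mul, map_add, ha, hb, add_mul]
  | smul c a ha => rw [map_smul, smul_mul_assoc, map_smul, ha, smul_mul_assoc]
  | of σ =>
    induction x using BrauerC.induction with
    | h0 => rw [mul_zero, map_zero, mul_zero]
    | hadd x y hx hy => rw [mul_add, map_add, hx, hy, map_add, mul_add]
    | hdiag c d =>
      rw [mul_smul_comm, map_smul, map_smul, mul_smul_comm]
      congr 1
      rw [hat_of, ofPerm_mul_diag]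
      by_cases h : ∃ τ : Hyp (r - l), d = Diagram.permCap τ
      · obtain ⟨τ, rfl⟩ := h
        rw [Diagram.ofPerm_comp_permCap, capCoeff_permCap, capCoeff_permCap, map_mul,
          mul_smul_comm]
      · push Not at h
        rw [capCoeff_of_forall_ne h, mul_zero, capCoeff_of_forall_ne]
        intro τ hτ
        refine h (σ⁻¹ * τ) ?_
        rw [← Diagram.ofPerm_comp_permCap, ← hτ, ← Diagram.comp_assoc, ← Diagram.ofPerm_mul,
          ← map_mul, inv_mul_cancel, map_one, Diagram.one_comp]

theorem capCoeff_e (hδ : δ ≠ 0) : capCoeff r δ l (BrauerC.e δ r l) = 1 := by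
  have h := diag_permCap (r := r) (δ := δ) (l := l) 1
  rw [map_one, map_one, one_mul] at h
  rw [BrauerC.e, map_smul, ← h, capCoeff_permCap, smul_smul,
    inv_mul_cancel₀ (pow_ne_zero l hδ), one_smul, map_one]

end CornerAlgebra

open MulOpposite
open scoped TensorProduct

/-! ### Induced modules -/

section Induced

variable (r : ℕ) (K : Type*) [Field K] (δ : K)

/-- The submodule `Z J_m` of a right module `Z` over the Brauer algebra. -/
noncomputable def layerSMul (m : ℕ) (Z : Type*) [AddCommGroup Z] [Module (BrauerC r K δ)ᵐᵒᵖ Z] :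
    Submodule (BrauerC r K δ)ᵐᵒᵖ Z :=
  Submodule.span _ {x | ∃ j ∈ layerIdeal r K δ m, ∃ z : Z, x = op j • z}

variable {r K δ}

theorem map_mem_layerSMul {m : ℕ} {Z Z' : Type*} [AddCommGroup Z] [Module (BrauerC r K δ)ᵐᵒᵖ Z]
    [AddCommGroup Z'] [Module (BrauerC r K δ)ᵐᵒᵖ Z'] (f : Z →ₗ[(BrauerC r K δ)ᵐᵒᵖ] Z') {z : Z}
    (hz : z ∈ layerSMul r K δ m Z) : f z ∈ layerSMul r K δ m Z' := by
  induction hz using Submodule.span_induction with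
  | mem x hx =>
    obtain ⟨j, hj, z, rfl⟩ := hx
    exact Submodule.subset_span ⟨j, hj, f z, map_smul f _ _⟩
  | zero => rw [map_zero]; exact zero_mem _
  | add x y _ _ hx hy => rw [map_add]; exact add_mem hx hy
  | smul c x _ hx => rw [map_smul]; exact Submodule.smul_mem _ _ hx

variable (r K δ) (l : ℕ) {X : Type*} [AddCommGroup X] [Module (BrauerC r K δ) X]
  [Module (BrauerC r K δ)ᵐᵒᵖ X] [SMulCommClass (BrauerC r K δ) (BrauerC r K δ)ᵐᵒᵖ X]
  {M : Type*} [AddCommGroup M] [Module (HypAlg K (r - l))ᵐᵒᵖ M]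

/-- The element `e_l x` of `e_l X`. -/
noncomputable def cornerMk (x : X) : corner r K δ l X :=
  ⟨BrauerC.e δ r l • x, LinearMap.mem_range_self _ x⟩

/-- The pure tensor `m ⊗ n`. -/
noncomputable def balMk (m : M) (n : corner r K δ l X) :
    BalTensor (HypAlg K (r - l)) (BrauerC r K δ) M (corner r K δ l X) :=
  Submodule.Quotient.mk (n ⊗ₜ[ℤ] m)

/-- The element `m ⊗ e_l ξ`. -/
noncomputable def indGen (ξ : X) (m : M) :
    BalTensor (HypAlg K (r - l)) (BrauerC r K δ) M (corner r K δ l X) :=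
  balMk r K δ l m (cornerMk r K δ l ξ)

variable {r K δ l}

theorem exists_cornerMk_eq (n : corner r K δ l X) : ∃ x, cornerMk r K δ l x = n := by
  obtain ⟨x, hx⟩ := n.2
  exact ⟨x, Subtype.ext hx⟩

theorem op_smul_cornerMk (b : BrauerC r K δ) (x : X) :
    op b • cornerMk r K δ l x = cornerMk r K δ l (op b • x) :=
  Subtype.ext (smul_comm (BrauerC.e δ r l) (op b) x).symm

theorem smul_cornerMk (a : HypAlg K (r - l)) (x : X) :
    a • cornerMk r K δ l x = cornerMk r K δ l (hat r K δ l a • x) := by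
  refine Subtype.ext ?_
  change hat r K δ l a • (BrauerC.e δ r l • x) = BrauerC.e δ r l • (hat r K δ l a • x)
  rw [smul_smul, smul_smul, hat_mul_e]

theorem cornerMk_e_smul (hδ : δ ≠ 0) (hl : l ≤ r) (x : X) :
    cornerMk r K δ l (BrauerC.e δ r l • x) = cornerMk r K δ l x := by
  refine Subtype.ext ?_
  change BrauerC.e δ r l • (BrauerC.e δ r l • x) = BrauerC.e δ r l • x
  rw [smul_smul, e_mul_e hδ hl]

theorem op_smul_balMk (b : BrauerC r K δ) (m : M) (n : corner r K δ l X) :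
    op b • balMk r K δ l m n = balMk r K δ l m (op b • n) := rfl

theorem balMk_op_smul (a : HypAlg K (r - l)) (m : M) (n : corner r K δ l X) :
    balMk r K δ l (op a • m) n = balMk r K δ l m (a • n) :=
  (Submodule.Quotient.eq _).2 (Submodule.subset_span ⟨a, m, n, rfl⟩)

theorem indGen_add (ξ : X) (m m' : M) :
    indGen r K δ l ξ (m + m') = indGen r K δ l ξ m + indGen r K δ l ξ m' :=
  congrArg Submodule.Quotient.mk (TensorProduct.tmul_add _ _ _)

theorem indGen_zero (ξ : X) : indGen r K δ l ξ (0 : M) = 0 :=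
  congrArg Submodule.Quotient.mk (TensorProduct.tmul_zero _ _)

variable (r K δ) in
/-- A generator of a bimodule that commutes with the algebra. -/
structure IsCentralGenerator (ξ : X) : Prop where
  exists_smul : ∀ x : X, ∃ b : BrauerC r K δ, x = b • ξ
  smul_eq : ∀ b : BrauerC r K δ, b • ξ = op b • ξ

/-- The group algebra element crosses the tensor sign, commutes with `e_l`, and becomes a right
factor because `ξ` is central. -/
theorem IsCentralGenerator.indGen_smul {ξ : X} (hξ : IsCentralGenerator r K δ ξ)
    (a : HypAlg K (r - l)) (m : M) :
    indGen r K δ l ξ (op a • m) = op (hat r K δ l a) • indGen r K δ l ξ m := by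
  rw [indGen, balMk_op_smul, smul_cornerMk, hξ.smul_eq, ← op_smul_cornerMk, ← op_smul_balMk]
  rfl

theorem IsCentralGenerator.e_smul_indGen {ξ : X} (hξ : IsCentralGenerator r K δ ξ)
    (hδ : δ ≠ 0) (hl : l ≤ r) (m : M) :
    op (BrauerC.e δ r l) • indGen r K δ l ξ m = indGen r K δ l ξ m := by
  rw [indGen, op_smul_balMk, op_smul_cornerMk, ← hξ.smul_eq, cornerMk_e_smul hδ hl]

theorem IsCentralGenerator.induction {ξ : X} (hξ : IsCentralGenerator r K δ ξ)
    {P : BalTensor (HypAlg K (r - l)) (BrauerC r K δ) M (corner r K δ l X) → Prop} (z)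
    (h0 : P 0) (hadd : ∀ x y, P x → P y → P (x + y))
    (hgen : ∀ (b : BrauerC r K δ) (m : M), P (op b • indGen r K δ l ξ m)) : P z := by
  induction z using Submodule.Quotient.induction_on with | _ z
  induction z using TensorProduct.induction_on with
  | zero => exact h0
  | add x y hx hy => exact hadd _ _ hx hy
  | tmul n m =>
    obtain ⟨x, rfl⟩ := exists_cornerMk_eq n
    obtain ⟨b, rfl⟩ := hξ.exists_smul x
    have := hgen b m
    rwa [indGen, op_smul_balMk, op_smul_cornerMk, ← hξ.smul_eq] at this

/-- Modulo the layer ideal the idempotent maps the induced module to `M ⊗ e_l`. -/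
theorem IsCentralGenerator.exists_e_smul_sub_mem {ξ : X} (hξ : IsCentralGenerator r K δ ξ)
    (hδ : δ ≠ 0) (hl : l ≤ r)
    (z : BalTensor (HypAlg K (r - l)) (BrauerC r K δ) M (corner r K δ l X)) :
    ∃ m : M, op (BrauerC.e δ r l) • z - indGen r K δ l ξ m ∈ layerSMul r K δ (l + 1) _ := by
  induction z using hξ.induction with
  | h0 =>
    refine ⟨0, ?_⟩
    rw [smul_zero, indGen_zero, sub_zero]
    exact zero_mem _
  | hadd x y hx hy =>
    obtain ⟨m, hm⟩ := hx
    obtain ⟨m', hm'⟩ := hy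
    refine ⟨m + m', ?_⟩
    rw [smul_add, indGen_add, add_sub_add_comm]
    exact add_mem hm hm'
  | hgen b m =>
    obtain ⟨a, ha⟩ := exists_e_mul_e_sub_mem hδ hl b
    -- Since `(m ⊗ e_l ξ) e_l = m ⊗ e_l ξ`, multiplying by `b e_l` is multiplying by `e_l b e_l`,
    -- which is `e_l` times the image of `a` up to an element of `J_{l+1}`.
    refine ⟨op a • m, Submodule.subset_span ⟨_, ha, indGen r K δ l ξ m, ?_⟩⟩
    rw [op_sub, sub_smul, hξ.indGen_smul]
    congr 1
    · conv_lhs => rw [← hξ.e_smul_indGen hδ hl m]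
      rw [smul_smul, smul_smul, op_mul, op_mul, mul_assoc]
    · rw [op_mul, ← smul_smul, hξ.e_smul_indGen hδ hl]

/-- The induced module of a finitely generated module is finitely generated. -/
theorem IsCentralGenerator.finite {ξ : X} (hξ : IsCentralGenerator r K δ ξ)
    [Module.Finite (HypAlg K (r - l))ᵐᵒᵖ M] : Module.Finite (BrauerC r K δ)ᵐᵒᵖ
      (BalTensor (HypAlg K (r - l)) (BrauerC r K δ) M (corner r K δ l X)) := by
  obtain ⟨S, hS⟩ := (Module.Finite.fg_top : (⊤ : Submodule (HypAlg K (r - l))ᵐᵒᵖ M).FG)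
  classical
  refine ⟨⟨S.image (indGen r K δ l ξ), ?_⟩⟩
  rw [Submodule.eq_top_iff']
  intro z
  induction z using hξ.induction with
  | h0 => exact zero_mem _
  | hadd x y hx hy => exact add_mem hx hy
  | hgen b m =>
    refine Submodule.smul_mem _ _ ?_
    have hm : m ∈ Submodule.span (HypAlg K (r - l))ᵐᵒᵖ (S : Set M) := by rw [hS]; trivial
    induction hm using Submodule.span_induction with
    | mem x hx => exact Submodule.subset_span (Finset.mem_coe.2 (Finset.mem_image_of_mem _ hx))
    | zero =>
      rw [indGen_zero]; exact zero_mem _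
    | add x y _ _ hx hy => rw [indGen_add]; exact add_mem hx hy
    | smul a x _ hx =>
      have := hξ.indGen_smul a.unop x
      rw [op_unop] at this
      rw [this]
      exact Submodule.smul_mem _ _ hx

end Induced

/-! ### The two induction functors -/

section Functors

variable {r : ℕ} {K : Type*} [Field K] {δ : K} {l : ℕ}

theorem isCentralGenerator_one : IsCentralGenerator r K δ (1 : BrauerC r K δ) where
  exists_smul x := ⟨x, (mul_one x).symm⟩
  smul_eq b := (mul_one b).trans (one_mul b).symm

theorem isCentralGenerator_mk_one (m : ℕ) :
    IsCentralGenerator r K δ (Submodule.Quotient.mk 1 : LayerQuotient r K δ m) where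
  exists_smul x := by
    induction x using Submodule.Quotient.induction_on with | _ x
    exact ⟨x, by rw [smul_mk_layer, mul_one]⟩
  smul_eq b := by
    rw [smul_mk_layer, ← Submodule.Quotient.mk_smul]
    exact congrArg Submodule.Quotient.mk ((mul_one b).trans (one_mul b).symm)

/-- With the next two instances `M(l,λ)` has finite length, as Fitting's lemma requires. -/
instance : IsNoetherianRing (BrauerC r K δ)ᵐᵒᵖ :=
  have : Module.Finite K (BrauerC r K δ)ᵐᵒᵖ := Module.Finite.equiv (opLinearEquiv K)
  isNoetherian_of_tower K inferInstance

instance : IsArtinianRing (BrauerC r K δ)ᵐᵒᵖ :=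
  have : Module.Finite K (BrauerC r K δ)ᵐᵒᵖ := Module.Finite.equiv (opLinearEquiv K)
  isArtinian_of_tower K inferInstance

instance (lam : BiPartition (r - l)) :
    Module.Finite (BrauerC r K δ)ᵐᵒᵖ (BrauerPermModule r K δ l lam) :=
  isCentralGenerator_one.finite

variable {M Y : Type*} [AddCommGroup M] [Module (HypAlg K (r - l))ᵐᵒᵖ M]
  [AddCommGroup Y] [Module (HypAlg K (r - l))ᵐᵒᵖ Y]

/-- Right multiplication by `j` acts on the factor in `B/J_{l+1}`, where it is zero. Hence every
homomorphism to `ind_l Y` kills the submodule `layerSMul`. -/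
theorem op_smul_smallInd {j : BrauerC r K δ} (hj : j ∈ layerIdeal r K δ (l + 1))
    (z : SmallInd r K δ l Y) : op j • z = 0 := by
  induction z using (isCentralGenerator_mk_one (l + 1)).induction with
  | h0 => exact smul_zero _
  | hadd x y hx hy => rw [smul_add, hx, hy, add_zero]
  | hgen b m =>
    rw [smul_smul, ← op_mul, indGen, op_smul_balMk, op_smul_cornerMk,
      ← (isCentralGenerator_mk_one (l + 1)).smul_eq, smul_mk_layer, mul_one]
    have : (Submodule.Quotient.mk (b * j) : LayerQuotient r K δ (l + 1)) = 0 :=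
      (Submodule.Quotient.mk_eq_zero _).2 ((layerIdeal r K δ (l + 1)).mul_mem_left b j hj)
    have h0 : cornerMk r K δ l (0 : LayerQuotient r K δ (l + 1)) = 0 :=
      Subtype.ext (smul_zero _)
    rw [this, h0]
    exact congrArg Submodule.Quotient.mk (TensorProduct.zero_tmul _ _)

theorem eq_zero_of_mem_layerSMul_smallInd {z : SmallInd r K δ l Y}
    (hz : z ∈ layerSMul r K δ (l + 1) _) : z = 0 := by
  have : layerSMul r K δ (l + 1) (SmallInd r K δ l Y) = ⊥ := by
    rw [layerSMul, Submodule.span_eq_bot]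
    rintro _ ⟨j, hj, z, rfl⟩
    exact op_smul_smallInd hj z
  rw [this] at hz
  exact hz

/-- The map `[x] ↦ capCoeff (x e_l)` on the quotient by the next layer. -/
noncomputable def layerCoeff (r : ℕ) (K : Type*) [Field K] (δ : K) (l : ℕ) (hl : l ≤ r) :
    LayerQuotient r K δ (l + 1) →+ HypAlg K (r - l) :=
  QuotientAddGroup.lift (layerSubmodule r K δ (l + 1)).toAddSubgroup
    ((capCoeff r δ l).toAddMonoidHom.comp (AddMonoidHom.mulRight (BrauerC.e δ r l))) fun _ hx =>
    capCoeff_of_mem_layerIdeal hl ((layerIdeal r K δ (l + 1)).mul_mem_right _ _ hx)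

theorem layerCoeff_mk (hl : l ≤ r) (x : BrauerC r K δ) :
    layerCoeff r K δ l hl (Submodule.Quotient.mk x) = capCoeff r δ l (x * BrauerC.e δ r l) := rfl

theorem layerCoeff_hat_smul (hl : l ≤ r) (a : HypAlg K (r - l)) (x : LayerQuotient r K δ (l + 1)) :
    layerCoeff r K δ l hl (hat r K δ l a • x) = a * layerCoeff r K δ l hl x := by
  induction x using Submodule.Quotient.induction_on with | _ x
  rw [smul_mk_layer, layerCoeff_mk, layerCoeff_mk, mul_assoc, capCoeff_hat_mul]

/-- The additive map `m ⊗ n ↦ m · layerCoeff n`. -/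
noncomputable def smallIndCoeff (hl : l ≤ r) (Y : Type*) [AddCommGroup Y]
    [Module (HypAlg K (r - l))ᵐᵒᵖ Y] :
    corner r K δ l (LayerQuotient r K δ (l + 1)) ⊗[ℤ] Y →+ Y :=
  TensorProduct.liftAddHom
    (AddMonoidHom.mk' (fun n => DistribSMul.toAddMonoidHom Y (op (layerCoeff r K δ l hl n.1)))
      fun n n' => by
        ext y
        change op (layerCoeff r K δ l hl (n.1 + n'.1)) • y =
          op (layerCoeff r K δ l hl n.1) • y + op (layerCoeff r K δ l hl n'.1) • y
        rw [map_add, op_add, add_smul])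
    fun c n y => by
      change op (layerCoeff r K δ l hl (c • n.1)) • y =
        op (layerCoeff r K δ l hl n.1) • (c • y)
      rw [map_zsmul, op_smul, smul_assoc, smul_comm]

theorem smallIndCoeff_tmul (hl : l ≤ r) (n : corner r K δ l (LayerQuotient r K δ (l + 1))) (y : Y) :
    smallIndCoeff hl Y (n ⊗ₜ y) = op (layerCoeff r K δ l hl n.1) • y := rfl

/-- The map `y ↦ y ⊗ e_l` to the small induced module is injective. -/
theorem indGen_mk_one_injective (hδ : δ ≠ 0) (hl : l ≤ r) : Function.Injective
    (indGen r K δ l (Submodule.Quotient.mk 1 : LayerQuotient r K δ (l + 1)) : Y → _) := by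
  -- `smallIndCoeff` is only additive, whereas the relations span a `B`-submodule; the statement for
  -- all translates `c • x` is what survives the induction on the span.
  have hspan : ∀ x ∈ Submodule.span (BrauerC r K δ)ᵐᵒᵖ
      {x : corner r K δ l (LayerQuotient r K δ (l + 1)) ⊗[ℤ] Y |
        ∃ (a : HypAlg K (r - l)) (m : Y) (n : corner r K δ l (LayerQuotient r K δ (l + 1))),
          x = n ⊗ₜ[ℤ] (op a • m) - (a • n) ⊗ₜ[ℤ] m},
      ∀ c : (BrauerC r K δ)ᵐᵒᵖ, smallIndCoeff hl Y (c • x) = 0 := by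
    intro x hx
    induction hx using Submodule.span_induction with
    | mem x hx =>
      obtain ⟨a, m, n, rfl⟩ := hx
      intro c
      rw [smul_sub, TensorProduct.smul_tmul', TensorProduct.smul_tmul', map_sub,
        smallIndCoeff_tmul, smallIndCoeff_tmul, sub_eq_zero, smul_smul, ← op_mul]
      congr 2
      rw [← layerCoeff_hat_smul]
      congr 1
      exact smul_comm (hat r K δ l a) c n.1
    | zero => intro c; rw [smul_zero, map_zero]
    | add x y _ _ hx hy => intro c; rw [smul_add, map_add, hx, hy, add_zero]
    | smul b x _ hx => intro c; rw [smul_smul]; exact hx _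
  intro y y' h
  have h1 := hspan _ ((Submodule.Quotient.eq _).1 h) 1
  rw [one_smul, map_sub, smallIndCoeff_tmul, smallIndCoeff_tmul] at h1
  -- The coefficient of `e_l` is `1`, so `smallIndCoeff` is a left inverse of `y ↦ y ⊗ e_l`.
  have h2 : layerCoeff r K δ l hl
      (cornerMk r K δ l (Submodule.Quotient.mk 1 : LayerQuotient r K δ (l + 1))).1 = 1 := by
    change capCoeff r δ l (BrauerC.e δ r l * 1 * BrauerC.e δ r l) = 1
    rw [mul_one, e_mul_e hδ hl, capCoeff_e hδ]
  rw [h2, op_one, one_smul, one_smul, sub_eq_zero] at h1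
  exact h1

variable (r K δ l) in
/-- The projection `e_l B → e_l (B / J_{l+1})`. -/
noncomputable def cornerProj : corner r K δ l (BrauerC r K δ) →ₗ[(BrauerC r K δ)ᵐᵒᵖ]
    corner r K δ l (LayerQuotient r K δ (l + 1)) :=
  (layerSubmodule r K δ (l + 1)).mkQ.restrict (by
    rintro _ ⟨x, rfl⟩
    exact ⟨Submodule.Quotient.mk x, rfl⟩)

variable (δ) in
/-- The map `Ind_l M → ind_l Y` induced by a homomorphism `M → Y`. -/
noncomputable def bigToSmall (f : M →ₗ[(HypAlg K (r - l))ᵐᵒᵖ] Y) :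
    BigInd r K δ l M →ₗ[(BrauerC r K δ)ᵐᵒᵖ] SmallInd r K δ l Y :=
  Submodule.mapQ _ _ (TensorProduct.AlgebraTensorModule.map (cornerProj r K δ l)
    f.toAddMonoidHom.toIntLinearMap) <| by
    refine Submodule.span_le.2 ?_
    rintro _ ⟨a, m, n, rfl⟩
    refine Submodule.subset_span ⟨a, f m, cornerProj r K δ l n, ?_⟩
    rw [map_sub, TensorProduct.AlgebraTensorModule.map_tmul,
      TensorProduct.AlgebraTensorModule.map_tmul]
    congr 2
    exact map_smul f (op a) m

theorem bigToSmall_indGen (f : M →ₗ[(HypAlg K (r - l))ᵐᵒᵖ] Y) (m : M) :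
    bigToSmall δ f (indGen r K δ l 1 m) = indGen r K δ l (Submodule.Quotient.mk 1) (f m) := rfl

end Functors

/-! ### Young modules of the Brauer algebra -/

section BrauerYoung

variable {r : ℕ} {K : Type*} [Field K] {δ : K} {l : ℕ}
  {M : Type*} [AddCommGroup M] [Module (HypAlg K (r - l))ᵐᵒᵖ M]

theorem exists_e_smul_smallInd (hδ : δ ≠ 0) (hl : l ≤ r) (z : SmallInd r K δ l M) :
    ∃ m : M, indGen r K δ l (Submodule.Quotient.mk 1 : LayerQuotient r K δ (l + 1)) m =
      op (BrauerC.e δ r l) • z := by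
  obtain ⟨m, hm⟩ := (isCentralGenerator_mk_one (l + 1)).exists_e_smul_sub_mem hδ hl z
  exact ⟨m, (sub_eq_zero.1 (eq_zero_of_mem_layerSMul_smallInd hm)).symm⟩

/-- A homomorphism `Ind_l M → ind_l Y` restricts to a homomorphism `M → Y` modulo the next layer. -/
theorem exists_restrict (hδ : δ ≠ 0) (hl : l ≤ r) {Y : Type*} [AddCommGroup Y]
    [Module (HypAlg K (r - l))ᵐᵒᵖ Y]
    (k : BigInd r K δ l M →ₗ[(BrauerC r K δ)ᵐᵒᵖ] SmallInd r K δ l Y) :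
    ∃ φ : M →ₗ[(HypAlg K (r - l))ᵐᵒᵖ] Y, ∀ m,
      indGen r K δ l (Submodule.Quotient.mk 1 : LayerQuotient r K δ (l + 1)) (φ m) =
        op (BrauerC.e δ r l) • k (indGen r K δ l 1 m) := by
  choose φ hφ using fun m => exists_e_smul_smallInd hδ hl (k (indGen r K δ l 1 m))
  refine ⟨{ toFun := φ, map_add' := fun m m' => ?_, map_smul' := fun a m => ?_ }, hφ⟩
  -- The chosen values are determined by their images, so linearity of `φ` is inherited from `k`.
  · apply indGen_mk_one_injective hδ hl
    rw [hφ, indGen_add, indGen_add, map_add, smul_add, hφ, hφ]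
  · apply indGen_mk_one_injective hδ hl
    obtain ⟨a, rfl⟩ := op_surjective a
    rw [hφ, isCentralGenerator_one.indGen_smul, RingHom.id_apply,
      (isCentralGenerator_mk_one (l + 1)).indGen_smul, hφ, map_smul, smul_smul, smul_smul,
      ← op_mul, ← op_mul, hat_mul_e]

/-- The elements `y ⊗ e_l` generate `ind_l Y` as a `B`-module. -/
theorem surjective_of_surjective_restrict {Z Y : Type*} [AddCommGroup Y]
    [Module (HypAlg K (r - l))ᵐᵒᵖ Y] [AddCommGroup Z] [Module (BrauerC r K δ)ᵐᵒᵖ Z]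
    (g : Z →ₗ[(BrauerC r K δ)ᵐᵒᵖ] SmallInd r K δ l Y)
    (h : ∀ y : Y, ∃ x, g x =
      indGen r K δ l (Submodule.Quotient.mk 1 : LayerQuotient r K δ (l + 1)) y) :
    Function.Surjective g := by
  intro z
  induction z using (isCentralGenerator_mk_one (l + 1)).induction with
  | h0 => exact ⟨0, map_zero g⟩
  | hadd x y hx hy =>
    obtain ⟨x, rfl⟩ := hx
    obtain ⟨y, rfl⟩ := hy
    exact ⟨x + y, map_add g x y⟩
  | hgen b m =>
    obtain ⟨x, hx⟩ := h m
    exact ⟨op b • x, by rw [map_smul, hx]⟩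

variable {lam : BiPartition (r - l)}

/-- The product of `e_l` and a column sum acts on `M(l, lam)` with rank at most one modulo the next
layer. -/
theorem exists_e_mul_columnSum_smul_sub_mem (hδ : δ ≠ 0) (hl : l ≤ r) (t : BiTableau lam)
    (x : BrauerPermModule r K δ l lam) : ∃ c : K,
      op (BrauerC.e δ r l * hat r K δ l (columnSum K t)) • x -
        op (algebraMap K (BrauerC r K δ) c) • indGen r K δ l 1 (polytabloid K t) ∈
          layerSMul r K δ (l + 1) (BrauerPermModule r K δ l lam) := by
  have hB : IsCentralGenerator r K δ (1 : BrauerC r K δ) := isCentralGenerator_one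
  -- In the right action `e_l` comes first and leaves `m ⊗ e_l` modulo the layer; the column sum
  -- then acts on `m` alone, with values in the line of the polytabloid.
  obtain ⟨m, hm⟩ := hB.exists_e_smul_sub_mem hδ hl x
  obtain ⟨c, hc⟩ := exists_columnSum_smul_eq K t m
  refine ⟨c, ?_⟩
  have := Submodule.smul_mem _ (op (hat r K δ l (columnSum K t))) hm
  rwa [smul_sub, smul_smul, ← op_mul, ← hB.indGen_smul, hc, ← PermModule.op_algebraMap_smul,
    hB.indGen_smul, AlgHom.commutes] at this

/-- Two vectors on the line of `v` modulo `T`, the first of them nonzero there, are proportional.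
The scalar `d / c` is realised inside the algebra. -/
theorem exists_smul_sub_smul_mem {Z : Type*} [AddCommGroup Z] [Module (BrauerC r K δ)ᵐᵒᵖ Z]
    {T : Submodule (BrauerC r K δ)ᵐᵒᵖ Z} {v x y : Z} {c d : K}
    (hc : x - op (algebraMap K (BrauerC r K δ) c) • v ∈ T)
    (hd : y - op (algebraMap K (BrauerC r K δ) d) • v ∈ T) (hx : x ∉ T) :
    ∃ a : (BrauerC r K δ)ᵐᵒᵖ, y - a • x ∈ T := by
  have hc0 : c ≠ 0 := by
    rintro rfl
    rw [map_zero, op_zero, zero_smul, sub_zero] at hc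
    exact hx hc
  refine ⟨op (algebraMap K (BrauerC r K δ) (d * c⁻¹)), ?_⟩
  have := sub_mem hd (T.smul_mem (op (algebraMap K (BrauerC r K δ) (d * c⁻¹))) hc)
  rwa [smul_sub, smul_smul, ← op_mul, ← map_mul, mul_comm c, mul_assoc, inv_mul_cancel₀ hc0,
    mul_one, sub_sub_sub_cancel_right] at this

/-- On `y ⊗ e_l` the idempotent is the identity and the column sum acts on `y`; the embedding `y ↦ y
⊗ e_l` carries the nonvanishing over from `Y`. -/
theorem exists_smul_smallInd_ne_zero (hδ : δ ≠ 0) (hl : l ≤ r)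
    {Y : Submodule (HypAlg K (r - l))ᵐᵒᵖ (PermModule K lam)} (hY : IsYoungModule K lam Y)
    (t : BiTableau lam) : ∃ z : SmallInd r K δ l Y,
      op (BrauerC.e δ r l * hat r K δ l (columnSum K t)) • z ≠ 0 := by
  obtain ⟨y, hy⟩ := hY.exists_columnSum_smul_ne t
  have hQ := isCentralGenerator_mk_one (r := r) (K := K) (δ := δ) (l + 1)
  refine ⟨indGen r K δ l (Submodule.Quotient.mk 1) y, fun h => hy ?_⟩
  rw [op_mul, ← smul_smul, hQ.e_smul_indGen hδ hl, ← hQ.indGen_smul] at h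
  exact indGen_mk_one_injective hδ hl (h.trans (indGen_zero _).symm)

theorem exists_surjective_of_restrict {Y : Type*} [AddCommGroup Y]
    [Module (HypAlg K (r - l))ᵐᵒᵖ Y]
    {N C : Submodule (BrauerC r K δ)ᵐᵒᵖ (BigInd r K δ l M)} (hNC : IsCompl N C)
    (p : BigInd r K δ l M →ₗ[(BrauerC r K δ)ᵐᵒᵖ] SmallInd r K δ l Y)
    (h : ∀ y : Y, ∃ m : M,
      indGen r K δ l (Submodule.Quotient.mk 1 : LayerQuotient r K δ (l + 1)) y =
        op (BrauerC.e δ r l) • (p ∘ₗ N.projection C hNC) (indGen r K δ l 1 m)) :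
    ∃ f : N →ₗ[(BrauerC r K δ)ᵐᵒᵖ] SmallInd r K δ l Y, Function.Surjective f := by
  refine ⟨p ∘ₗ N.subtype, surjective_of_surjective_restrict _ fun y => ?_⟩
  obtain ⟨m, hm⟩ := h y
  refine ⟨op (BrauerC.e δ r l) • N.projectionOnto C hNC (indGen r K δ l 1 m), ?_⟩
  rw [map_smul]
  exact hm.symm

set_option maxHeartbeats 400000 in
/-- If `Y` is an indecomposable summand of `M`, then in every decomposition of `Ind_l M` in two
summands one of them maps onto `ind_l Y`. -/
theorem exists_surjective_smallInd (hδ : δ ≠ 0) (hl : l ≤ r)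
    {Y Y' : Submodule (HypAlg K (r - l))ᵐᵒᵖ M} [IsArtinian (HypAlg K (r - l))ᵐᵒᵖ M]
    [IsNoetherian (HypAlg K (r - l))ᵐᵒᵖ M] (hYY' : IsCompl Y Y')
    (hY : Indecomposable (HypAlg K (r - l))ᵐᵒᵖ Y)
    {N C : Submodule (BrauerC r K δ)ᵐᵒᵖ (BigInd r K δ l M)} (hNC : IsCompl N C) :
    (∃ f : N →ₗ[(BrauerC r K δ)ᵐᵒᵖ] SmallInd r K δ l Y, Function.Surjective f) ∨
      ∃ f : C →ₗ[(BrauerC r K δ)ᵐᵒᵖ] SmallInd r K δ l Y, Function.Surjective f := by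
  obtain ⟨p, hp⟩ : ∃ p : BigInd r K δ l M →ₗ[(BrauerC r K δ)ᵐᵒᵖ] SmallInd r K δ l Y, ∀ y : Y,
      p (indGen r K δ l 1 y.1) = indGen r K δ l (Submodule.Quotient.mk 1) y :=
    ⟨bigToSmall δ (Y.projectionOnto Y' hYY'), fun y => by
      rw [bigToSmall_indGen, Submodule.projectionOnto_apply_left]⟩
  obtain ⟨φ, hφ⟩ := exists_restrict hδ hl (p ∘ₗ N.projection C hNC)
  obtain ⟨ψ, hψ⟩ := exists_restrict hδ hl (p ∘ₗ C.projection N hNC.symm)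
  -- The two projections add up to the identity, and both `p` and the cut by `e_l` leave `y ⊗ e_l`
  -- as it is.
  have hadd : ∀ y : Y, φ y.1 + ψ y.1 = y := by
    intro y
    refine indGen_mk_one_injective (δ := δ) hδ hl ?_
    have hpr := congrArg p
      (Submodule.projection_add_projection_eq_self hNC (indGen r K δ l 1 y.1))
    rw [map_add, hp] at hpr
    have he := (isCentralGenerator_mk_one (l + 1)).e_smul_indGen hδ hl y
    rw [← hpr, smul_add] at he
    rw [indGen_add, hφ, hψ]
    exact he.trans hpr
  have hsum : φ ∘ₗ Y.subtype + ψ ∘ₗ Y.subtype = (1 : Module.End (HypAlg K (r - l))ᵐᵒᵖ Y) :=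
    LinearMap.ext hadd
  -- If the restriction of `φ` to `Y` is bijective, every `y ⊗ e_l` is the image of an element of
  -- `N`; likewise with `ψ` and `C`.
  rcases hY.bijective_or_bijective hsum with hb | hb
  · refine Or.inl (exists_surjective_of_restrict hNC p fun y => ?_)
    obtain ⟨y, rfl⟩ := hb.2 y
    exact ⟨y.1, hφ y.1⟩
  · refine Or.inr (exists_surjective_of_restrict hNC.symm p fun y => ?_)
    obtain ⟨y, rfl⟩ := hb.2 y
    exact ⟨y.1, hψ y.1⟩

theorem rankOneTest (hδ : δ ≠ 0) (hl : l ≤ r)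
    {Y : Submodule (HypAlg K (r - l))ᵐᵒᵖ (PermModule K lam)} (hY : IsYoungModule K lam Y)
    (t : BiTableau lam) :
    RankOneTest (X := BrauerPermModule r K δ l lam)
      (op (BrauerC.e δ r l * hat r K δ l (columnSum K t))) (layerSMul r K δ (l + 1) _)
      (SmallInd r K δ l Y) where
  invariant f x hx := map_mem_layerSMul f hx
  killed f x hx := eq_zero_of_mem_layerSMul_smallInd (map_mem_layerSMul f hx)
  rank_le x y hx := by
    obtain ⟨c, hc⟩ := exists_e_mul_columnSum_smul_sub_mem hδ hl t x
    obtain ⟨d, hd⟩ := exists_e_mul_columnSum_smul_sub_mem hδ hl t y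
    exact exists_smul_sub_smul_mem hc hd hx
  exists_smul_ne := exists_smul_smallInd_ne_zero hδ hl hY t
  exists_surjective N C hNC := by
    obtain ⟨⟨Y', hYY'⟩, hind, -⟩ := hY
    exact exists_surjective_smallInd hδ hl hYY' hind hNC

end BrauerYoung

end TypeC

theorem mainTheorem9 (K : Type*) [Field K] (δ : K) (hδ : δ ≠ 0) (r l : ℕ) (hl : l ≤ r)
    (lam : TypeC.BiPartition (r - l)) :
    (∃ Y, TypeC.IsYoungModule K lam Y) ∧
    ∀ Y, TypeC.IsYoungModule K lam Y →
      (∃ N, TypeC.IsBrauerYoungModule r K δ l lam Y N ∧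
        ∀ N', TypeC.IsBrauerYoungModule r K δ l lam Y N' →
          Nonempty (N' ≃ₗ[(TypeC.BrauerC r K δ)ᵐᵒᵖ] N)) ∧
      ∀ (k : ℕ) (N : Fin k → Submodule (TypeC.BrauerC r K δ)ᵐᵒᵖ
          (TypeC.BrauerPermModule r K δ l lam)),
        DirectSum.IsInternal N →
        (∀ i, TypeC.Indecomposable (TypeC.BrauerC r K δ)ᵐᵒᵖ (N i)) →
        ∃! i, TypeC.HasQuotientIso (TypeC.BrauerC r K δ)ᵐᵒᵖ (N i)
          (TypeC.SmallInd r K δ l Y) := by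
  refine ⟨TypeC.exists_isYoungModule K lam, fun Y hY => ?_⟩
  -- Any bitableau serves: the conclusions depend on `t` only through the existence of the rank-one
  -- element.
  obtain ⟨t⟩ := (inferInstance : Nonempty (TypeC.BiTableau lam))
  have h := TypeC.rankOneTest hδ hl hY t
  refine ⟨?_, fun k N hN _ => h.existsUnique_of_isInternal hN⟩
  obtain ⟨N, h1, h2, h3⟩ := h.exists_summand
  exact ⟨N, ⟨h1, h2, h3⟩, fun N' hN' => h.nonempty_equiv h1 hN'.1 h2 hN'.2.1 h3 hN'.2.2⟩
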